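/- Let $r,m\ge 1$ be integers and let $a_0,a_1,\dots,a_r\in M_m(\mathbb{C})$ with $a_0^*=a_0$. Put $K=\|a_0\|+16\sum_{j=1}^r\|a_j\|$, where $\|\cdot\|$ is the operator norm. Then there is a constant $C_2<\infty$, depending only on $r$, $m$ and $a_0,\dots,a_r$, such that the following holds. For each integer $n\ge 1$ let $Y_1^{(n)},\dots,Y_r^{(n)}$ be independent real random $n\times n$ matrices on a probability space, each with $n^2$ independent $N(0,\tfrac1n)$-distributed entries. Put $$S_n=a_0\otimes\mathbf 1_n+\sum_{j=1}^r\big(a_j\otimes Y_j^{(n)}+a_j^*\otimes (Y_j^{(n)})^*\big)\in M_m(\mathbb{C})\otimes M_n(\mathbb{C}).$$ Let $(\mathcal A,\tau)$ be a $C^*$-probability space (a unital $C^*$-algebra with a state $\tau$), and let $y_1,\dots,y_r\in\mathcal A$ be a circular system, i.e. the $2r$ elements $\tfrac1{\sqrt2}(y_j+y_j^*)$ and $\tfrac1{\mathrm i\sqrt2}(y_j-y_j^*)$, $1\le j\le r$, are free with respect to $\tau$ and each has the semicircle distribution with density $\tfrac1{2\pi}\sqrt{4-t^2}$ on $[-2,2]$.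 Put $$s=a_0\otimes\mathbf 1_{\mathcal A}+\sum_{j=1}^r\big(a_j\otimes y_j+a_j^*\otimes y_j^*\big)\in M_m(\mathbb{C})\otimes\mathcal A.$$ For $\lambda\in M_m(\mathbb{C})$ such that $\operatorname{Im}\lambda=\tfrac1{2\mathrm i}(\lambda-\lambda^*)$ is positive definite, define $$G_n(\lambda)=\mathbb{E}\big\{(\mathrm{id}_m\otimes\mathrm{tr}_n)[(\lambda\otimes\mathbf 1_n-S_n)^{-1}]\big\},\qquad G(\lambda)=(\mathrm{id}_m\otimes\tau)[(\lambda\otimes\mathbf 1_{\mathcal A}-s)^{-1}],$$ where $\mathrm{tr}_n=\tfrac1n\mathrm{Tr}_n$. Then for every $\lambda\in M_m(\mathbb{C})$ with $\operatorname{Im}\lambda$ positive definite and every integer $n\ge1$, $$\|G_n(\lambda)-G(\lambda)\|\le\frac{C_2}{n}\,(\|\lambda\|+K)^2\Big(\|(\operatorname{Im}\lambda)^{-1}\|^7+\|(\operatorname{Im}\lambda)^{-1}\|^5\Big).$$ -/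

import Mathlib

open MeasureTheory ProbabilityTheory
open scoped Matrix.Norms.L2Operator ComplexOrder NNReal

noncomputable section

/-- `Im l = (1 / 2i) (l - l*)` for a complex square matrix `l`. -/
def matIm {m : ℕ} (l : Matrix (Fin m) (Fin m) ℂ) : Matrix (Fin m) (Fin m) ℂ :=
  (2 * Complex.I)⁻¹ • (l - l.conjTranspose)

/-- The normalized trace `(1/n) Tr` on complex `n × n` matrices. -/
def normTr (n : ℕ) : Matrix (Fin n) (Fin n) ℂ →ₗ[ℂ] ℂ :=
  (n : ℂ)⁻¹ • Matrix.traceLinearMap (Fin n) ℂ ℂ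

section Tensor

variable {A : Type*} [Ring A] [Algebra ℂ A] {m r : ℕ}

/-- The elementary tensor `a ⊗ x` in `M_m(ℂ) ⊗ A`, identified with `M_m(A)`
(for `A = M_n(ℂ)`: block matrices with `n × n` blocks). -/
def tens (a : Matrix (Fin m) (Fin m) ℂ) (x : A) : Matrix (Fin m) (Fin m) A :=
  a.map (fun z => z • x)

/-- The slice map `id ⊗ φ : M_m(ℂ) ⊗ A → M_m(ℂ)`. -/
def slice (φ : A →ₗ[ℂ] ℂ) (u : Matrix (Fin m) (Fin m) A) : Matrix (Fin m) (Fin m) ℂ :=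
  u.map φ

/-- `a₀ ⊗ 1 + ∑ j, (a j ⊗ x j + (a j)* ⊗ (x j)*)`. -/
def linPencil [Star A] (a₀ : Matrix (Fin m) (Fin m) ℂ)
    (a : Fin r → Matrix (Fin m) (Fin m) ℂ) (x : Fin r → A) : Matrix (Fin m) (Fin m) A :=
  tens a₀ 1 + ∑ j, (tens (a j) (x j) + tens (a j).conjTranspose (star (x j)))

/-- `(id ⊗ φ)[(l ⊗ 1 - S)⁻¹]`, where `S` is the pencil `linPencil a₀ a x`. -/
def slicedResolvent [Star A] (φ : A →ₗ[ℂ] ℂ) (a₀ : Matrix (Fin m) (Fin m) ℂ)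
    (a : Fin r → Matrix (Fin m) (Fin m) ℂ) (x : Fin r → A) (l : Matrix (Fin m) (Fin m) ℂ) :
    Matrix (Fin m) (Fin m) ℂ :=
  slice φ (Ring.inverse (tens l 1 - linPencil a₀ a x))

end Tensor

section RandomMatrices

variable {Ω : Type*} [MeasurableSpace Ω]

/-- The class `GRM^ℝ(n, v)`: real random `n × n` matrices whose `n²` entries are independent
with distribution `N(0, v)` (variance `v`). -/
structure IsGRMReal (P : Measure Ω) {n : ℕ} (v : ℝ≥0) (Y : Ω → Matrix (Fin n) (Fin n) ℝ) :
    Prop where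
  measurable : ∀ k l, Measurable (fun ω => Y ω k l)
  indep : iIndepFun (fun (p : Fin n × Fin n) ω => Y ω p.1 p.2) P
  law : ∀ k l, P.map (fun ω => Y ω k l) = gaussianReal 0 v

variable {m r n : ℕ}

/-- `H_n(l) = (id ⊗ tr_n)[(l ⊗ 1 - S_n)⁻¹]`, where
`S_n = a₀ ⊗ 1 + ∑ j, (a j ⊗ Y j + (a j)* ⊗ (Y j)*)`. -/
def Hn (a₀ : Matrix (Fin m) (Fin m) ℂ) (a : Fin r → Matrix (Fin m) (Fin m) ℂ)
    (Y : Fin r → Ω → Matrix (Fin n) (Fin n) ℝ) (l : Matrix (Fin m) (Fin m) ℂ) (ω : Ω) :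
    Matrix (Fin m) (Fin m) ℂ :=
  slicedResolvent (normTr n) a₀ a (fun j => (Y j ω).map ((↑) : ℝ → ℂ)) l

/-- `G_n(l)`, the (entrywise) expectation of `H_n(l)`. -/
def Gn (P : Measure Ω) (a₀ : Matrix (Fin m) (Fin m) ℂ)
    (a : Fin r → Matrix (Fin m) (Fin m) ℂ) (Y : Fin r → Ω → Matrix (Fin n) (Fin n) ℝ)
    (l : Matrix (Fin m) (Fin m) ℂ) : Matrix (Fin m) (Fin m) ℂ :=
  Matrix.of fun p q => ∫ ω, Hn a₀ a Y l ω p q ∂P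

end RandomMatrices

section FreeProbability

variable {A : Type*} [CStarAlgebra A]

/-- A state on a unital C*-algebra; `(A, τ)` is then a C*-probability space. -/
structure IsState (τ : A →ₗ[ℂ] ℂ) : Prop where
  map_one : τ 1 = 1
  nonneg : ∀ x : A, 0 ≤ τ (star x * x)

/-- Freeness of a family of unital *-subalgebras: `τ (b₁ ⋯ b_k) = 0` (`k ≥ 1`) whenever the
`b`'s are centred and consecutive ones lie in subalgebras with different indices. -/
def AreFree {ι : Type*} (τ : A →ₗ[ℂ] ℂ) (B : ι → StarSubalgebra ℂ A) : Prop :=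
  ∀ w : List (ι × A), w ≠ [] → (∀ p ∈ w, p.2 ∈ B p.1 ∧ τ p.2 = 0) →
    (w.map Prod.fst).IsChain (· ≠ ·) → τ (w.map Prod.snd).prod = 0

/-- The standard semicircle law, with density `(1/2π) √(4 - t²)` on `[-2, 2]`. -/
def semicircleLaw : Measure ℝ :=
  (volume.restrict (Set.Icc (-2) 2)).withDensity
    (fun t => ENNReal.ofReal ((2 * Real.pi)⁻¹ * Real.sqrt (4 - t ^ 2)))

/-- A semicircular system: a free family of self-adjoint elements, each of which has the standard
semicircle law as its distribution (that is, the same moments). -/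
structure IsSemicircularSystem {ι : Type*} (τ : A →ₗ[ℂ] ℂ) (x : ι → A) : Prop where
  selfAdjoint : ∀ i, IsSelfAdjoint (x i)
  free : AreFree τ (fun i => StarAlgebra.adjoin ℂ {x i})
  moments : ∀ i (k : ℕ), τ (x i ^ k) = ((∫ t, t ^ k ∂semicircleLaw : ℝ) : ℂ)

/-- A circular system: the elements `(y j + (y j)*) / √2` and `(y j - (y j)*) / (i √2)`
together form a semicircular system. -/
def IsCircularSystem {r : ℕ} (τ : A →ₗ[ℂ] ℂ) (y : Fin r → A) : Prop :=
  IsSemicircularSystem τ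
    (Sum.elim (fun j => (((Real.sqrt 2 : ℝ) : ℂ))⁻¹ • (y j + star (y j)))
      (fun j => (Complex.I * ((Real.sqrt 2 : ℝ) : ℂ))⁻¹ • (y j - star (y j))) :
      Fin r ⊕ Fin r → A)

variable {m r : ℕ}

/-- `G(l) = (id ⊗ τ)[(l ⊗ 1 - s)⁻¹]`, where
`s = a₀ ⊗ 1 + ∑ j, (a j ⊗ y j + (a j)* ⊗ (y j)*)`. -/
def Glim (τ : A →ₗ[ℂ] ℂ) (a₀ : Matrix (Fin m) (Fin m) ℂ)
    (a : Fin r → Matrix (Fin m) (Fin m) ℂ) (y : Fin r → A) (l : Matrix (Fin m) (Fin m) ℂ) :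
    Matrix (Fin m) (Fin m) ℂ :=
  slicedResolvent τ a₀ a y l

end FreeProbability

end

/-! Write `η = covMap a`, `k = ‖(Im λ)⁻¹‖` and `L = ‖λ‖ + K`. Both `G` and `G_n` are compared with
the matrix Dyson equation `(λ - a₀ - η(g)) g = 1`, which `G` solves exactly and `G_n` solves up to
an error of order `1/n`.

The error for `G_n`. Gaussian integration by parts (`schwinger_dyson_realResolvent`) expresses `(λ -
a₀) G_n - 1` through the resolvent. Summing over matrix entries produces `η(H) H` for the sliced
resolvent `H`, plus transposed terms with a factor `1/n`, which are present because the matrices are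
real (`norm_E_sum_entryCoeff_mul_sub_le`). Replacing `E[η(H) H]` by `η(E H) E H` costs covariances
of entries of `H`, bounded by an Efron–Stein argument (`norm_integral_mul_sub_le`). The total is
`O(1/n) (k⁴ + k²)`.

The equation for `G`. If `g` is a small solution, the resolvent of the pencil is an explicit series
over words: the coefficients are `g c g c ⋯ g`, and the algebra factors are products of Chebyshev
polynomials, which freeness makes centred. Slicing leaves only the empty word, that is `g`
(`E_resolvent_eq_of_small`). This gives the equation for large `Im λ`, and analytic continuation
gives it for all `λ`. Solutions `g` of the required size come from the random model: a limit point
of the means as `n → ∞` solves the equation (`exists_isDysonSol`).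

Stability (`norm_sub_le_of_approx_dyson`). An approximate solution at `λ` is an exact one at a
nearby `Λ`. Solutions with negative imaginary part are unique (`IsDysonSol.unique`), so `G_n(λ) =
G(Λ)`, and the resolvent identity bounds `G(Λ) - G(λ)`. This costs `L² k³`, whence the exponents `7`
and `5`. About `K` only `‖a₀‖ ≤ K` and `∑ ‖a j‖ ≤ K` matter. -/

section CStar

/-! ### Resolvent bounds from a positive imaginary part -/

variable {B : Type*} [CStarAlgebra B]

/-- In a C*-algebra, an element whose imaginary part is at least `c > 0` is invertible, with
inverse of norm at most `1 / c`. -/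
theorem isUnit_and_norm_inverse_le_of_im {T h b : B} {c : ℝ} (hc : 0 < c)
    (hT : T - star T = (2 * Complex.I) • h) (hb : h = (c : ℂ) • 1 + star b * b) :
    IsUnit T ∧ ‖Ring.inverse T‖ ≤ c⁻¹ := by
  let _ := CStarAlgebra.spectralOrder B
  have _ := CStarAlgebra.spectralOrderedRing B
  obtain ⟨d, hd⟩ : ∃ d : ℂ, d = Complex.I * c := ⟨_, rfl⟩
  have hdd : d * d = -(c : ℂ) ^ 2 := by
    rw [hd]; linear_combination (c : ℂ) ^ 2 * Complex.I_mul_I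
  have hds : star d = -d := by simp [hd]
  have hsU : star (T - d • 1) = star T + d • 1 := by
    rw [star_sub, star_smul, hds, star_one]; module
  have key : d • T = d • star T - ((2 * c ^ 2 : ℂ) • 1 + (2 * c : ℂ) • (star b * b)) := by
    have h1 : d • (T - star T) = -((2 * c : ℂ) • h) := by
      rw [hT, smul_smul, ← neg_smul]; congr 1; rw [hd]
      linear_combination (2 * (c : ℂ)) * Complex.I_mul_I
    rw [smul_sub, hb, sub_eq_iff_eq_add] at h1
    rw [h1]; module
  -- Subtracting `ic` from `T` removes `c` from its imaginary part and leaves `star b * b`, so the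
  -- square of `T` exceeds that of the shift by `c² + 2c b*b ≥ c²`. The same holds for `T T*`; both
  -- are needed, one for each one-sided inverse.
  have e1 : star T * T = star (T - d • 1) * (T - d • 1)
      + ((c : ℂ) ^ 2 • 1 + (2 * c : ℂ) • (star b * b)) := by
    rw [hsU]
    simp only [add_mul, mul_sub, smul_mul_assoc, mul_smul_comm, one_mul, mul_one]
    rw [smul_add, key, smul_smul, hdd]
    module
  have e2 : T * star T = star (star (T - d • 1)) * star (T - d • 1)
      + ((c : ℂ) ^ 2 • 1 + (2 * c : ℂ) • (star b * b)) := by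
    rw [star_star, hsU]
    simp only [mul_add, sub_mul, smul_mul_assoc, mul_smul_comm, one_mul, mul_one]
    rw [smul_sub, key, smul_smul, hdd]
    module
  have hcc : (c : ℂ) ^ 2 • (1 : B) = algebraMap ℝ B (c ^ 2) := by
    rw [Algebra.algebraMap_eq_smul_one, ← Complex.coe_smul]; norm_cast
  have h2c : (2 * c : ℂ) • (star b * b) = (2 * c : ℝ) • (star b * b) := by
    rw [← Complex.coe_smul]; norm_cast
  have hpos : (0 : B) ≤ (2 * c : ℂ) • (star b * b) := by
    rw [h2c]; exact smul_nonneg (by positivity) (star_mul_self_nonneg b)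
  have l1 : algebraMap ℝ B (c ^ 2) ≤ star T * T := by
    rw [e1, hcc]
    exact le_add_of_nonneg_of_le (star_mul_self_nonneg _) (le_add_of_nonneg_right hpos)
  have l2 : algebraMap ℝ B (c ^ 2) ≤ T * star T := by
    rw [e2, hcc]
    exact le_add_of_nonneg_of_le (star_mul_self_nonneg _) (le_add_of_nonneg_right hpos)
  have hsp : IsStrictlyPositive (algebraMap ℝ B (c ^ 2)) := by
    refine IsUnit.isStrictlyPositive ?_ ?_
    · exact (IsUnit.mk0 (c ^ 2) (by positivity)).map (algebraMap ℝ B)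
    · rw [Algebra.algebraMap_eq_smul_one]
      exact smul_nonneg (by positivity) zero_le_one
  have u1 := CStarAlgebra.isUnit_of_le _ l1 hsp
  have u2 := CStarAlgebra.isUnit_of_le _ l2 hsp
  have hu : IsUnit T := by
    obtain ⟨a, ha⟩ := u1.exists_left_inv
    obtain ⟨a', ha'⟩ := u2.exists_right_inv
    rw [isUnit_iff_exists_and_exists]
    exact ⟨⟨star T * a', by rw [← mul_assoc, ha']⟩, ⟨a * star T, by rw [mul_assoc, ha]⟩⟩
  refine ⟨hu, ?_⟩
  set S := Ring.inverse T with hS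
  have hTS : T * S = 1 := Ring.mul_inverse_cancel _ hu
  have l3 : star S * algebraMap ℝ B (c ^ 2) * S ≤ 1 := by
    refine (star_left_conjugate_le_conjugate l1 S).trans_eq ?_
    rw [show star S * (star T * T) * S = star (T * S) * (T * S) by
      rw [star_mul]; simp only [mul_assoc], hTS]; simp
  rw [Algebra.algebraMap_eq_smul_one, mul_smul_comm, mul_one, smul_mul_assoc] at l3
  have l4 := CStarAlgebra.norm_le_norm_of_nonneg_of_le
    (smul_nonneg (by positivity) (star_mul_self_nonneg S)) l3
  rw [norm_smul, CStarRing.norm_star_mul_self] at l4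
  -- The zero algebra is not excluded, so only an inequality is available.
  have l5 : ‖(1 : B)‖ ≤ 1 := by
    rcases subsingleton_or_nontrivial B with hB | hB
    · rw [Subsingleton.elim (1 : B) 0]; simp
    · simp
  rw [Real.norm_of_nonneg (by positivity)] at l4
  have l6 : (c * ‖S‖) ^ 2 ≤ 1 ^ 2 := by nlinarith
  have l7 := le_of_sq_le_sq l6 (by norm_num)
  rw [← one_div, le_div_iff₀ hc]; linarith

end CStar

/-! ### Imaginary parts of matrices and lower bounds on them -/

section MatrixIm

variable {m : ℕ}

/-- The imaginary part of `l` is at least `c`. -/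
def ImGe (l : Matrix (Fin m) (Fin m) ℂ) (c : ℝ) : Prop :=
  ∃ b : Matrix (Fin m) (Fin m) ℂ, matIm l = (c : ℂ) • 1 + star b * b

theorem sub_star_eq_matIm (l : Matrix (Fin m) (Fin m) ℂ) :
    l - star l = (2 * Complex.I) • matIm l := by
  rw [matIm, smul_smul, mul_inv_cancel₀ (by simp), one_smul]; rfl

theorem matIm_eq_of_sub_star {l h : Matrix (Fin m) (Fin m) ℂ}
    (H : l - star l = (2 * Complex.I) • h) : matIm l = h := by
  rw [sub_star_eq_matIm] at H
  exact smul_right_injective _ (by simp : (2 * Complex.I : ℂ) ≠ 0) H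

theorem matIm_add (l k : Matrix (Fin m) (Fin m) ℂ) : matIm (l + k) = matIm l + matIm k := by
  simp only [matIm, Matrix.conjTranspose_add]; module

theorem matIm_neg (l : Matrix (Fin m) (Fin m) ℂ) : matIm (-l) = -matIm l := by
  simp only [matIm, Matrix.conjTranspose_neg]; module

theorem matIm_smul_one (z : ℂ) : matIm (z • (1 : Matrix (Fin m) (Fin m) ℂ)) = (z.im : ℂ) • 1 := by
  apply matIm_eq_of_sub_star
  rw [star_smul, star_one, smul_smul, ← sub_smul]
  congr 1
  apply Complex.ext <;> simp
  ring

theorem isSelfAdjoint_matIm (l : Matrix (Fin m) (Fin m) ℂ) : IsSelfAdjoint (matIm l) := by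
  have : star (2 * Complex.I)⁻¹ = -(2 * Complex.I)⁻¹ := by simp
  rw [IsSelfAdjoint, matIm, star_smul, this, ← Matrix.star_eq_conjTranspose, star_sub, star_star]
  module

theorem norm_matIm_le (l : Matrix (Fin m) (Fin m) ℂ) : ‖matIm l‖ ≤ ‖l‖ := by
  rw [matIm, norm_smul]
  have h1 : ‖(2 * Complex.I)⁻¹‖ = 1 / 2 := by simp
  have h2 := norm_sub_le l l.conjTranspose
  rw [Matrix.l2_opNorm_conjTranspose] at h2
  rw [h1]; linarith

/-- A self-adjoint matrix is bounded above by its norm. -/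
theorem exists_norm_smul_one_eq_add {x : Matrix (Fin m) (Fin m) ℂ} (hx : IsSelfAdjoint x) {c : ℝ}
    (hc : ‖x‖ ≤ c) : ∃ b : Matrix (Fin m) (Fin m) ℂ, (c : ℂ) • 1 = x + star b * b := by
  let _ := CStarAlgebra.spectralOrder (Matrix (Fin m) (Fin m) ℂ)
  have _ := CStarAlgebra.spectralOrderedRing (Matrix (Fin m) (Fin m) ℂ)
  have h1 : x ≤ algebraMap ℝ _ c := (hx.le_algebraMap_norm_self).trans (by
    rw [← sub_nonneg, ← map_sub, Algebra.algebraMap_eq_smul_one]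
    exact smul_nonneg (by linarith) zero_le_one)
  obtain ⟨b, hb⟩ := CStarAlgebra.nonneg_iff_eq_star_mul_self.1 (sub_nonneg.2 h1)
  refine ⟨b, ?_⟩
  rw [← hb, Algebra.algebraMap_eq_smul_one, ← Complex.coe_smul]; abel

theorem ImGe.add_of_norm_le {l k : Matrix (Fin m) (Fin m) ℂ} {c d : ℝ} (hl : ImGe l c)
    (hk : ‖k‖ ≤ d) : ImGe (l + k) (c - d) := by
  obtain ⟨b, hb⟩ := hl
  obtain ⟨e, he⟩ := exists_norm_smul_one_eq_add (isSelfAdjoint_matIm (-k)) (c := d)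
    ((norm_matIm_le _).trans (by simpa using hk))
  let _ := CStarAlgebra.spectralOrder (Matrix (Fin m) (Fin m) ℂ)
  have _ := CStarAlgebra.spectralOrderedRing (Matrix (Fin m) (Fin m) ℂ)
  obtain ⟨f, hf⟩ := CStarAlgebra.nonneg_iff_eq_star_mul_self.1
    (add_nonneg (star_mul_self_nonneg b) (star_mul_self_nonneg e))
  refine ⟨f, ?_⟩
  rw [← hf, matIm_add, hb]
  rw [matIm_neg] at he
  have : matIm k = star e * e - (d : ℂ) • 1 := by rw [he]; abel
  rw [this, Complex.ofReal_sub]; module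

theorem ImGe.add_smul_one {l : Matrix (Fin m) (Fin m) ℂ} {c : ℝ} (hl : ImGe l c) (z : ℂ) :
    ImGe (l + z • 1) (c + z.im) := by
  obtain ⟨b, hb⟩ := hl
  refine ⟨b, ?_⟩
  rw [matIm_add, hb, matIm_smul_one, Complex.ofReal_add]; module

/-- A positive definite matrix `h` is bounded below by `1 / ‖h⁻¹‖`. -/
theorem exists_eq_inv_norm_inv_smul_add {h : Matrix (Fin m) (Fin m) ℂ} (hh : h.PosDef)
    (hm : 0 < m) : 0 < ‖h⁻¹‖ ∧ ∃ b : Matrix (Fin m) (Fin m) ℂ,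
      h = ((‖h⁻¹‖⁻¹ : ℝ) : ℂ) • 1 + star b * b := by
  have : NeZero m := ⟨hm.ne'⟩
  have hdet : IsUnit h.det := (Matrix.isUnit_iff_isUnit_det _).1 hh.isUnit
  have hhi : h * h⁻¹ = 1 := Matrix.mul_nonsing_inv _ hdet
  have hpos : 0 < ‖h⁻¹‖ := by
    rw [norm_pos_iff]; rintro h0; rw [h0, mul_zero] at hhi; exact zero_ne_one hhi
  refine ⟨hpos, ?_⟩
  obtain ⟨u, hu⟩ : ∃ u, h = star u * u := by
    open scoped MatrixOrder in
    exact CStarAlgebra.nonneg_iff_eq_star_mul_self.1 (Matrix.nonneg_iff_posSemidef.2 hh.posSemidef)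
  let _ := CStarAlgebra.spectralOrder (Matrix (Fin m) (Fin m) ℂ)
  have _ := CStarAlgebra.spectralOrderedRing (Matrix (Fin m) (Fin m) ℂ)
  have hud : IsUnit u.det := by
    rw [hu, Matrix.det_mul] at hdet; exact isUnit_of_mul_isUnit_right hdet
  set v := u⁻¹ with hv
  have huv : u * v = 1 := Matrix.mul_nonsing_inv _ hud
  have hvu : v * u = 1 := Matrix.nonsing_inv_mul _ hud
  have hvv : h⁻¹ = v * star v := by
    apply Matrix.inv_eq_right_inv
    rw [hu]
    calc star u * u * (v * star v) = star u * (u * v) * star v := by simp only [mul_assoc]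
      _ = star (v * u) := by rw [huv, mul_one, star_mul]
      _ = 1 := by rw [hvu, star_one]
  have hn : ‖v‖ ^ 2 = ‖h⁻¹‖ := by rw [hvv, CStarRing.norm_self_mul_star, sq]
  -- With `h = u*u` and `v = u⁻¹`, conjugating `v*v ≤ ‖v‖² = ‖h⁻¹‖` by `u` gives `1 ≤ ‖h⁻¹‖ h`.
  have l1 := star_left_conjugate_le_conjugate
    (CStarAlgebra.star_mul_le_algebraMap_norm_sq (a := v)) u
  rw [hn, show star u * (star v * v) * u = star (v * u) * (v * u) by
    rw [star_mul]; simp only [mul_assoc], hvu, Algebra.algebraMap_eq_smul_one, mul_smul_comm,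
    mul_one, smul_mul_assoc, mul_one, ← hu, star_one] at l1
  have l2 : (‖h⁻¹‖⁻¹ : ℝ) • (1 : Matrix (Fin m) (Fin m) ℂ) ≤ h := by
    have := smul_le_smul_of_nonneg_left l1 (inv_nonneg.2 hpos.le)
    rwa [smul_smul, inv_mul_cancel₀ hpos.ne', one_smul] at this
  obtain ⟨b, hb⟩ := CStarAlgebra.nonneg_iff_eq_star_mul_self.1 (sub_nonneg.2 l2)
  refine ⟨b, ?_⟩
  rw [← hb, Complex.coe_smul]; abel

theorem imGe_inv_norm {l : Matrix (Fin m) (Fin m) ℂ} (hl : (matIm l).PosDef) (hm : 0 < m) :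
    0 < ‖(matIm l)⁻¹‖ ∧ ImGe l (‖(matIm l)⁻¹‖⁻¹) :=
  exists_eq_inv_norm_inv_smul_add hl hm

theorem one_le_norm_mul_norm_inv_matIm {l : Matrix (Fin m) (Fin m) ℂ} (hl : (matIm l).PosDef)
    (hm : 0 < m) : 1 ≤ ‖l‖ * ‖(matIm l)⁻¹‖ := by
  have : NeZero m := ⟨hm.ne'⟩
  have hhi : matIm l * (matIm l)⁻¹ = 1 :=
    Matrix.mul_nonsing_inv _ ((Matrix.isUnit_iff_isUnit_det _).1 hl.isUnit)
  calc (1 : ℝ) = ‖matIm l * (matIm l)⁻¹‖ := by rw [hhi, norm_one]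
    _ ≤ ‖matIm l‖ * ‖(matIm l)⁻¹‖ := norm_mul_le _ _
    _ ≤ _ := by gcongr; exact norm_matIm_le l

end MatrixIm

/-! ### Matrix-valued expectations and sliced resolvents -/

/-- A conditional expectation of a C*-algebra onto a copy of the `m × m` matrices. -/
structure MatExp (m : ℕ) (B : Type*) [CStarAlgebra B] where
  /-- the inclusion of the matrices -/
  inc : Matrix (Fin m) (Fin m) ℂ →⋆ₐ[ℂ] B
  /-- the expectation -/
  E : B →ₗ[ℂ] Matrix (Fin m) (Fin m) ℂ
  inc_mul : ∀ a x, E (inc a * x) = a * E x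
  mul_inc : ∀ a x, E (x * inc a) = E x * a
  E_one : E 1 = 1
  E_star : ∀ x, E (star x) = star (E x)
  pos : ∀ x, (E (star x * x)).PosSemidef
  bound : ∀ x, ‖E x‖ ≤ 2 * m ^ 2 * ‖x‖

namespace MatExp

variable {m : ℕ} {B : Type*} [CStarAlgebra B] (φ : MatExp m B)

theorem norm_inc_le (a : Matrix (Fin m) (Fin m) ℂ) : ‖φ.inc a‖ ≤ ‖a‖ :=
  NonUnitalStarAlgHom.norm_apply_le φ.inc a

theorem E_inc (a : Matrix (Fin m) (Fin m) ℂ) : φ.E (φ.inc a) = a := by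
  rw [← mul_one (φ.inc a), φ.inc_mul, φ.E_one, mul_one]

variable {l : Matrix (Fin m) (Fin m) ℂ} {c : ℝ} {s : B}

theorem sub_star_inc_sub (hs : IsSelfAdjoint s) :
    φ.inc l - s - star (φ.inc l - s) = (2 * Complex.I) • φ.inc (matIm l) := by
  rw [star_sub, hs.star_eq, ← map_smul, ← sub_star_eq_matIm, map_sub, map_star]; abel

theorem resolvent_bound (hc : 0 < c) (hl : ImGe l c) (hs : IsSelfAdjoint s) :
    IsUnit (φ.inc l - s) ∧ ‖Ring.inverse (φ.inc l - s)‖ ≤ c⁻¹ := by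
  obtain ⟨b, hb⟩ := hl
  refine isUnit_and_norm_inverse_le_of_im (b := φ.inc b) hc (φ.sub_star_inc_sub hs) ?_
  rw [hb, map_add, map_smul, map_one, map_mul, map_star]

theorem norm_E_resolvent_le (hc : 0 < c) (hl : ImGe l c) (hs : IsSelfAdjoint s) :
    ‖φ.E (Ring.inverse (φ.inc l - s))‖ ≤ 2 * m ^ 2 * c⁻¹ :=
  (φ.bound _).trans (by gcongr; exact (φ.resolvent_bound hc hl hs).2)

/-- The resolvent identity `R - R' = R (l' - l) R'`. It is the Lipschitz estimate that converts a
shift of the spectral parameter into a distance between values of `G`. -/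
theorem norm_E_resolvent_sub_le {l' : Matrix (Fin m) (Fin m) ℂ} {c' : ℝ} (hc : 0 < c)
    (hl : ImGe l c) (hc' : 0 < c') (hl' : ImGe l' c') (hs : IsSelfAdjoint s) :
    ‖φ.E (Ring.inverse (φ.inc l - s)) - φ.E (Ring.inverse (φ.inc l' - s))‖
      ≤ 2 * m ^ 2 * (c⁻¹ * c'⁻¹) * ‖l' - l‖ := by
  obtain ⟨u, hu⟩ := φ.resolvent_bound hc hl hs
  obtain ⟨u', hu'⟩ := φ.resolvent_bound hc' hl' hs
  have : Ring.inverse (φ.inc l - s) - Ring.inverse (φ.inc l' - s)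
      = Ring.inverse (φ.inc l - s) * φ.inc (l' - l) * Ring.inverse (φ.inc l' - s) := by
    have e1 := Ring.inverse_mul_cancel _ u
    have e2 := Ring.mul_inverse_cancel _ u'
    have : φ.inc (l' - l) = (φ.inc l' - s) - (φ.inc l - s) := by rw [map_sub]; abel
    rw [this, mul_sub, sub_mul, e1, one_mul, mul_assoc, e2, mul_one]
  rw [← map_sub, this]
  refine (φ.bound _).trans ?_
  rw [mul_assoc (2 * (m : ℝ) ^ 2)]
  gcongr
  calc _ ≤ ‖Ring.inverse (φ.inc l - s)‖ * ‖φ.inc (l' - l)‖ * ‖Ring.inverse (φ.inc l' - s)‖ :=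
        (norm_mul_le _ _).trans (by gcongr; exact norm_mul_le _ _)
    _ ≤ c⁻¹ * ‖l' - l‖ * c'⁻¹ := by gcongr; exact φ.norm_inc_le _
    _ = _ := by ring

/-- The imaginary part of `-R` is `R* (Im T) R ≥ c R*R`, and `R*R` is bounded below by a positive
scalar because `R` is invertible. This places the sliced resolvent in the class where Dyson
solutions are unique. -/
theorem posDef_neg_matIm_E_resolvent (hc : 0 < c) (hl : ImGe l c) (hs : IsSelfAdjoint s) :
    (-matIm (φ.E (Ring.inverse (φ.inc l - s)))).PosDef := by
  obtain ⟨u, -⟩ := φ.resolvent_bound hc hl hs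
  have hsub := φ.sub_star_inc_sub (l := l) hs
  obtain ⟨b, hb⟩ := hl
  set T := φ.inc l - s with hT
  set R := Ring.inverse T with hR
  have hTR : T * R = 1 := Ring.mul_inverse_cancel _ u
  have hRT : star R * star T = 1 := by rw [← star_mul, hTR, star_one]
  have h1 : -R - star (-R) = (2 * Complex.I) • (star R * φ.inc (matIm l) * R) := by
    rw [← smul_mul_assoc, ← mul_smul_comm, ← hsub, mul_sub, sub_mul, hRT, mul_assoc, hTR]
    simp only [star_neg]; simp
    abel
  have h2 : -matIm (φ.E R) = φ.E (star R * φ.inc (matIm l) * R) := by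
    rw [← matIm_neg]
    apply matIm_eq_of_sub_star
    rw [← map_neg, ← φ.E_star, ← map_sub, h1, map_smul]
  rw [h2, hb, map_add φ.inc, map_smul φ.inc, map_one φ.inc, map_mul φ.inc, map_star φ.inc]
  have h3 : star R * ((c : ℂ) • 1 + star (φ.inc b) * φ.inc b) * R
      = (c : ℂ) • (star R * R) + star (φ.inc b * R) * (φ.inc b * R) := by
    rw [star_mul, mul_add, add_mul, mul_smul_comm, smul_mul_assoc, mul_one]
    simp only [mul_assoc]
  rw [h3, map_add, map_smul]
  refine Matrix.PosDef.add_posSemidef ?_ (φ.pos _)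
  let _ := CStarAlgebra.spectralOrder B
  have _ := CStarAlgebra.spectralOrderedRing B
  have l1 := star_left_conjugate_le_conjugate
    (CStarAlgebra.star_mul_le_algebraMap_norm_sq (a := T)) R
  rw [show star R * (star T * T) * R = star (T * R) * (T * R) by
    rw [star_mul]; simp only [mul_assoc], hTR, Algebra.algebraMap_eq_smul_one, mul_smul_comm,
    mul_one, smul_mul_assoc, star_one, mul_one] at l1
  obtain ⟨w, hw⟩ := CStarAlgebra.nonneg_iff_eq_star_mul_self.1 (sub_nonneg.2 l1)
  -- From `‖T‖² R*R = 1 + w*w`. Adding one more `R*R` makes the divisor `‖T‖² + 1` nonzero without a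
  -- case distinction.
  have h4 : φ.E (star R * R) = (((‖T‖ ^ 2 + 1)⁻¹ : ℝ) : ℂ) •
      (1 + φ.E (star w * w) + φ.E (star R * R)) := by
    rw [← hw, ← φ.E_one, ← map_add, ← map_add, Complex.coe_smul, ← Complex.coe_smul, ← map_smul,
      Complex.coe_smul]
    congr 1
    rw [show 1 + (‖T‖ ^ 2 • (star R * R) - 1) + star R * R = (‖T‖ ^ 2 + 1) • (star R * R) by
      rw [add_smul, one_smul]; abel, smul_smul, inv_mul_cancel₀ (by positivity), one_smul]
  rw [h4]
  refine Matrix.PosDef.smul (Matrix.PosDef.smul ?_ ?_) ?_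
  · exact (Matrix.PosDef.one.add_posSemidef (φ.pos _)).add_posSemidef (φ.pos _)
  · rw [Complex.zero_lt_real]; positivity
  · rw [Complex.zero_lt_real]; exact hc

end MatExp

/-! ### The matrix Dyson equation: uniqueness and stability -/

section Dyson

variable {m r : ℕ}

/-- The covariance map `x ↦ ∑ j, (a j x (a j)* + (a j)* x a j)`. -/
noncomputable def covMap (a : Fin r → Matrix (Fin m) (Fin m) ℂ) (x : Matrix (Fin m) (Fin m) ℂ) :
    Matrix (Fin m) (Fin m) ℂ :=
  ∑ j, (a j * x * star (a j) + star (a j) * x * a j)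

theorem covMap_sub (a : Fin r → Matrix (Fin m) (Fin m) ℂ) (x y : Matrix (Fin m) (Fin m) ℂ) :
    covMap a (x - y) = covMap a x - covMap a y := by
  simp only [covMap, mul_sub, sub_mul, ← Finset.sum_sub_distrib]
  exact Finset.sum_congr rfl fun _ _ => by abel

theorem covMap_smul (a : Fin r → Matrix (Fin m) (Fin m) ℂ) (z : ℂ)
    (x : Matrix (Fin m) (Fin m) ℂ) : covMap a (z • x) = z • covMap a x := by
  simp only [covMap, mul_smul_comm, smul_mul_assoc, Finset.smul_sum, smul_add]

theorem star_covMap (a : Fin r → Matrix (Fin m) (Fin m) ℂ) (x : Matrix (Fin m) (Fin m) ℂ) :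
    star (covMap a x) = covMap a (star x) := by
  simp only [covMap, star_sum, star_add, star_mul, star_star, mul_assoc]

theorem norm_covMap_le (a : Fin r → Matrix (Fin m) (Fin m) ℂ) (x : Matrix (Fin m) (Fin m) ℂ) :
    ‖covMap a x‖ ≤ 2 * (∑ j, ‖a j‖) ^ 2 * ‖x‖ := by
  have h1 : ∀ j, ‖a j * x * star (a j) + star (a j) * x * a j‖ ≤ 2 * ‖a j‖ ^ 2 * ‖x‖ := by
    intro j
    refine (norm_add_le _ _).trans ?_
    have h1 : ‖a j * x * star (a j)‖ ≤ ‖a j‖ * ‖x‖ * ‖star (a j)‖ :=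
      (norm_mul_le _ _).trans (by gcongr; exact norm_mul_le _ _)
    have h2 : ‖star (a j) * x * a j‖ ≤ ‖star (a j)‖ * ‖x‖ * ‖a j‖ :=
      (norm_mul_le _ _).trans (by gcongr; exact norm_mul_le _ _)
    rw [norm_star] at h1 h2
    linarith
  refine (norm_sum_le_of_le _ fun j _ => h1 j).trans ?_
  rw [← Finset.sum_mul, ← Finset.mul_sum]
  gcongr
  exact Finset.sum_sq_le_sq_sum_of_nonneg fun _ _ => norm_nonneg _

theorem continuous_covMap (a : Fin r → Matrix (Fin m) (Fin m) ℂ) : Continuous (covMap a) := by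
  unfold covMap; fun_prop

/-- The real part of the sesquilinear form of a matrix. -/
noncomputable def reForm (x : Matrix (Fin m) (Fin m) ℂ) (v w : Fin m → ℂ) : ℝ :=
  (star v ⬝ᵥ x.mulVec w).re

theorem reForm_add (x y : Matrix (Fin m) (Fin m) ℂ) (v w : Fin m → ℂ) :
    reForm (x + y) v w = reForm x v w + reForm y v w := by
  simp [reForm, Matrix.add_mulVec, dotProduct_add]

theorem reForm_sum {ι : Type*} (s : Finset ι) (x : ι → Matrix (Fin m) (Fin m) ℂ)
    (v w : Fin m → ℂ) : reForm (∑ i ∈ s, x i) v w = ∑ i ∈ s, reForm (x i) v w := by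
  classical
  induction s using Finset.induction_on with
  | empty => simp [reForm]
  | insert i s hi ih => rw [Finset.sum_insert hi, Finset.sum_insert hi, reForm_add, ih]

theorem reForm_smul (c : ℝ) (x : Matrix (Fin m) (Fin m) ℂ) (v w : Fin m → ℂ) :
    reForm ((c : ℂ) • x) v w = c * reForm x v w := by
  simp [reForm, Matrix.smul_mulVec, dotProduct_smul]

theorem reForm_mul_mul (a x b : Matrix (Fin m) (Fin m) ℂ) (v w : Fin m → ℂ) :
    reForm (a * x * b) v w = reForm x ((star a).mulVec v) (b.mulVec w) := by
  simp only [reForm, Matrix.star_eq_conjTranspose, Matrix.star_mulVec,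
    Matrix.conjTranspose_conjTranspose]
  rw [← Matrix.dotProduct_mulVec, Matrix.mulVec_mulVec, Matrix.mulVec_mulVec, mul_assoc]

theorem reForm_one_self_nonneg (v : Fin m → ℂ) : 0 ≤ reForm 1 v v := by
  rw [reForm, Matrix.one_mulVec]
  exact (Complex.nonneg_iff.1 (dotProduct_star_self_nonneg v)).1

theorem reForm_star_mul_self_nonneg (b : Matrix (Fin m) (Fin m) ℂ) (v : Fin m → ℂ) :
    0 ≤ reForm (star b * b) v v := by
  rw [← mul_one (star b), reForm_mul_mul, star_star]
  exact reForm_one_self_nonneg _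

theorem Matrix.PosDef.exists_reForm_le (hm : 0 < m) {p : Matrix (Fin m) (Fin m) ℂ}
    (hp : p.PosDef) : ∃ c > 0, ∀ v, c * reForm 1 v v ≤ reForm p v v := by
  obtain ⟨h1, b, hb⟩ := exists_eq_inv_norm_inv_smul_add hp hm
  refine ⟨‖p⁻¹‖⁻¹, inv_pos.2 h1, fun v => ?_⟩
  conv_rhs => rw [hb]
  rw [reForm_add, reForm_smul]
  linarith [reForm_star_mul_self_nonneg b v]

theorem reForm_self_le {x : Matrix (Fin m) (Fin m) ℂ} (hx : IsSelfAdjoint x) (v : Fin m → ℂ) :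
    reForm x v v ≤ ‖x‖ * reForm 1 v v := by
  obtain ⟨b, hb⟩ := exists_norm_smul_one_eq_add hx le_rfl
  rw [← reForm_smul, hb, reForm_add]
  linarith [reForm_star_mul_self_nonneg b v]

/-- Two definite matrices are comparable. -/
theorem exists_mul_reForm_le (hm : 0 < m) {p y : Matrix (Fin m) (Fin m) ℂ} (hp : p.PosDef)
    (hy : IsSelfAdjoint y) : ∃ d > 0, ∀ v, d * reForm y v v ≤ reForm p v v := by
  obtain ⟨c, hc, h⟩ := hp.exists_reForm_le hm
  refine ⟨c / (‖y‖ + 1), by positivity, fun v => ?_⟩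
  have h1 := reForm_self_le hy v
  have h2 := reForm_one_self_nonneg v
  calc c / (‖y‖ + 1) * reForm y v v ≤ c / (‖y‖ + 1) * ((‖y‖ + 1) * reForm 1 v v) := by
        gcongr; linarith
    _ = c * reForm 1 v v := by field_simp
    _ ≤ _ := h v

theorem reForm_covMap (a : Fin r → Matrix (Fin m) (Fin m) ℂ)
    (g x g' : Matrix (Fin m) (Fin m) ℂ) (v w : Fin m → ℂ) :
    reForm (g * covMap a x * g') v w =
      ∑ j, (reForm x ((star (g * a j)).mulVec v) ((star (a j) * g').mulVec w)
        + reForm x ((star (g * star (a j))).mulVec v) ((a j * g').mulVec w)) := by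
  rw [covMap, Finset.mul_sum, Finset.sum_mul, reForm_sum]
  refine Finset.sum_congr rfl fun j _ => ?_
  rw [← reForm_mul_mul, ← reForm_mul_mul, ← reForm_add]
  congr 1
  noncomm_ring

/-- The matrix Dyson equation. -/
def IsDysonSol (a₀ : Matrix (Fin m) (Fin m) ℂ) (a : Fin r → Matrix (Fin m) (Fin m) ℂ)
    (l g : Matrix (Fin m) (Fin m) ℂ) : Prop :=
  (l - a₀ - covMap a g) * g = 1

variable {a₀ : Matrix (Fin m) (Fin m) ℂ} {a : Fin r → Matrix (Fin m) (Fin m) ℂ}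
  {l g g₁ g₂ : Matrix (Fin m) (Fin m) ℂ}

theorem IsDysonSol.mul_comm (h : IsDysonSol a₀ a l g) : g * (l - a₀ - covMap a g) = 1 :=
  mul_eq_one_comm.1 h

/-- Here `W = g⁻¹` has imaginary part `Im l - η(Im g)`; conjugating by `g` from either side gives
`-Im g`. Uniqueness uses one form for each of its two solutions, since one of them acts on the left
vector and the other on the right vector. -/
theorem IsDysonSol.neg_matIm (h : IsDysonSol a₀ a l g) (ha₀ : a₀.IsHermitian) :
    -matIm g = star g * (matIm l + covMap a (-matIm g)) * g ∧
    -matIm g = g * (matIm l + covMap a (-matIm g)) * star g := by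
  set W := l - a₀ - covMap a g with hW
  have h1 : W * g = 1 := h
  have h2 : g * W = 1 := h.mul_comm
  have h1' : star g * star W = 1 := by rw [← star_mul, h1, star_one]
  have h2' : star W * star g = 1 := by rw [← star_mul, h2, star_one]
  have hs : W - star W = (2 * Complex.I) • (matIm l + covMap a (-matIm g)) := by
    have e1 : covMap a (-matIm g) = (-1 : ℂ) • covMap a (matIm g) := by
      rw [← covMap_smul]; simp
    have e2 : (2 * Complex.I) • covMap a (matIm g) = covMap a g - covMap a (star g) := by
      rw [← covMap_smul, ← sub_star_eq_matIm, covMap_sub]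
    rw [e1, smul_add, smul_comm, e2, ← sub_star_eq_matIm, hW]
    simp only [star_sub, star_covMap]
    rw [show star a₀ = a₀ from ha₀]
    module
  set X := matIm l + covMap a (-matIm g) with hX
  constructor
  · rw [← matIm_neg]
    apply matIm_eq_of_sub_star
    rw [← smul_mul_assoc, ← mul_smul_comm, ← hs, mul_sub, sub_mul, h1', mul_assoc, h1]
    simp only [star_neg, one_mul, mul_one]; abel
  · rw [← matIm_neg]
    apply matIm_eq_of_sub_star
    rw [← smul_mul_assoc, ← mul_smul_comm, ← hs, mul_sub, sub_mul, h2, mul_assoc, h2']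
    simp only [star_neg, one_mul, mul_one]; abel

/-- One step of the contraction argument for the uniqueness of the Dyson equation. -/
theorem reForm_le_of_eq_mul_covMap_mul {x y₁ y₂ : Matrix (Fin m) (Fin m) ℂ}
    (hx : x = g₁ * covMap a x * g₂) {t : ℝ}
    (h : ∀ v w, reForm x v w ≤ t * (reForm y₁ v v + reForm y₂ w w)) (v w : Fin m → ℂ) :
    reForm x v w ≤ t * (reForm (g₁ * covMap a y₁ * star g₁) v v +
      reForm (star g₂ * covMap a y₂ * g₂) w w) := by
  conv_lhs => rw [hx]
  rw [reForm_covMap, reForm_covMap, reForm_covMap, ← Finset.sum_add_distrib, Finset.mul_sum]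
  refine Finset.sum_le_sum fun j _ => ?_
  have h1 := h ((star (g₁ * a j)).mulVec v) ((star (a j) * g₂).mulVec w)
  have h2 := h ((star (g₁ * star (a j))).mulVec v) ((a j * g₂).mulVec w)
  simp only [star_mul, star_star] at h1 h2 ⊢
  linarith

/-- Starting point of the contraction: `2 Re⟨v, x w⟩ ≤ |v|² + |x w|²`, followed by comparison of
both squares with the definite forms. -/
theorem exists_reForm_le_mul (hm : 0 < m) {y₁ y₂ : Matrix (Fin m) (Fin m) ℂ} (hy₁ : y₁.PosDef)
    (hy₂ : y₂.PosDef) (x : Matrix (Fin m) (Fin m) ℂ) :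
    ∃ t > 0, ∀ v w, reForm x v w ≤ t * (reForm y₁ v v + reForm y₂ w w) := by
  obtain ⟨c₁, hc₁, h₁⟩ := hy₁.exists_reForm_le hm
  obtain ⟨c₂, hc₂, h₂⟩ := hy₂.exists_reForm_le hm
  refine ⟨1 / c₁ + ‖star x * x‖ / c₂, by positivity, fun v w => ?_⟩
  have e1 : 2 * reForm x v w ≤ reForm 1 v v + reForm (star x * x) w w := by
    have h0 := reForm_one_self_nonneg (v - x.mulVec w)
    have e2 : reForm (star x * x) w w = reForm 1 (x.mulVec w) (x.mulVec w) := by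
      rw [← mul_one (star x), reForm_mul_mul, star_star]
    have e3 : (star (x.mulVec w) ⬝ᵥ v).re = (star v ⬝ᵥ x.mulVec w).re := by
      rw [← Complex.conj_re, ← Complex.star_def, ← Matrix.star_dotProduct_star, star_star]
    rw [e2]
    simp only [reForm, Matrix.one_mulVec, star_sub, sub_dotProduct, dotProduct_sub,
      Complex.sub_re, e3] at h0 ⊢
    linarith
  have e2 := reForm_self_le (IsSelfAdjoint.star_mul_self x) w
  have n1 := reForm_one_self_nonneg v
  have n2 := reForm_one_self_nonneg w
  have f1 : reForm 1 v v ≤ 1 / c₁ * reForm y₁ v v := by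
    rw [one_div, ← div_eq_inv_mul, le_div_iff₀ hc₁]; linarith [h₁ v]
  have f2 : reForm 1 w w ≤ 1 / c₂ * reForm y₂ w w := by
    rw [one_div, ← div_eq_inv_mul, le_div_iff₀ hc₂]; linarith [h₂ w]
  have g1 : 0 ≤ reForm y₁ v v := (mul_nonneg hc₁.le n1).trans (h₁ v)
  have g2 : 0 ≤ reForm y₂ w w := (mul_nonneg hc₂.le n2).trans (h₂ w)
  have f3 : ‖star x * x‖ * reForm 1 w w ≤ ‖star x * x‖ / c₂ * reForm y₂ w w := by
    calc _ ≤ ‖star x * x‖ * (1 / c₂ * reForm y₂ w w) := by gcongr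
      _ = _ := by ring
  have f4 : 0 ≤ 1 / c₁ * reForm y₂ w w := by positivity
  have f5 : 0 ≤ ‖star x * x‖ / c₂ * reForm y₁ v v := by positivity
  have f6 : 0 ≤ 1 / c₁ * reForm y₁ v v := by positivity
  have f7 : 0 ≤ ‖star x * x‖ / c₂ * reForm y₂ w w := by positivity
  nlinarith

/-- The choice `v = x w` turns the form into `|x w|²`, so a one-sided bound on real parts is enough.
-/
theorem eq_zero_of_reForm_nonpos {x : Matrix (Fin m) (Fin m) ℂ}
    (h : ∀ v w, reForm x v w ≤ 0) : x = 0 := by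
  have h2 : ∀ w, x.mulVec w = 0 := by
    intro w
    have := h (x.mulVec w) w
    have h3 := dotProduct_star_self_nonneg (x.mulVec w)
    rw [reForm] at this
    have h4 : star (x.mulVec w) ⬝ᵥ x.mulVec w = 0 := by
      have h5 := Complex.nonneg_iff.1 h3
      apply Complex.ext
      · exact le_antisymm this h5.1
      · exact h5.2.symm
    exact dotProduct_star_self_eq_zero.1 h4
  exact Matrix.toLin'.injective (LinearMap.ext fun w => by simp [Matrix.toLin'_apply, h2])

/-- The matrix Dyson equation has at most one solution with negative imaginary part. -/
theorem IsDysonSol.unique (hm : 0 < m) (ha₀ : a₀.IsHermitian) (hl : (matIm l).PosDef)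
    (h₁ : IsDysonSol a₀ a l g₁) (h₂ : IsDysonSol a₀ a l g₂)
    (p₁ : (-matIm g₁).PosDef) (p₂ : (-matIm g₂).PosDef) : g₁ = g₂ := by
  -- Since each `gᵢ` inverts `l - a₀ - η(gᵢ)`, this is the resolvent identity for the two inverses.
  have hx : g₁ - g₂ = g₁ * covMap a (g₁ - g₂) * g₂ := by
    have : covMap a (g₁ - g₂) = (l - a₀ - covMap a g₂) - (l - a₀ - covMap a g₁) := by
      rw [covMap_sub]; abel
    rw [this, mul_sub, sub_mul, h₁.mul_comm, mul_assoc, h₂, mul_one, one_mul]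
  have u₁ : IsUnit g₁ := (Matrix.isUnit_iff_isUnit_det _).2
    (Matrix.isUnit_det_of_left_inverse h₁)
  have u₂ : IsUnit g₂ := (Matrix.isUnit_iff_isUnit_det _).2
    (Matrix.isUnit_det_of_left_inverse h₂)
  have e₁ := (h₁.neg_matIm ha₀).2
  have e₂ := (h₂.neg_matIm ha₀).1
  set y₁ := -matIm g₁ with hy₁
  set y₂ := -matIm g₂ with hy₂
  set x := g₁ - g₂ with hxd
  have q₁ : (g₁ * matIm l * star g₁).PosDef :=
    hl.mul_mul_conjTranspose_same (Matrix.vecMul_injective_of_isUnit u₁)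
  have q₂ : (star g₂ * matIm l * g₂).PosDef :=
    hl.conjTranspose_mul_mul_same (Matrix.mulVec_injective_of_isUnit u₂)
  obtain ⟨d₁, hd₁, k₁⟩ := exists_mul_reForm_le hm q₁ (isSelfAdjoint_matIm g₁).neg
  obtain ⟨d₂, hd₂, k₂⟩ := exists_mul_reForm_le hm q₂ (isSelfAdjoint_matIm g₂).neg
  set d := min (min d₁ d₂) 1 with hd
  have hd0 : 0 < d := by positivity
  have hd1 : d ≤ 1 := min_le_right _ _
  have n₁ : ∀ v, 0 ≤ reForm y₁ v v := fun v => by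
    obtain ⟨c, hc, h⟩ := p₁.exists_reForm_le hm
    exact (mul_nonneg hc.le (reForm_one_self_nonneg v)).trans (h v)
  have n₂ : ∀ v, 0 ≤ reForm y₂ v v := fun v => by
    obtain ⟨c, hc, h⟩ := p₂.exists_reForm_le hm
    exact (mul_nonneg hc.le (reForm_one_self_nonneg v)).trans (h v)
  -- By `e₁`, `y₁` is the sum of `g₁ (Im l) g₁*` and `g₁ η(y₁) g₁*`. The first summand is at least
  -- `d y₁`, which leaves at most `(1 - d) y₁` for the second.
  have s₁ : ∀ v, reForm (g₁ * covMap a y₁ * star g₁) v v ≤ (1 - d) * reForm y₁ v v := by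
    intro v
    have h : reForm y₁ v v = reForm (g₁ * matIm l * star g₁) v v +
        reForm (g₁ * covMap a y₁ * star g₁) v v := by
      conv_lhs => rw [e₁, mul_add, add_mul, reForm_add]
    have : d * reForm y₁ v v ≤ d₁ * reForm y₁ v v :=
      mul_le_mul_of_nonneg_right ((min_le_left _ _).trans (min_le_left _ _)) (n₁ v)
    linarith [k₁ v]
  have s₂ : ∀ v, reForm (star g₂ * covMap a y₂ * g₂) v v ≤ (1 - d) * reForm y₂ v v := by
    intro v
    have h : reForm y₂ v v = reForm (star g₂ * matIm l * g₂) v v +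
        reForm (star g₂ * covMap a y₂ * g₂) v v := by
      conv_lhs => rw [e₂, mul_add, add_mul, reForm_add]
    have : d * reForm y₂ v v ≤ d₂ * reForm y₂ v v :=
      mul_le_mul_of_nonneg_right ((min_le_left _ _).trans (min_le_right _ _)) (n₂ v)
    linarith [k₂ v]
  obtain ⟨t, ht, hb⟩ := exists_reForm_le_mul hm p₁ p₂ x
  -- Substituting `x = g₁ η(x) g₂` into the bound gains a factor `1 - d`, so iteration forces the
  -- form of `x` to be nonpositive.
  have key : ∀ k : ℕ, ∀ v w, reForm x v w ≤
      ((1 - d) ^ k * t) * (reForm y₁ v v + reForm y₂ w w) := by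
    intro k
    induction k with
    | zero => simpa using hb
    | succ k ih =>
      intro v w
      refine (reForm_le_of_eq_mul_covMap_mul hx ih v w).trans ?_
      have h0 : 0 ≤ (1 - d) ^ k * t := mul_nonneg (pow_nonneg (by linarith) _) ht.le
      calc _ ≤ (1 - d) ^ k * t * ((1 - d) * reForm y₁ v v + (1 - d) * reForm y₂ w w) := by
            gcongr
            exacts [s₁ v, s₂ w]
        _ = _ := by ring
  refine sub_eq_zero.1 (eq_zero_of_reForm_nonpos fun v w => ?_)
  have hlim : Filter.Tendsto (fun k : ℕ => ((1 - d) ^ k * t) * (reForm y₁ v v + reForm y₂ w w))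
      Filter.atTop (nhds ((0 * t) * (reForm y₁ v v + reForm y₂ w w))) :=
    ((tendsto_pow_atTop_nhds_zero_of_lt_one (by linarith) (by linarith)).mul_const _).mul_const _
  rw [zero_mul, zero_mul] at hlim
  exact ge_of_tendsto' hlim fun k => key k v w

theorem ImGe.posDef {c : ℝ} (hc : 0 < c) (hl : ImGe l c) : (matIm l).PosDef := by
  obtain ⟨b, hb⟩ := hl
  rw [hb]
  refine Matrix.PosDef.add_posSemidef (Matrix.PosDef.smul Matrix.PosDef.one ?_)
    (Matrix.posSemidef_conjTranspose_mul_self b)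
  rw [Complex.zero_lt_real]; exact hc

/-- An approximate solution of the matrix Dyson equation is an exact solution for a nearby
spectral parameter. -/
theorem exists_isDysonSol_of_approx {ε D : ℝ} (hε : ‖(l - a₀ - covMap a g) * g - 1‖ ≤ ε)
    (hε4 : ε ≤ 1 / 4) (hWn : ‖l - a₀ - covMap a g‖ ≤ D) :
    ∃ Λ, IsDysonSol a₀ a Λ g ∧ ‖Λ - l‖ ≤ 2 * (ε * D) := by
  have hε0 : 0 ≤ ε := (norm_nonneg _).trans hε
  obtain ⟨W, hW⟩ : ∃ W, W = l - a₀ - covMap a g := ⟨_, rfl⟩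
  rw [← hW] at hε hWn
  have hu : IsUnit (W * g) := by
    have := isUnit_one_sub_of_norm_lt_one (x := 1 - W * g) (by
      rw [norm_sub_rev]; linarith)
    simpa using this
  have hgd : IsUnit g.det := by
    have := (Matrix.isUnit_iff_isUnit_det _).1 hu
    rw [Matrix.det_mul] at this
    exact isUnit_of_mul_isUnit_right this
  have hgg : g * g⁻¹ = 1 := Matrix.mul_nonsing_inv _ hgd
  have hdiff : g⁻¹ - W = -((W * g - 1) * g⁻¹) := by
    rw [sub_mul, mul_assoc, hgg, mul_one, one_mul]; abel
  have hd : ‖g⁻¹ - W‖ ≤ ε * ‖g⁻¹‖ := by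
    rw [hdiff, norm_neg]
    exact (norm_mul_le _ _).trans (by gcongr)
  have hgi : ‖g⁻¹‖ ≤ 2 * D := by
    have h1 : ε * ‖g⁻¹‖ ≤ 1 / 4 * ‖g⁻¹‖ := by gcongr
    have h2 : ‖g⁻¹‖ ≤ ‖g⁻¹ - W‖ + ‖W‖ := by simpa using norm_add_le (g⁻¹ - W) W
    linarith [norm_nonneg W]
  -- The new parameter is the one for which `Λ - a₀ - η(g)` equals `g⁻¹`.
  refine ⟨l + (g⁻¹ - W), ?_, ?_⟩
  · have : l + (g⁻¹ - W) - a₀ - covMap a g = g⁻¹ := by rw [hW]; abel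
    rw [IsDysonSol, this, Matrix.nonsing_inv_mul _ hgd]
  · rw [add_sub_cancel_left]
    calc _ ≤ ε * (2 * D) := hd.trans (by gcongr)
      _ = _ := by ring

/-- Stability of the matrix Dyson equation. -/
theorem norm_sub_le_of_approx_dyson (hm : 0 < m) (ha₀ : a₀.IsHermitian)
    {G : Matrix (Fin m) (Fin m) ℂ → Matrix (Fin m) (Fin m) ℂ} {C : ℝ} (hC : 0 ≤ C)
    (hG : ∀ l c, 0 < c → ImGe l c → IsDysonSol a₀ a l (G l) ∧ (-matIm (G l)).PosDef ∧
      ‖G l‖ ≤ C * c⁻¹)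
    (hlip : ∀ l c l' c', 0 < c → ImGe l c → 0 < c' → ImGe l' c' →
      ‖G l - G l'‖ ≤ C * (c⁻¹ * c'⁻¹) * ‖l' - l‖)
    {c ε K : ℝ} (hc : 0 < c) (hl : ImGe l c) (hcl : c ≤ ‖l‖) (hg : (-matIm g).PosDef)
    (hgn : ‖g‖ ≤ C * c⁻¹) (hε : ‖(l - a₀ - covMap a g) * g - 1‖ ≤ ε)
    (hK₀ : ‖a₀‖ ≤ K) (hK : ∑ j, ‖a j‖ ≤ K) :
    ‖g - G l‖ ≤ 8 * C * (1 + 2 * C) * ε * (‖l‖ + K) ^ 2 * c⁻¹ ^ 3 := by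
  have hε0 : 0 ≤ ε := (norm_nonneg _).trans hε
  have hK0 : 0 ≤ K := (norm_nonneg _).trans hK₀
  have hci : 0 < c⁻¹ := inv_pos.2 hc
  set k := c⁻¹ with hk
  have hck : c * k = 1 := mul_inv_cancel₀ hc.ne'
  set L := ‖l‖ + K with hL
  have hcL : c ≤ L := by linarith
  have hLk : 1 ≤ L * k := by rw [← hck]; gcongr
  -- `D` dominates both `‖l - a₀ - η(g)‖` and `L`; the latter uses `L k ≥ 1`, which comes from `c ≤
  -- ‖l‖`.
  obtain ⟨D, hD⟩ : ∃ D, D = (1 + 2 * C) * L ^ 2 * k := ⟨_, rfl⟩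
  have hL0 : 0 < L := hc.trans_le hcL
  have hD1 : L ^ 2 * k ≤ D := by
    rw [hD, mul_assoc]; exact le_mul_of_one_le_left (by positivity) (by linarith)
  have hDL : L ≤ D := by
    refine le_trans ?_ hD1
    rw [sq, mul_assoc]; exact le_mul_of_one_le_right hL0.le hLk
  have htarget : 8 * C * (1 + 2 * C) * ε * L ^ 2 * k ^ 3 = 8 * C * (ε * D) * k ^ 2 := by
    rw [hD]; ring
  rw [htarget]
  -- When `εD` is not small against `c`, the trivial bound `‖g‖ + ‖G l‖ ≤ 2Ck` already suffices.
  -- Otherwise the shift `2εD` is at most `c / 2`, and half of the imaginary part survives.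
  rcases lt_or_ge c (4 * (ε * D)) with h4 | h4
  · calc ‖g - G l‖ ≤ ‖g‖ + ‖G l‖ := norm_sub_le _ _
      _ ≤ C * k + C * k := add_le_add hgn (hG l c hc hl).2.2
      _ = 2 * C * (c * k) * k := by rw [hck]; ring
      _ = 2 * C * c * k ^ 2 := by ring
      _ ≤ 2 * C * (4 * (ε * D)) * k ^ 2 := by gcongr
      _ = _ := by ring
  have hε4 : ε ≤ 1 / 4 := by
    by_contra hlt
    push Not at hlt
    have : ε * D > 1 / 4 * c := by
      calc 1 / 4 * c < ε * c := by gcongr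
        _ ≤ ε * D := by gcongr; linarith
    linarith
  have hWn : ‖l - a₀ - covMap a g‖ ≤ D := by
    have h1 : ‖covMap a g‖ ≤ 2 * K ^ 2 * (C * k) := by
      refine (norm_covMap_le a g).trans ?_
      have h0 : 0 ≤ ∑ j, ‖a j‖ := Finset.sum_nonneg fun _ _ => norm_nonneg _
      have h1 := pow_le_pow_left₀ h0 hK 2
      exact mul_le_mul (by linarith) hgn (norm_nonneg g) (by positivity)
    have h2 : ‖l - a₀ - covMap a g‖ ≤ ‖l‖ + ‖a₀‖ + ‖covMap a g‖ := by
      exact (norm_sub_le _ _).trans (add_le_add_left (norm_sub_le _ _) _)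
    have h3 : L ≤ L ^ 2 * k := by
      rw [sq, mul_assoc]; exact le_mul_of_one_le_right hL0.le hLk
    have h4 : K ^ 2 ≤ L ^ 2 := by gcongr; linarith [norm_nonneg l]
    have h5 : 2 * K ^ 2 * (C * k) ≤ 2 * L ^ 2 * (C * k) := by gcongr
    rw [hD]
    linarith
  obtain ⟨Λ, hsol, hn⟩ := exists_isDysonSol_of_approx hε hε4 hWn
  have hΛi : ImGe Λ (c / 2) := by
    have := hl.add_of_norm_le (hn.trans (by linarith : _ ≤ c / 2))
    rwa [add_sub_cancel, sub_half] at this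
  obtain ⟨s1, s2, -⟩ := hG Λ (c / 2) (by positivity) hΛi
  have heq : g = G Λ :=
    hsol.unique hm ha₀ (hΛi.posDef (by positivity)) s1 hg s2
  have hc2 : (c / 2)⁻¹ = 2 * k := by rw [hk, inv_div]; ring
  have hfin := hlip _ _ _ _ (by positivity) hΛi hc hl
  rw [← heq, hc2, norm_sub_rev l Λ] at hfin
  have hD0 : 0 ≤ ε * D := mul_nonneg hε0 (by linarith)
  calc ‖g - G l‖ ≤ C * (2 * k * k) * (2 * (ε * D)) := hfin.trans (by gcongr)
    _ = 4 * (C * (ε * D) * k ^ 2) := by ring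
    _ ≤ 8 * (C * (ε * D) * k ^ 2) := by gcongr; norm_num
    _ = _ := by ring

end Dyson

/-! ### Operator norm against matrix entries -/

theorem norm_single_one_le {m : ℕ} (p q : Fin m) :
    ‖(Matrix.single p q 1 : Matrix (Fin m) (Fin m) ℂ)‖ ≤ 1 := by
  have h1 : star (Matrix.single p q 1 : Matrix (Fin m) (Fin m) ℂ) * Matrix.single p q 1
      = Matrix.diagonal (Pi.single q 1) := by
    rw [Matrix.star_eq_conjTranspose, Matrix.conjTranspose_single, Matrix.single_mul_single_same,
      star_one, mul_one, Matrix.diagonal_single]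
  have h2 := CStarRing.norm_star_mul_self (x := (Matrix.single p q 1 : Matrix (Fin m) (Fin m) ℂ))
  rw [h1, Matrix.l2_opNorm_diagonal] at h2
  have h3 : ‖(Pi.single q 1 : Fin m → ℂ)‖ ≤ 1 := by
    rw [pi_norm_le_iff_of_nonneg zero_le_one]
    intro i
    by_cases h : i = q
    · subst h; simp
    · simp [h]
  nlinarith [norm_nonneg (Matrix.single p q 1 : Matrix (Fin m) (Fin m) ℂ)]

theorem norm_le_of_entries_le {m : ℕ} (x : Matrix (Fin m) (Fin m) ℂ) {c : ℝ}
    (h : ∀ p q, ‖x p q‖ ≤ c) : ‖x‖ ≤ m ^ 2 * c := by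
  rw [Matrix.matrix_eq_sum_single x]
  have : ∀ p q, ‖Matrix.single p q (x p q)‖ ≤ c := by
    intro p q
    rw [← mul_one (x p q), ← smul_eq_mul, ← Matrix.smul_single, norm_smul]
    calc _ ≤ ‖x p q‖ * 1 := by gcongr; exact norm_single_one_le p q
      _ ≤ c := by rw [mul_one]; exact h p q
  refine (norm_sum_le_of_le _ fun p _ => norm_sum_le_of_le _ fun q _ => this p q).trans_eq ?_
  simp; ring

theorem norm_entry_le {m : ℕ} (x : Matrix (Fin m) (Fin m) ℂ) (p q : Fin m) : ‖x p q‖ ≤ ‖x‖ := by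
  have h := Matrix.l2_opNorm_mulVec x (EuclideanSpace.single q (1 : ℂ))
  rw [PiLp.norm_single, norm_one, mul_one] at h
  refine le_trans ?_ h
  refine le_trans (le_of_eq ?_) (PiLp.norm_apply_le _ p)
  simp

/-! ### States and the slice expectation -/

namespace IsState

variable {A : Type*} [CStarAlgebra A] {τ : A →ₗ[ℂ] ℂ}

theorem nonneg_of_nonneg [PartialOrder A] [StarOrderedRing A] (hτ : IsState τ) {x : A}
    (hx : 0 ≤ x) : 0 ≤ τ x := by
  obtain ⟨y, rfl⟩ := CStarAlgebra.nonneg_iff_eq_star_mul_self.1 hx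
  exact hτ.nonneg y

theorem exists_real_of_isSelfAdjoint (hτ : IsState τ) {x : A} (hx : IsSelfAdjoint x) :
    ∃ t : ℝ, τ x = t ∧ |t| ≤ ‖x‖ := by
  let _ := CStarAlgebra.spectralOrder A
  have _ := CStarAlgebra.spectralOrderedRing A
  have h1 := hτ.nonneg_of_nonneg (sub_nonneg.2 hx.le_algebraMap_norm_self)
  have h2 := hτ.nonneg_of_nonneg (sub_nonneg.2 hx.neg_algebraMap_norm_le_self)
  have e : τ (algebraMap ℝ A ‖x‖) = ‖x‖ := by
    rw [Algebra.algebraMap_eq_smul_one, ← Complex.coe_smul, map_smul, hτ.map_one]; simp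
  rw [map_sub, e, Complex.nonneg_iff] at h1
  rw [map_sub, map_neg, e, Complex.nonneg_iff] at h2
  simp at h1 h2
  refine ⟨(τ x).re, Complex.ext (by simp) (by simp [h1.2]), abs_le.2 ⟨by linarith, h1.1⟩⟩

theorem apply_star (hτ : IsState τ) (x : A) : τ (star x) = star (τ x) := by
  obtain ⟨s, hs, -⟩ := hτ.exists_real_of_isSelfAdjoint (realPart x).2
  obtain ⟨t, ht, -⟩ := hτ.exists_real_of_isSelfAdjoint (imaginaryPart x).2
  have h := realPart_add_I_smul_imaginaryPart x
  have h' : star x = (realPart x : A) - Complex.I • (imaginaryPart x : A) := by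
    conv_lhs => rw [← h]
    rw [star_add, star_smul, (realPart x).2.star_eq, (imaginaryPart x).2.star_eq]
    simp [sub_eq_add_neg]
  rw [h']
  conv_rhs => rw [← h]
  rw [map_sub, map_add, map_smul, hs, ht]
  simp [sub_eq_add_neg]

/-- The factor `2` comes from treating real and imaginary parts separately; it only affects the
final constant. -/
theorem norm_apply_le (hτ : IsState τ) (x : A) : ‖τ x‖ ≤ 2 * ‖x‖ := by
  obtain ⟨s, hs, hs'⟩ := hτ.exists_real_of_isSelfAdjoint (realPart x).2
  obtain ⟨t, ht, ht'⟩ := hτ.exists_real_of_isSelfAdjoint (imaginaryPart x).2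
  have h1 : ‖(realPart x : A)‖ ≤ ‖x‖ := realPart.norm_le x
  have h2 : ‖(imaginaryPart x : A)‖ ≤ ‖x‖ := imaginaryPart.norm_le x
  rw [← realPart_add_I_smul_imaginaryPart x, map_add, map_smul, hs, ht,
    realPart_add_I_smul_imaginaryPart x]
  refine (norm_add_le _ _).trans ?_
  simp
  linarith

end IsState

section SliceExp

variable {m : ℕ} {A : Type*} [CStarAlgebra A] [PartialOrder A] [StarOrderedRing A]

/-- The inclusion `a ↦ a ⊗ 1`. -/
noncomputable def tensOne (m : ℕ) (A : Type*) [CStarAlgebra A] [PartialOrder A]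
    [StarOrderedRing A] :
    Matrix (Fin m) (Fin m) ℂ →⋆ₐ[ℂ] CStarMatrix (Fin m) (Fin m) A where
  toFun a := CStarMatrix.ofMatrix (tens a 1)
  map_one' := by
    ext p q
    by_cases h : p = q
    · subst h; simp [tens]
    · simp [tens, h]
  map_mul' a b := by
    ext p q
    simp [tens, CStarMatrix.mul_apply, Matrix.mul_apply, Finset.sum_smul, smul_smul, mul_comm]
  map_zero' := by ext p q; simp [tens]
  map_add' a b := by ext p q; simp [tens, add_smul]
  commutes' z := by
    ext p q
    by_cases h : p = q
    · subst h; simp [tens, Algebra.algebraMap_eq_smul_one]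
    · simp [tens, h, Algebra.algebraMap_eq_smul_one]
  map_star' a := by
    ext p q
    simp [tens, CStarMatrix.star_apply]

/-- The conditional expectation `id ⊗ τ`. -/
noncomputable def sliceExp (m : ℕ) {τ : A →ₗ[ℂ] ℂ} (hτ : IsState τ) :
    MatExp m (CStarMatrix (Fin m) (Fin m) A) where
  inc := tensOne m A
  E :=
    { toFun := fun u => slice τ (CStarMatrix.ofMatrix.symm u)
      map_add' := fun u v => by ext p q; simp [slice]
      map_smul' := fun z u => by ext p q; simp [slice] }
  inc_mul a x := by
    ext p q
    simp [slice, tensOne, tens, CStarMatrix.mul_apply, Matrix.mul_apply]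
  mul_inc a x := by
    ext p q
    simp [slice, tensOne, tens, CStarMatrix.mul_apply, Matrix.mul_apply, mul_comm]
  E_one := by
    ext p q
    by_cases h : p = q
    · subst h; simp [slice, hτ.map_one]
    · simp [slice, h]
  E_star x := by
    ext p q
    simp [slice, CStarMatrix.star_apply, hτ.apply_star]
  pos x := by
    rw [Matrix.posSemidef_iff_dotProduct_mulVec]
    refine ⟨?_, fun v => ?_⟩
    · ext p q
      simp [slice, CStarMatrix.mul_apply, CStarMatrix.star_apply, ← hτ.apply_star]
    -- The quadratic form of the slice of `x*x` at `v` splits over the rows `k` of `x`, each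
    -- contributing `τ` of a square.
    · have : star v ⬝ᵥ (slice τ (CStarMatrix.ofMatrix.symm (star x * x))).mulVec v
          = ∑ k, τ (star (∑ q, v q • x k q) * (∑ q, v q • x k q)) := by
        simp only [dotProduct, Matrix.mulVec, slice, Matrix.map_apply,
          CStarMatrix.ofMatrix_symm_apply, CStarMatrix.mul_apply, CStarMatrix.star_apply, map_sum,
          star_sum, Finset.sum_mul, Finset.mul_sum, star_smul, smul_mul_assoc, mul_smul_comm,
          map_smul, smul_eq_mul, Pi.star_apply]
        rw [Finset.sum_congr rfl fun p _ => Finset.sum_comm, Finset.sum_comm]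
        refine Finset.sum_congr rfl fun k _ => ?_
        rw [Finset.sum_comm]
        refine Finset.sum_congr rfl fun p _ => Finset.sum_congr rfl fun q _ => ?_
        ring
      change 0 ≤ star v ⬝ᵥ (slice τ (CStarMatrix.ofMatrix.symm (star x * x))).mulVec v
      rw [this]
      exact Finset.sum_nonneg fun k _ => hτ.nonneg _
  bound x := by
    refine (norm_le_of_entries_le (c := 2 * ‖x‖) _ fun p q => ?_).trans_eq (by ring)
    refine (hτ.norm_apply_le _).trans ?_
    gcongr
    exact CStarMatrix.norm_entry_le_norm

end SliceExp

/-! ### Chebyshev polynomials and the semicircle law -/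

section Semicircle

open Polynomial Polynomial.Chebyshev

theorem integral_semicircleLaw (f : ℝ → ℝ) :
    ∫ t, f t ∂semicircleLaw =
      ∫ t in (-2 : ℝ)..2, ((2 * Real.pi)⁻¹ * Real.sqrt (4 - t ^ 2)) * f t := by
  have h0 : ∀ t : ℝ, 0 ≤ (2 * Real.pi)⁻¹ * Real.sqrt (4 - t ^ 2) := fun t => by positivity
  rw [semicircleLaw, integral_withDensity_eq_integral_toReal_smul (by fun_prop) (by simp),
    intervalIntegral.integral_of_le (by norm_num), ← integral_Icc_eq_integral_Ioc]
  simp_rw [ENNReal.toReal_ofReal (h0 _), smul_eq_mul]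

/-- The substitution `t = 2u` turns `S` into `U` and the semicircle weight into a multiple of `1 -
u²` against the arcsine measure. There `(1 - u²) U_{n+1} = (T_{n+1} - T_{n+3}) / 2`, and both `T`
have mean zero. The shift by one excludes `S_0 = 1`. -/
theorem integral_eval_S_semicircleLaw (n : ℕ) :
    ∫ t, (S ℝ ((n : ℤ) + 1)).eval t ∂semicircleLaw = 0 := by
  have h1 : ∀ t : ℝ, ((2 * Real.pi)⁻¹ * Real.sqrt (4 - (2 * t) ^ 2)) *
      (S ℝ ((n : ℤ) + 1)).eval (2 * t) =
      Real.pi⁻¹ * (((1 - X ^ 2) * U ℝ ((n : ℤ) + 1)).eval t * Real.sqrt (1 - t ^ 2)⁻¹) := by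
    intro t
    have e1 : (S ℝ ((n : ℤ) + 1)).eval (2 * t) = (U ℝ ((n : ℤ) + 1)).eval t := by
      rw [← S_comp_two_mul_X, eval_comp]; simp
    have e2 : Real.sqrt (4 - (2 * t) ^ 2) = 2 * Real.sqrt (1 - t ^ 2) := by
      rw [show 4 - (2 * t) ^ 2 = 2 ^ 2 * (1 - t ^ 2) by ring, Real.sqrt_mul (by positivity),
        Real.sqrt_sq (by norm_num)]
    have e3 : (1 - t ^ 2) * (Real.sqrt (1 - t ^ 2))⁻¹ = Real.sqrt (1 - t ^ 2) := by
      rw [← div_eq_mul_inv, Real.div_sqrt]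
    rw [e1, e2, Real.sqrt_inv, eval_mul]
    simp only [eval_sub, eval_one, eval_pow, eval_X]
    rw [show (1 - t ^ 2) * eval t (U ℝ (n + 1)) * (Real.sqrt (1 - t ^ 2))⁻¹
      = ((1 - t ^ 2) * (Real.sqrt (1 - t ^ 2))⁻¹) * eval t (U ℝ (n + 1)) by ring, e3]
    field_simp
  have h2 : (1 - X ^ 2) * U ℝ ((n : ℤ) + 1)
      = C (1 / 2) * (T ℝ ((n : ℤ) + 1) - T ℝ ((n : ℤ) + 1 + 2)) := by
    rw [one_sub_X_sq_mul_U_eq_pol_in_T]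
    have := T_add_two ℝ ((n : ℤ) + 1)
    rw [this]
    have h3 : (C (1 / 2) : ℝ[X]) * 2 = 1 := by
      rw [show (2 : ℝ[X]) = C 2 by rfl, ← Polynomial.C_mul]; norm_num
    linear_combination (-(T ℝ ((n : ℤ) + 1)) + X * T ℝ ((n : ℤ) + 1 + 1)) * h3
  rw [integral_semicircleLaw]
  have h3 := intervalIntegral.integral_comp_mul_left (a := -1) (b := 1)
    (fun t => ((2 * Real.pi)⁻¹ * Real.sqrt (4 - t ^ 2)) * (S ℝ ((n : ℤ) + 1)).eval t)
    (c := 2) (by norm_num)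
  norm_num at h3
  have h4 : ∫ t in (-1 : ℝ)..1, ((2 * Real.pi)⁻¹ * Real.sqrt (4 - (2 * t) ^ 2)) *
      (S ℝ ((n : ℤ) + 1)).eval (2 * t) = 0 := by
    simp_rw [h1]
    rw [intervalIntegral.integral_const_mul, ← integral_measureT, h2]
    simp_rw [eval_mul, eval_sub, eval_C]
    rw [integral_const_mul, integral_sub (integrable_measureT (by fun_prop))
      (integrable_measureT (by fun_prop)),
      integral_eval_T_real_measureT_of_ne_zero (by positivity),
      integral_eval_T_real_measureT_of_ne_zero (by positivity)]
    simp
  norm_num at h4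
  rw [h4] at h3
  simpa using h3.symm

variable {A : Type*} [CStarAlgebra A] {τ : A →ₗ[ℂ] ℂ}

theorem integral_eval_semicircleLaw (p : ℝ[X]) :
    ∫ t, p.eval t ∂semicircleLaw =
      ∑ k ∈ Finset.range (p.natDegree + 1), p.coeff k * ∫ t, t ^ k ∂semicircleLaw := by
  simp_rw [integral_semicircleLaw, ← intervalIntegral.integral_const_mul]
  rw [← intervalIntegral.integral_finsetSum]
  · congr 1
    ext t
    rw [eval_eq_sum_range, Finset.mul_sum]
    exact Finset.sum_congr rfl fun k _ => by ring
  · intro k _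
    exact Continuous.intervalIntegrable (by fun_prop) _ _

theorem apply_aeval_of_moments {x : A}
    (hx : ∀ k : ℕ, τ (x ^ k) = ((∫ t, t ^ k ∂semicircleLaw : ℝ) : ℂ)) (p : ℝ[X]) :
    τ (aeval x (p.map (algebraMap ℝ ℂ))) = ((∫ t, p.eval t ∂semicircleLaw : ℝ) : ℂ) := by
  rw [integral_eval_semicircleLaw, aeval_eq_sum_range, map_sum, Complex.ofReal_sum,
    natDegree_map]
  refine Finset.sum_congr rfl fun k _ => ?_
  rw [map_smul, hx, coeff_map, smul_eq_mul, Complex.ofReal_mul]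
  rfl

theorem apply_aeval_S {x : A}
    (hx : ∀ k : ℕ, τ (x ^ k) = ((∫ t, t ^ k ∂semicircleLaw : ℝ) : ℂ)) (n : ℕ) :
    τ (aeval x (S ℂ ((n : ℤ) + 1))) = 0 := by
  have := apply_aeval_of_moments hx (S ℝ ((n : ℤ) + 1))
  rwa [map_S, integral_eval_S_semicircleLaw, Complex.ofReal_zero] at this

end Semicircle

/-! ### Reduced words in a free semicircular family -/

section FreeWord

variable {ι : Type*} [DecidableEq ι] {A : Type*} [Ring A]

/-- The reduced words in the `x i`: products of Chebyshev polynomials of the blocks of a word. -/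
def freeWord (x : ι → A) : List ι → A
  | [] => 1
  | [i] => x i
  | i :: j :: t => x i * freeWord x (j :: t) - if i = j then freeWord x t else 0

@[simp] theorem freeWord_nil (x : ι → A) : freeWord x [] = 1 := by rw [freeWord]

@[simp] theorem freeWord_singleton (x : ι → A) (i : ι) : freeWord x [i] = x i := by rw [freeWord]

theorem freeWord_cons_cons (x : ι → A) (i j : ι) (t : List ι) :
    freeWord x (i :: j :: t) = x i * freeWord x (j :: t) - if i = j then freeWord x t else 0 := by
  rw [freeWord]

theorem freeWord_cons_of_head_ne (x : ι → A) (i : ι) (w : List ι) (h : w.head? ≠ some i) :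
    freeWord x (i :: w) = x i * freeWord x w := by
  cases w with
  | nil => simp
  | cons j t =>
    rw [freeWord_cons_cons, if_neg, sub_zero]
    rintro rfl; simp at h

theorem map_freeWord {A' : Type*} [Ring A'] (f : A →+* A') (x : ι → A) (w : List ι) :
    freeWord (fun i => f (x i)) w = f (freeWord x w) := by
  match w with
  | [] => simp
  | [i] => simp
  | i :: j :: t =>
    rw [freeWord_cons_cons, freeWord_cons_cons, map_freeWord f x (j :: t), map_freeWord f x t,
      map_sub, map_mul]
    congr 1
    split_ifs <;> simp

/-- The subtraction in `freeWord` for two equal leading letters is the recurrence `S_{n+2} = X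
S_{n+1} - S_n`. -/
theorem freeWord_replicate_append [Algebra ℂ A] (x : ι → A) (i : ι) (w : List ι)
    (h : w.head? ≠ some i) (n : ℕ) : freeWord x (List.replicate n i ++ w) =
      Polynomial.aeval (x i) (Polynomial.Chebyshev.S ℂ n) * freeWord x w := by
  match n with
  | 0 => simp
  | 1 => simp [freeWord_cons_of_head_ne x i w h]
  | n + 2 =>
    have e1 := freeWord_replicate_append x i w h (n + 1)
    have e2 := freeWord_replicate_append x i w h n
    simp only [List.replicate_succ, List.cons_append] at e1 e2 ⊢
    rw [freeWord_cons_cons, if_pos rfl, e1, e2]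
    push_cast
    rw [Polynomial.Chebyshev.S_add_two]
    simp [sub_mul, mul_assoc]

/-- Brings a word into the shape that `AreFree` speaks about: its maximal constant runs become the
factors. Agreement of the heads is what keeps neighbouring indices distinct in the recursion. -/
theorem exists_block_decomposition [Algebra ℂ A] (x : ι → A) (w : List ι) :
    ∃ L : List (ι × A), (∀ p ∈ L, ∃ n : ℕ, p.2 =
        Polynomial.aeval (x p.1) (Polynomial.Chebyshev.S ℂ ((n : ℤ) + 1))) ∧
      (L.map Prod.fst).IsChain (· ≠ ·) ∧ (L.map Prod.fst).head? = w.head? ∧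
      (L.map Prod.snd).prod = freeWord x w := by
  match w with
  | [] => exact ⟨[], by simp⟩
  | i :: t =>
    obtain ⟨n, hn⟩ : ∃ n, t.takeWhile (· = i) = List.replicate n i :=
      ⟨_, List.eq_replicate_of_mem fun b hb => by simpa using List.mem_takeWhile_imp hb⟩
    set w' := t.dropWhile (· = i) with hw'
    have hlen : w'.length ≤ t.length := (List.dropWhile_suffix _).length_le
    have hhead : w'.head? ≠ some i := by
      intro h
      have := List.head?_dropWhile_not (fun b => decide (b = i)) t
      rw [← hw', h] at this
      simp at this
    have hsplit : i :: t = List.replicate (n + 1) i ++ w' := by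
      rw [List.replicate_succ, List.cons_append, ← hn, List.takeWhile_append_dropWhile]
    obtain ⟨L, h1, h2, h3, h4⟩ := exists_block_decomposition x w'
    refine ⟨(i, Polynomial.aeval (x i) (Polynomial.Chebyshev.S ℂ ((n : ℤ) + 1))) :: L,
      ?_, ?_, ?_, ?_⟩
    · intro p hp
      rcases List.mem_cons.1 hp with rfl | hp
      · exact ⟨n, rfl⟩
      · exact h1 p hp
    · rw [List.map_cons, List.isChain_cons]
      refine ⟨fun y hy => ?_, h2⟩
      rw [h3] at hy
      rintro rfl
      exact hhead hy
    · simp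
    · rw [List.map_cons, List.prod_cons, h4, hsplit, freeWord_replicate_append x i w' hhead]
      simp
  termination_by w.length
  decreasing_by simp; omega

end FreeWord

/-- Every block is a Chebyshev polynomial of positive degree, hence centred by `apply_aeval_S`, and
neighbouring blocks carry different indices, so freeness applies. -/
theorem IsSemicircularSystem.apply_freeWord {ι : Type*} [DecidableEq ι] {A : Type*}
    [CStarAlgebra A] {τ : A →ₗ[ℂ] ℂ} {x : ι → A} (hx : IsSemicircularSystem τ x) {w : List ι}
    (hw : w ≠ []) : τ (freeWord x w) = 0 := by
  obtain ⟨L, h1, h2, h3, h4⟩ := exists_block_decomposition x w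
  rw [← h4]
  refine hx.free L ?_ ?_ h2
  · rintro rfl
    cases w with
    | nil => exact hw rfl
    | cons => simp at h3
  · intro p hp
    obtain ⟨n, hn⟩ := h1 p hp
    refine ⟨?_, by rw [hn]; exact apply_aeval_S (hx.moments p.1) n⟩
    rw [hn]
    have : Algebra.adjoin ℂ {x p.1} ≤ (StarAlgebra.adjoin ℂ {x p.1}).toSubalgebra :=
      Algebra.adjoin_le (StarAlgebra.subset_adjoin ℂ _)
    exact this (Polynomial.aeval_mem_adjoin_singleton ℂ (x p.1))

/-! ### The resolvent of a semicircular pencil as a series over words -/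

section WordSum

variable {ι : Type*} [Fintype ι] {B : Type*} [Ring B]

/-- The sum of a function over all words of length `k`. -/
def wordSum : ℕ → (List ι → B) → B
  | 0, f => f []
  | k + 1, f => ∑ i, wordSum k fun w => f (i :: w)

theorem wordSum_sub (k : ℕ) (f g : List ι → B) :
    wordSum k (fun w => f w - g w) = wordSum k f - wordSum k g := by
  induction k generalizing f g with
  | zero => rfl
  | succ k ih => simp only [wordSum, ih, Finset.sum_sub_distrib]

theorem wordSum_mul_left (k : ℕ) (b : B) (f : List ι → B) :
    wordSum k (fun w => b * f w) = b * wordSum k f := by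
  induction k generalizing f with
  | zero => rfl
  | succ k ih => simp only [wordSum, ih, Finset.mul_sum]

theorem map_wordSum_eq_zero {M : Type*} [AddCommGroup M] (E : B →+ M) (k : ℕ) (f : List ι → B)
    (h : ∀ w : List ι, w.length = k → E (f w) = 0) : E (wordSum k f) = 0 := by
  induction k generalizing f with
  | zero => exact h [] rfl
  | succ k ih =>
    rw [wordSum, map_sum]
    exact Finset.sum_eq_zero fun i _ => ih _ fun w hw => h _ (by simp [hw])

end WordSum

namespace MatExp

variable {m : ℕ} {B : Type*} [CStarAlgebra B] (φ : MatExp m B)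

/-- The expectation, as a continuous linear map. -/
noncomputable def EL : B →L[ℂ] Matrix (Fin m) (Fin m) ℂ :=
  φ.E.mkContinuous (2 * m ^ 2) φ.bound

theorem EL_apply (x : B) : φ.EL x = φ.E x := rfl

section Ansatz

variable {ι : Type*} [Fintype ι] [DecidableEq ι] (c : ι → Matrix (Fin m) (Fin m) ℂ) (X : ι → B)
  (g : Matrix (Fin m) (Fin m) ℂ)

/-- The coefficients `g c_{i₁} g c_{i₂} ⋯ g` of the reduced words in the resolvent. -/
def wordCoeff : List ι → Matrix (Fin m) (Fin m) ℂ
  | [] => g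
  | i :: w => g * c i * wordCoeff w

/-- The part of the resolvent supported by the words of length `k`. -/
noncomputable def resolventPart (k : ℕ) : B :=
  wordSum k fun w => φ.inc (wordCoeff c g w) * freeWord X w

variable {c X g}

theorem resolventPart_zero : φ.resolventPart c X g 0 = φ.inc g := by
  simp [resolventPart, wordSum, wordCoeff]

theorem resolventPart_one (hX : ∀ i a, X i * φ.inc a = φ.inc a * X i) :
    φ.resolventPart c X g 1 =
      φ.inc g * ((∑ i, φ.inc (c i) * X i) * φ.resolventPart c X g 0) := by
  rw [resolventPart_zero]
  simp only [resolventPart, wordSum, wordCoeff, freeWord_singleton, map_mul, Finset.sum_mul,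
    Finset.mul_sum, mul_assoc, hX]

/-- The correction in `freeWord` for `i = j` contributes `g c i g c i`; summed over `i` it is the
covariance term of the Dyson equation. -/
theorem resolventPart_add_two (hX : ∀ i a, X i * φ.inc a = φ.inc a * X i) (k : ℕ) :
    φ.resolventPart c X g (k + 2) =
      φ.inc g * ((∑ i, φ.inc (c i) * X i) * φ.resolventPart c X g (k + 1)
        - φ.inc (∑ i, c i * g * c i) * φ.resolventPart c X g k) := by
  have e : ∀ i j, (wordSum k fun w => φ.inc (wordCoeff c g (i :: j :: w)) *
        freeWord X (i :: j :: w)) =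
      φ.inc g * (φ.inc (c i) * X i * wordSum k fun w => φ.inc (wordCoeff c g (j :: w)) *
        freeWord X (j :: w)) -
      if i = j then φ.inc g * (φ.inc (c i * g * c i) * wordSum k fun w =>
        φ.inc (wordCoeff c g w) * freeWord X w) else 0 := by
    intro i j
    have : ∀ w, φ.inc (wordCoeff c g (i :: j :: w)) * freeWord X (i :: j :: w) =
        (φ.inc g * (φ.inc (c i) * X i)) * (φ.inc (wordCoeff c g (j :: w)) * freeWord X (j :: w))
        - (if i = j then φ.inc g * φ.inc (c i * g * c i) else 0) *
          (φ.inc (wordCoeff c g w) * freeWord X w) := by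
      intro w
      rw [freeWord_cons_cons, mul_sub]
      congr 1
      · rw [show wordCoeff c g (i :: j :: w) = g * c i * wordCoeff c g (j :: w) from rfl, map_mul,
          map_mul]
        simp only [mul_assoc]
        rw [← mul_assoc (X i) (φ.inc _), hX, mul_assoc]
      · split_ifs with h
        · subst h
          simp only [wordCoeff, map_mul, mul_assoc]
        · simp
    simp_rw [this]
    rw [wordSum_sub, wordSum_mul_left, wordSum_mul_left]
    split_ifs
    · simp only [mul_assoc]
    · simp only [mul_assoc, zero_mul]
  simp only [resolventPart]
  rw [wordSum]
  simp only [wordSum]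
  simp_rw [e]
  simp only [Finset.sum_sub_distrib, Finset.sum_ite_eq, Finset.mem_univ, if_true, map_sum,
    Finset.sum_mul, Finset.mul_sum, mul_sub]
  rw [Finset.sum_comm]

theorem E_resolventPart_succ (hE : ∀ w : List ι, w ≠ [] → φ.E (freeWord X w) = 0) (k : ℕ) :
    φ.E (φ.resolventPart c X g (k + 1)) = 0 := by
  refine map_wordSum_eq_zero φ.E.toAddMonoidHom _ _ fun w hw => ?_
  change φ.E _ = 0
  rw [φ.inc_mul, hE w (by rintro rfl; simp at hw), mul_zero]

/-- The constants fit the two-step recursion exactly: `(1/4)(1/2) + 1/8 = (1/2)²`. -/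
theorem norm_resolventPart_le (hX : ∀ i a, X i * φ.inc a = φ.inc a * X i)
    (h1 : ‖g‖ * ‖∑ i, φ.inc (c i) * X i‖ ≤ 1 / 4) (h2 : ‖g‖ * ‖∑ i, c i * g * c i‖ ≤ 1 / 8)
    (k : ℕ) : ‖φ.resolventPart c X g k‖ ≤ (1 / 2) ^ k * ‖g‖ := by
  set S := ∑ i, φ.inc (c i) * X i with hS
  have a1 : ∀ k, ‖φ.inc g * (S * φ.resolventPart c X g k)‖ ≤
      1 / 4 * ‖φ.resolventPart c X g k‖ := fun k => by
    calc _ ≤ ‖φ.inc g‖ * (‖S‖ * ‖φ.resolventPart c X g k‖) :=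
          (norm_mul_le _ _).trans (by gcongr; exact norm_mul_le _ _)
      _ ≤ ‖g‖ * (‖S‖ * ‖φ.resolventPart c X g k‖) := by gcongr; exact φ.norm_inc_le g
      _ = (‖g‖ * ‖S‖) * ‖φ.resolventPart c X g k‖ := by ring
      _ ≤ _ := by gcongr
  have a2 : ∀ k, ‖φ.inc g * (φ.inc (∑ i, c i * g * c i) * φ.resolventPart c X g k)‖ ≤
      1 / 8 * ‖φ.resolventPart c X g k‖ := fun k => by
    calc _ ≤ ‖φ.inc g‖ * (‖φ.inc (∑ i, c i * g * c i)‖ * ‖φ.resolventPart c X g k‖) :=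
          (norm_mul_le _ _).trans (by gcongr; exact norm_mul_le _ _)
      _ ≤ ‖g‖ * (‖∑ i, c i * g * c i‖ * ‖φ.resolventPart c X g k‖) := by
          gcongr
          exacts [φ.norm_inc_le g, φ.norm_inc_le _]
      _ = (‖g‖ * ‖∑ i, c i * g * c i‖) * ‖φ.resolventPart c X g k‖ := by ring
      _ ≤ _ := by gcongr
  have a0 : ‖φ.resolventPart c X g 0‖ ≤ ‖g‖ := by
    rw [resolventPart_zero]; exact φ.norm_inc_le g
  induction k using Nat.twoStepInduction with
  | zero => simpa using a0
  | one =>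
    rw [φ.resolventPart_one hX, ← hS]
    have := a1 0
    have := norm_nonneg g
    linarith
  | more k ih1 ih2 =>
    rw [φ.resolventPart_add_two hX, ← hS, mul_sub]
    refine (norm_sub_le _ _).trans ((add_le_add (a1 _) (a2 _)).trans ?_)
    calc _ ≤ 1 / 4 * ((1 / 2) ^ (k + 1) * ‖g‖) + 1 / 8 * ((1 / 2) ^ k * ‖g‖) := by gcongr
      _ = _ := by ring

/-- If `g` is a small solution of the Dyson equation, it is the expectation of the resolvent of a
semicircular pencil. -/
theorem E_resolvent_eq_of_small (hX : ∀ i a, X i * φ.inc a = φ.inc a * X i)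
    (hE : ∀ w : List ι, w ≠ [] → φ.E (freeWord X w) = 0)
    (h1 : ‖g‖ * ‖∑ i, φ.inc (c i) * X i‖ ≤ 1 / 4) (h2 : ‖g‖ * ‖∑ i, c i * g * c i‖ ≤ 1 / 8)
    {l : Matrix (Fin m) (Fin m) ℂ} (hg : (l - ∑ i, c i * g * c i) * g = 1)
    (hu : IsUnit (φ.inc l - ∑ i, φ.inc (c i) * X i)) :
    φ.E (Ring.inverse (φ.inc l - ∑ i, φ.inc (c i) * X i)) = g := by
  set S := ∑ i, φ.inc (c i) * X i with hS
  set V := φ.resolventPart c X g with hV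
  set q := ∑ i, c i * g * c i with hq
  have hsum : Summable V := by
    refine Summable.of_norm_bounded (g := fun k => (1 / 2 : ℝ) ^ k * ‖g‖)
      (Summable.mul_right _ (summable_geometric_of_lt_one (by norm_num) (by norm_num)))
      (φ.norm_resolventPart_le hX h1 h2)
  have hs1 : Summable fun k => V (k + 1) := (summable_nat_add_iff 1).2 hsum
  have hs2 : Summable fun k => V (k + 2) := (summable_nat_add_iff 2).2 hsum
  set R := ∑' k, V k with hR
  have hWg : φ.inc (l - q) * φ.inc g = 1 := by rw [← map_mul, hg, map_one]
  have r1 : R = V 0 + ∑' k, V (k + 1) := hsum.tsum_eq_zero_add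
  have r2 : ∑' k, V (k + 1) = V 1 + ∑' k, V (k + 2) := hs1.tsum_eq_zero_add
  have r3 : φ.inc (l - q) * ∑' k, V (k + 2) = S * (∑' k, V (k + 1)) - φ.inc q * R := by
    rw [← hs2.tsum_mul_left, ← hs1.tsum_mul_left, hR, ← hsum.tsum_mul_left,
      ← (hs1.mul_left S).tsum_sub (hsum.mul_left _)]
    refine tsum_congr fun k => ?_
    rw [hV, φ.resolventPart_add_two hX, ← mul_assoc, hWg, one_mul]
  -- Summing the recursions of all parts gives `(l - q) R = 1 + S R - q R`, and the terms in `q`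
  -- cancel.
  have r4 : (φ.inc l - S) * R = 1 := by
    have v0 : φ.inc (l - q) * V 0 = 1 := by rw [hV, resolventPart_zero, hWg]
    have v1 : φ.inc (l - q) * V 1 = S * V 0 := by
      rw [hV, φ.resolventPart_one hX, ← mul_assoc, hWg, one_mul]
    have t1 : φ.inc (l - q) * R = 1 + (S * V 0 + (S * (∑' k, V (k + 1)) - φ.inc q * R)) := by
      conv_lhs => rw [r1, r2, mul_add, mul_add, v0, v1, r3]
    have t2 : S * R = S * V 0 + S * ∑' k, V (k + 1) := by
      conv_lhs => rw [r1, mul_add]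
    rw [map_sub, sub_mul] at t1
    rw [sub_mul, t2, sub_eq_iff_eq_add.1 t1]
    abel
  have r5 : Ring.inverse (φ.inc l - S) = R := by
    have := Ring.inverse_mul_cancel _ hu
    calc _ = Ring.inverse (φ.inc l - S) * ((φ.inc l - S) * R) := by rw [r4, mul_one]
      _ = R := by rw [← mul_assoc, this, one_mul]
  rw [r5, ← φ.EL_apply, hR, φ.EL.map_tsum hsum,
    (φ.EL.summable hsum).tsum_eq_zero_add]
  -- Every nonempty word is centred, so only the term `g` of the empty word survives.
  have : ∀ k, φ.EL (V (k + 1)) = 0 := fun k => φ.E_resolventPart_succ hE k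
  simp only [this, tsum_zero, add_zero]
  rw [hV, resolventPart_zero, φ.EL_apply, φ.E_inc]

end Ansatz

/-- The Dyson equation extends from spectral parameters with large imaginary part to all spectral
parameters with positive imaginary part. -/
theorem isDysonSol_of_large {r : ℕ} {a₀ : Matrix (Fin m) (Fin m) ℂ}
    {a : Fin r → Matrix (Fin m) (Fin m) ℂ} {s : B} (hs : IsSelfAdjoint s) {c₀ : ℝ}
    (h : ∀ l c, 0 < c → c₀ ≤ c → ImGe l c →
      IsDysonSol a₀ a l (φ.E (Ring.inverse (φ.inc l - s))))
    {l : Matrix (Fin m) (Fin m) ℂ} {c : ℝ} (hc : 0 < c) (hl : ImGe l c) :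
    IsDysonSol a₀ a l (φ.E (Ring.inverse (φ.inc l - s))) := by
  -- The equation is continued analytically along the line `l + z`: it holds for large `Im z`, and
  -- the half-plane is connected and contains `z = 0`.
  set U : Set ℂ := {z | -c < z.im} with hU
  have hUo : IsOpen U := isOpen_lt continuous_const Complex.continuous_im
  have hUc : IsPreconnected U := (convex_halfSpace_im_gt (-c)).isPreconnected
  set G : ℂ → Matrix (Fin m) (Fin m) ℂ :=
    fun z => φ.EL (Ring.inverse (φ.inc (l + z • 1) - s)) with hG
  set f : ℂ → Matrix (Fin m) (Fin m) ℂ :=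
    fun z => (l + z • 1 - a₀ - covMap a (G z)) * G z with hf
  have hGd : DifferentiableOn ℂ G U := by
    intro z hz
    refine DifferentiableAt.differentiableWithinAt ?_
    have hz' : -c < z.im := hz
    have hu := (φ.resolvent_bound (by linarith : 0 < c + z.im) (hl.add_smul_one z) hs).1
    have h1 : DifferentiableAt ℂ (fun z : ℂ => φ.inc (l + z • 1) - s) z := by
      have : (fun z : ℂ => φ.inc (l + z • 1) - s) = fun z => φ.inc l + z • 1 - s := by
        ext z; rw [map_add, map_smul, map_one]
      rw [this]
      fun_prop
    have h2 : DifferentiableAt ℂ (fun z : ℂ => Ring.inverse (φ.inc (l + z • 1) - s)) z :=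
      (differentiableAt_inverse hu).fun_comp' z h1
    exact φ.EL.differentiableAt.fun_comp' z h2
  have hfd : DifferentiableOn ℂ f U := by
    have : DifferentiableOn ℂ (fun z => covMap a (G z)) U := by
      unfold covMap
      exact DifferentiableOn.fun_sum fun j _ =>
        ((hGd.const_mul _).mul_const _).add ((hGd.const_mul _).mul_const _)
    have h2 : DifferentiableOn ℂ (fun z : ℂ => l + z • 1 - a₀) U := by fun_prop
    exact (h2.sub this).mul hGd
  obtain ⟨t, ht⟩ : ∃ t : ℝ, t = max c₀ c := ⟨_, rfl⟩
  have htc : c ≤ t := ht ▸ le_max_right _ _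
  have ht0 : c₀ ≤ t := ht ▸ le_max_left _ _
  have hz₀ : ((t + 1 : ℝ) : ℂ) * Complex.I ∈ U := by
    change -c < _
    simp; linarith
  have hev : f =ᶠ[nhds (((t + 1 : ℝ) : ℂ) * Complex.I)] fun _ => 1 := by
    have : {z : ℂ | t < z.im} ∈ nhds (((t + 1 : ℝ) : ℂ) * Complex.I) :=
      (isOpen_lt continuous_const Complex.continuous_im).mem_nhds (by simp)
    filter_upwards [this] with z hz
    have hz : t < z.im := hz
    exact h (l + z • 1) (c + z.im) (by linarith) (by linarith) (hl.add_smul_one z)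
  have key := (hfd.analyticOnNhd hUo).eqOn_of_preconnected_of_eventuallyEq
    analyticOnNhd_const hUc hz₀ hev
  have h0 := key (show (0 : ℂ) ∈ U by change -c < _; simpa using hc)
  simpa [hf, hG, IsDysonSol, φ.EL_apply] using h0

end MatExp

/-! ### The Dyson equation for the circular pencil -/

section Pencil

variable {m r : ℕ} {A : Type*} [CStarAlgebra A] [PartialOrder A] [StarOrderedRing A]

theorem slicedResolvent_eq {τ : A →ₗ[ℂ] ℂ} (hτ : IsState τ) (a₀ : Matrix (Fin m) (Fin m) ℂ)
    (a : Fin r → Matrix (Fin m) (Fin m) ℂ) (x : Fin r → A) (l : Matrix (Fin m) (Fin m) ℂ) :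
    slicedResolvent τ a₀ a x l = (sliceExp m hτ).E (Ring.inverse ((sliceExp m hτ).inc l -
      CStarMatrix.ofMatrix (linPencil a₀ a x))) := rfl

omit [PartialOrder A] [StarOrderedRing A] in
theorem isSelfAdjoint_linPencil {a₀ : Matrix (Fin m) (Fin m) ℂ} (ha₀ : a₀.IsHermitian)
    (a : Fin r → Matrix (Fin m) (Fin m) ℂ) (x : Fin r → A) :
    IsSelfAdjoint (CStarMatrix.ofMatrix (linPencil a₀ a x)) := by
  have h : star (linPencil a₀ a x) = linPencil a₀ a x := by
    have h1 : ∀ (b : Matrix (Fin m) (Fin m) ℂ) (z : A), star (tens b z) =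
        tens b.conjTranspose (star z) := by
      intro b z; ext p q; simp [tens, Matrix.star_apply]
    rw [linPencil, star_add, star_sum, h1, ha₀.eq, star_one]
    congr 1
    refine Finset.sum_congr rfl fun j _ => ?_
    rw [star_add, h1, h1, star_star, Matrix.conjTranspose_conjTranspose, add_comm]
  exact h

/-- The inclusion `x ↦ 1 ⊗ x`. -/
noncomputable def oneTens (m : ℕ) (A : Type*) [CStarAlgebra A] [PartialOrder A]
    [StarOrderedRing A] : A →+* CStarMatrix (Fin m) (Fin m) A :=
  (CStarMatrix.ofMatrixRingEquiv : Matrix (Fin m) (Fin m) A ≃+* _).toRingHom.comp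
    (Matrix.scalar (Fin m))

theorem oneTens_apply (x : A) (p q : Fin m) : oneTens m A x p q = if p = q then x else 0 := by
  change Matrix.scalar (Fin m) x p q = _
  rw [Matrix.scalar_apply, Matrix.diagonal_apply]

theorem ofMatrix_tens (b : Matrix (Fin m) (Fin m) ℂ) (x : A) :
    CStarMatrix.ofMatrix (tens b x) = tensOne m A b * oneTens m A x := by
  ext p q
  rw [CStarMatrix.mul_apply]
  simp [oneTens_apply, tensOne, tens]

theorem oneTens_mul_tensOne (b : Matrix (Fin m) (Fin m) ℂ) (x : A) :
    oneTens m A x * tensOne m A b = tensOne m A b * oneTens m A x := by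
  ext p q
  rw [CStarMatrix.mul_apply, CStarMatrix.mul_apply]
  simp [oneTens_apply, tensOne, tens]

theorem sliceExp_E_oneTens {τ : A →ₗ[ℂ] ℂ} (hτ : IsState τ) {x : A} (hx : τ x = 0) :
    (sliceExp m hτ).E (oneTens m A x) = 0 := by
  ext p q
  change τ (oneTens m A x p q) = 0
  rw [oneTens_apply]
  split_ifs <;> simp [hx]

/-- The coefficients of a linear pencil with respect to a semicircular system. -/
noncomputable def semicircularCoeff (a : Fin r → Matrix (Fin m) (Fin m) ℂ) :
    Fin r ⊕ Fin r → Matrix (Fin m) (Fin m) ℂ :=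
  Sum.elim (fun j => (((Real.sqrt 2 : ℝ) : ℂ))⁻¹ • (a j + star (a j)))
    (fun j => (Complex.I * (((Real.sqrt 2 : ℝ) : ℂ))⁻¹) • (a j - star (a j)))

theorem ofReal_sqrt_two_inv_mul_self :
    (((Real.sqrt 2 : ℝ) : ℂ))⁻¹ * (((Real.sqrt 2 : ℝ) : ℂ))⁻¹ = 1 / 2 := by
  rw [← mul_inv, ← Complex.ofReal_mul, Real.mul_self_sqrt (by norm_num)]; norm_num

/-- The terms `a g a` and `a* g a*` cancel between the two families, because the factor `I` of the
second one squares to `-1`. -/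
theorem sum_semicircularCoeff (a : Fin r → Matrix (Fin m) (Fin m) ℂ)
    (g : Matrix (Fin m) (Fin m) ℂ) :
    ∑ i, semicircularCoeff a i * g * semicircularCoeff a i = covMap a g := by
  rw [Fintype.sum_sum_type, ← Finset.sum_add_distrib, covMap]
  refine Finset.sum_congr rfl fun j _ => ?_
  obtain ⟨t, ht⟩ : ∃ t, t = (((Real.sqrt 2 : ℝ) : ℂ))⁻¹ := ⟨_, rfl⟩
  have htt : t * t = 1 / 2 := ht ▸ ofReal_sqrt_two_inv_mul_self
  have hII : Complex.I * t * (Complex.I * t) = -(1 / 2) := by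
    linear_combination t * t * Complex.I_mul_I - htt
  simp only [semicircularCoeff, Sum.elim_inl, Sum.elim_inr, smul_mul_assoc, mul_smul_comm,
    smul_smul, ← ht, htt, hII]
  simp only [add_mul, mul_add, sub_mul, mul_sub]
  module

variable {τ : A →ₗ[ℂ] ℂ}

theorem ofMatrix_linPencil_eq (a₀ : Matrix (Fin m) (Fin m) ℂ)
    (a : Fin r → Matrix (Fin m) (Fin m) ℂ) (y : Fin r → A) :
    CStarMatrix.ofMatrix (linPencil a₀ a y) = tensOne m A a₀ + ∑ i,
      tensOne m A (semicircularCoeff a i) * oneTens m A ((Sum.elim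
        (fun j => (((Real.sqrt 2 : ℝ) : ℂ))⁻¹ • (y j + star (y j)))
        (fun j => (Complex.I * ((Real.sqrt 2 : ℝ) : ℂ))⁻¹ • (y j - star (y j))) :
        Fin r ⊕ Fin r → A) i) := by
  rw [Fintype.sum_sum_type, ← Finset.sum_add_distrib]
  simp_rw [← ofMatrix_tens]
  change linPencil a₀ a y = tens a₀ 1 + ∑ j, (tens _ _ + tens _ _ : Matrix (Fin m) (Fin m) A)
  rw [linPencil]
  congr 1
  refine Finset.sum_congr rfl fun j _ => ?_
  obtain ⟨t, ht⟩ : ∃ t, t = (((Real.sqrt 2 : ℝ) : ℂ))⁻¹ := ⟨_, rfl⟩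
  have htt : t * t = 1 / 2 := ht ▸ ofReal_sqrt_two_inv_mul_self
  have hII : (Complex.I * t) * (Complex.I⁻¹ * t) = 1 / 2 := by
    linear_combination t * t * mul_inv_cancel₀ Complex.I_ne_zero + htt
  ext p q
  simp only [tens, semicircularCoeff, Sum.elim_inl, Sum.elim_inr, Matrix.add_apply,
    Matrix.map_apply, Matrix.smul_apply, Matrix.sub_apply, Matrix.star_apply,
    Matrix.conjTranspose_apply, mul_inv, ← ht, smul_smul, smul_eq_mul]
  rw [show t * (a j p q + star (a j q p)) * t = (t * t) * (a j p q + star (a j q p)) by ring,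
    show Complex.I * t * (a j p q - star (a j q p)) * (Complex.I⁻¹ * t) =
      ((Complex.I * t) * (Complex.I⁻¹ * t)) * (a j p q - star (a j q p)) by ring, htt, hII]
  module

/-- The expected resolvent of a circular pencil satisfies the matrix Dyson equation, provided
that the equation has small solutions at large spectral parameters. -/
theorem isDysonSol_Glim (hτ : IsState τ) {y : Fin r → A} (hy : IsCircularSystem τ y)
    {a₀ : Matrix (Fin m) (Fin m) ℂ} (ha₀ : a₀.IsHermitian)
    {a : Fin r → Matrix (Fin m) (Fin m) ℂ}
    (hex : ∀ l c, 0 < c → ImGe l c → ∃ g, IsDysonSol a₀ a l g ∧ ‖g‖ ≤ 2 * m ^ 2 * c⁻¹)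
    {l : Matrix (Fin m) (Fin m) ℂ} {c : ℝ} (hc : 0 < c) (hl : ImGe l c) :
    IsDysonSol a₀ a l (Glim τ a₀ a y l) := by
  rw [Glim, slicedResolvent_eq hτ]
  set φ := sliceExp m hτ with hφ
  have hsa := isSelfAdjoint_linPencil ha₀ a y
  obtain ⟨x, hx⟩ : ∃ x : Fin r ⊕ Fin r → A, x = Sum.elim
        (fun j => (((Real.sqrt 2 : ℝ) : ℂ))⁻¹ • (y j + star (y j)))
        (fun j => (Complex.I * ((Real.sqrt 2 : ℝ) : ℂ))⁻¹ • (y j - star (y j))) := ⟨_, rfl⟩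
  obtain ⟨S, hS⟩ : ∃ S, S = ∑ i, φ.inc (semicircularCoeff a i) * oneTens m A (x i) := ⟨_, rfl⟩
  have hs : CStarMatrix.ofMatrix (linPencil a₀ a y) = φ.inc a₀ + S := by
    rw [ofMatrix_linPencil_eq, hS, hx]; rfl
  have hsys : IsSemicircularSystem τ x := by rw [hx]; exact hy
  obtain ⟨σ, hσ⟩ : ∃ σ, σ = ∑ j, ‖a j‖ := ⟨_, rfl⟩
  have hσ0 : 0 ≤ σ := hσ ▸ Finset.sum_nonneg fun _ _ => norm_nonneg _
  -- With `‖g‖ ≤ 2m²/c`, this threshold makes `‖g‖ (1 + ‖S‖ + σ) ≤ 1/8`, enough for both smallness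
  -- conditions of `E_resolvent_eq_of_small`.
  refine φ.isDysonSol_of_large hsa (c₀ := 16 * m ^ 2 * (1 + ‖S‖ + σ)) (fun l c hc hcc hl => ?_)
    hc hl
  obtain ⟨g, hg, hgn⟩ := hex l c hc hl
  obtain ⟨hu, -⟩ := φ.resolvent_bound hc hl hsa
  have hsub : φ.inc l - CStarMatrix.ofMatrix (linPencil a₀ a y) = φ.inc (l - a₀) - S := by
    rw [hs, map_sub]; abel
  rw [hsub] at hu ⊢
  have hsmall : ‖g‖ * (1 + ‖S‖ + σ) ≤ 1 / 8 := by
    calc ‖g‖ * (1 + ‖S‖ + σ) ≤ 2 * m ^ 2 * c⁻¹ * (1 + ‖S‖ + σ) := by gcongr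
      _ = (16 * m ^ 2 * (1 + ‖S‖ + σ)) * c⁻¹ / 8 := by ring
      _ ≤ c * c⁻¹ / 8 := by gcongr
      _ = 1 / 8 := by rw [mul_inv_cancel₀ hc.ne']
  have hg0 := norm_nonneg g
  have h1 : ‖g‖ * ‖S‖ ≤ 1 / 8 :=
    (mul_le_mul_of_nonneg_left (by linarith) hg0).trans hsmall
  have h2 : ‖g‖ * σ ≤ 1 / 8 :=
    (mul_le_mul_of_nonneg_left (by linarith [norm_nonneg S]) hg0).trans hsmall
  have h3 : ‖g‖ * ‖covMap a g‖ ≤ 1 / 8 := by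
    calc ‖g‖ * ‖covMap a g‖ ≤ ‖g‖ * (2 * σ ^ 2 * ‖g‖) :=
          mul_le_mul_of_nonneg_left (hσ ▸ norm_covMap_le a g) hg0
      _ = 2 * (‖g‖ * σ) ^ 2 := by ring
      _ ≤ 2 * (1 / 8) ^ 2 := by gcongr
      _ ≤ 1 / 8 := by norm_num
  have hE : φ.E (Ring.inverse (φ.inc (l - a₀) - S)) = g := by
    rw [hS] at hu ⊢
    refine φ.E_resolvent_eq_of_small (fun i b => oneTens_mul_tensOne b (x i)) ?_
      (by rw [← hS]; linarith) (by rw [sum_semicircularCoeff]; exact h3)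
      (by rw [sum_semicircularCoeff]; exact hg) hu
    intro w hw
    rw [map_freeWord]
    exact sliceExp_E_oneTens hτ (hsys.apply_freeWord hw)
  rw [hE]
  exact hg

end Pencil

/-! ### Gaussian integration by parts in one variable -/

section Stein

variable {E : Type*} [NormedAddCommGroup E] [NormedSpace ℝ E] {v : ℝ≥0}

theorem hasDerivAt_gaussianPDFReal_zero (hv : v ≠ 0) (t : ℝ) :
    HasDerivAt (gaussianPDFReal 0 v) (-(t / v * gaussianPDFReal 0 v t)) t := by
  have hv' : (v : ℝ) ≠ 0 := by exact_mod_cast hv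
  have h : gaussianPDFReal 0 v = fun t => (Real.sqrt (2 * Real.pi * v))⁻¹ *
      Real.exp (-t ^ 2 / (2 * v)) := by
    ext t; simp [gaussianPDFReal]
  rw [h]
  have h1 : HasDerivAt (fun t : ℝ => -t ^ 2 / (2 * v)) (-(t / v)) t := by
    have := ((hasDerivAt_pow 2 t).neg).div_const (2 * (v : ℝ))
    refine this.congr_deriv ?_
    field_simp
    simp
  exact (h1.exp.const_mul _).congr_deriv (by ring)

theorem integrable_mul_gaussianPDFReal (hv : v ≠ 0) :
    Integrable fun t : ℝ => t * gaussianPDFReal 0 v t := by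
  have hv' : (0 : ℝ) < v := by positivity
  have h : (fun t : ℝ => t * gaussianPDFReal 0 v t) = fun t => (Real.sqrt (2 * Real.pi * v))⁻¹ *
      (t * Real.exp (-(1 / (2 * v)) * t ^ 2)) := by
    ext t
    simp only [gaussianPDFReal, sub_zero]
    rw [show -t ^ 2 / (2 * (v : ℝ)) = -(1 / (2 * v)) * t ^ 2 by ring]
    ring
  rw [h]
  exact (integrable_mul_exp_neg_mul_sq (by positivity)).const_mul _

/-- Gaussian integration by parts. -/
theorem integral_smul_gaussianReal_eq (hv : v ≠ 0) {f f' : ℝ → E}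
    (hf : ∀ t, HasDerivAt f (f' t) t) (hf' : Continuous f') {C : ℝ} (hC : ∀ t, ‖f t‖ ≤ C)
    (hC' : ∀ t, ‖f' t‖ ≤ C) :
    ∫ t, t • f t ∂gaussianReal 0 v = (v : ℝ) • ∫ t, f' t ∂gaussianReal 0 v := by
  have hv' : (v : ℝ) ≠ 0 := by exact_mod_cast hv
  have hfc : Continuous f := continuous_iff_continuousAt.2 fun t => (hf t).continuousAt
  have hi := integrable_gaussianPDFReal 0 v
  have hi' := integrable_mul_gaussianPDFReal hv
  have key := integral_bilinear_hasDerivAt_right_eq_neg_left_of_integrable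
    (L := ContinuousLinearMap.lsmul ℝ ℝ) (u := gaussianPDFReal 0 v)
    (u' := fun t => -(t / v * gaussianPDFReal 0 v t)) (v := f) (v' := f')
    (fun t _ => hasDerivAt_gaussianPDFReal_zero hv t) (fun t _ => hf t)
    (hi.smul_bdd C hf'.aestronglyMeasurable (.of_forall hC'))
    (by
      have h : Integrable fun t => -(t / v * gaussianPDFReal 0 v t) := by
        refine (hi'.const_mul (-(v : ℝ)⁻¹)).congr (.of_forall fun t => ?_)
        simp only; ring
      exact h.smul_bdd C hfc.aestronglyMeasurable (.of_forall hC))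
    (hi.smul_bdd C hfc.aestronglyMeasurable (.of_forall hC))
  rw [integral_gaussianReal_eq_integral_smul hv, integral_gaussianReal_eq_integral_smul hv]
  simp only [ContinuousLinearMap.lsmul_apply] at key
  rw [key, ← integral_neg, ← integral_smul]
  congr 1
  ext t
  rw [← neg_smul, smul_smul, smul_smul]
  congr 1
  field_simp

end Stein

/-! ### Product Gaussian measures: integration by parts and covariance -/

section PiGaussian

variable {ι : Type*} [Fintype ι] [DecidableEq ι] {γ : Measure ℝ} [IsProbabilityMeasure γ]

/-- Resampling one coordinate preserves a product measure. -/
theorem measurePreserving_update (i : ι) :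
    MeasurePreserving (fun p : (ι → ℝ) × ℝ => Function.update p.1 i p.2)
      ((Measure.pi fun _ => γ).prod γ) (Measure.pi fun _ => γ) := by
  have hm : Measurable fun p : (ι → ℝ) × ℝ => Function.update p.1 i p.2 := by
    rw [measurable_pi_iff]
    intro j
    by_cases h : j = i
    · subst h; simpa using measurable_snd
    · simp only [Function.update_of_ne h]; fun_prop
  refine ⟨hm, ?_⟩
  refine (Measure.pi_eq fun s hs => ?_).symm
  rw [Measure.map_apply hm (MeasurableSet.univ_pi hs)]
  have : (fun p : (ι → ℝ) × ℝ => Function.update p.1 i p.2) ⁻¹' (Set.univ.pi s) =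
      (Set.univ.pi (Function.update s i Set.univ)) ×ˢ s i := by
    ext ⟨x, t⟩
    simp only [Set.mem_preimage, Set.mem_pi, Set.mem_univ, true_implies, Set.mem_prod]
    constructor
    · intro h
      refine ⟨fun j => ?_, by simpa using h i⟩
      by_cases hj : j = i
      · subst hj; simp
      · simpa [hj] using h j
    · rintro ⟨h1, h2⟩ j
      by_cases hj : j = i
      · subst hj; simpa using h2
      · simpa [hj] using h1 j
  rw [this, Measure.prod_prod, Measure.pi_pi, ← Finset.prod_erase_mul _ _ (Finset.mem_univ i),
    ← Finset.prod_erase_mul _ (fun j => γ (s j)) (Finset.mem_univ i)]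
  simp only [Function.update_self, measure_univ, mul_one]
  congr 1
  refine Finset.prod_congr rfl fun j hj => ?_
  rw [Function.update_of_ne (Finset.ne_of_mem_erase hj)]

/-- Exchanging one coordinate between two independent copies preserves the product measure. -/
theorem measurePreserving_swap_coord (i : ι) :
    MeasurePreserving (fun p : (ι → ℝ) × (ι → ℝ) =>
      (Function.update p.1 i (p.2 i), Function.update p.2 i (p.1 i)))
      ((Measure.pi fun _ => γ).prod (Measure.pi fun _ => γ))
      ((Measure.pi fun _ => γ).prod (Measure.pi fun _ => γ)) := by
  have e := measurePreserving_arrowProdEquivProdArrow ℝ ℝ ι (fun _ => γ) (fun _ => γ)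
  have hT : MeasurePreserving (fun (x : ι → ℝ × ℝ) j => if j = i then (x j).swap else x j)
      (Measure.pi fun _ => γ.prod γ) (Measure.pi fun _ => γ.prod γ) := by
    refine measurePreserving_pi (f := fun j (y : ℝ × ℝ) => if j = i then y.swap else y) _ _
      fun j => ?_
    by_cases h : j = i
    · simpa [h] using Measure.measurePreserving_swap
    · simp only [h, if_false]; exact MeasurePreserving.id _
  have := (e.comp hT).comp e.symm
  convert this using 1
  ext p j
  · by_cases h : j = i
    · subst h; simp [MeasurableEquiv.arrowProdEquivProdArrow, Equiv.arrowProdEquivProdArrow]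
    · simp [MeasurableEquiv.arrowProdEquivProdArrow, Equiv.arrowProdEquivProdArrow, h]
  · by_cases h : j = i
    · subst h; simp [MeasurableEquiv.arrowProdEquivProdArrow, Equiv.arrowProdEquivProdArrow]
    · simp [MeasurableEquiv.arrowProdEquivProdArrow, Equiv.arrowProdEquivProdArrow, h]

variable {v : ℝ≥0}

theorem integral_sq_gaussianReal_zero : ∫ t, t ^ 2 ∂gaussianReal 0 v = v := by
  have := variance_fun_id_gaussianReal (μ := 0) (v := v)
  rw [variance_eq_integral (by fun_prop)] at this
  simpa using this

theorem integrable_sq_gaussianReal_zero : Integrable (fun t => t ^ 2) (gaussianReal 0 v) :=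
  (memLp_id_gaussianReal 2).integrable_sq

theorem integrable_id_gaussianReal_zero : Integrable (fun t => t) (gaussianReal 0 v) :=
  (memLp_id_gaussianReal 1).integrable (by simp)

variable {E : Type*} [NormedAddCommGroup E]

theorem integrable_of_continuous_of_bounded {X : Type*} [TopologicalSpace X]
    [MeasurableSpace X] [OpensMeasurableSpace X] [SecondCountableTopology X] {μ : Measure X}
    [IsFiniteMeasure μ] {F : X → E} (hF : Continuous F) {C : ℝ}
    (hC : ∀ x, ‖F x‖ ≤ C) : Integrable F μ :=
  Integrable.of_bound hF.aestronglyMeasurable C (.of_forall hC)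

variable [NormedSpace ℝ E]

omit [DecidableEq ι] in
theorem integrable_smul_pi_gaussianReal (i : ι) {F : (ι → ℝ) → E} (hF : Continuous F) {C : ℝ}
    (hC : ∀ x, ‖F x‖ ≤ C) :
    Integrable (fun x => x i • F x) (Measure.pi fun _ : ι => gaussianReal 0 v) := by
  have h1 : Integrable (fun x : ι → ℝ => x i) (Measure.pi fun _ : ι => gaussianReal 0 v) :=
    (measurePreserving_eval (fun _ : ι => gaussianReal 0 v) i).integrable_comp_of_integrable
      integrable_id_gaussianReal_zero
  exact h1.smul_bdd C hF.aestronglyMeasurable (.of_forall hC)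

/-- Gaussian integration by parts for independent Gaussian variables. -/
theorem integral_smul_pi_gaussianReal_eq (hv : v ≠ 0) (i : ι) {F F' : (ι → ℝ) → E}
    (hF : ∀ x t, HasDerivAt (fun t => F (Function.update x i t)) (F' (Function.update x i t)) t)
    (hFc : Continuous F) (hFc' : Continuous F') {C : ℝ} (hC : ∀ x, ‖F x‖ ≤ C)
    (hC' : ∀ x, ‖F' x‖ ≤ C) :
    ∫ x, x i • F x ∂(Measure.pi fun _ : ι => gaussianReal 0 v) =
      (v : ℝ) • ∫ x, F' x ∂(Measure.pi fun _ : ι => gaussianReal 0 v) := by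
  have hmp := measurePreserving_update (γ := gaussianReal 0 v) i
  have hi := integrable_smul_pi_gaussianReal (v := v) i hFc hC
  have hi' : Integrable F' (Measure.pi fun _ : ι => gaussianReal 0 v) :=
    integrable_of_continuous_of_bounded hFc' hC'
  rw [← hmp.map_eq, integral_map hmp.measurable.aemeasurable
      (by rw [hmp.map_eq]; exact hi.aestronglyMeasurable),
    integral_map hmp.measurable.aemeasurable (by rw [hmp.map_eq]; exact hi'.aestronglyMeasurable),
    integral_prod (fun p : (ι → ℝ) × ℝ => Function.update p.1 i p.2 i •
      F (Function.update p.1 i p.2)) (hmp.integrable_comp_of_integrable hi),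
    integral_prod (fun p : (ι → ℝ) × ℝ => F' (Function.update p.1 i p.2))
      (hmp.integrable_comp_of_integrable hi'), ← integral_smul]
  congr 1
  ext x
  simp only [Function.update_self]
  exact integral_smul_gaussianReal_eq hv (hF x)
    (hFc'.comp (continuous_const.update i continuous_id)) (fun t => hC _) (fun t => hC' _)

-- The integrand dominates `(p.2 i - p.1 i)²` and has no cross term to integrate.
omit [DecidableEq ι] in
theorem integral_sq_sub_le (i : ι) :
    Integrable (fun p : (ι → ℝ) × (ι → ℝ) => 2 * (p.1 i) ^ 2 + 2 * (p.2 i) ^ 2)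
      ((Measure.pi fun _ => gaussianReal 0 v).prod (Measure.pi fun _ => gaussianReal 0 v)) ∧
    ∫ p : (ι → ℝ) × (ι → ℝ), (2 * (p.1 i) ^ 2 + 2 * (p.2 i) ^ 2)
      ∂((Measure.pi fun _ => gaussianReal 0 v).prod (Measure.pi fun _ => gaussianReal 0 v))
      = 4 * (v : ℝ) := by
  have h1 := (measurePreserving_eval (fun _ : ι => gaussianReal 0 v) i).comp
    (measurePreserving_fst (μ := Measure.pi fun _ : ι => gaussianReal 0 v)
      (ν := Measure.pi fun _ : ι => gaussianReal 0 v))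
  have h2 := (measurePreserving_eval (fun _ : ι => gaussianReal 0 v) i).comp
    (measurePreserving_snd (μ := Measure.pi fun _ : ι => gaussianReal 0 v)
      (ν := Measure.pi fun _ : ι => gaussianReal 0 v))
  have i1 := h1.integrable_comp_of_integrable integrable_sq_gaussianReal_zero
  have i2 := h2.integrable_comp_of_integrable integrable_sq_gaussianReal_zero
  have e1 := integral_map (μ := (Measure.pi fun _ : ι => gaussianReal 0 v).prod
    (Measure.pi fun _ : ι => gaussianReal 0 v)) h1.measurable.aemeasurable (f := fun t : ℝ => t ^ 2)
    (by fun_prop)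
  have e2 := integral_map (μ := (Measure.pi fun _ : ι => gaussianReal 0 v).prod
    (Measure.pi fun _ : ι => gaussianReal 0 v)) h2.measurable.aemeasurable (f := fun t : ℝ => t ^ 2)
    (by fun_prop)
  rw [h1.map_eq, integral_sq_gaussianReal_zero] at e1
  rw [h2.map_eq, integral_sq_gaussianReal_zero] at e2
  refine ⟨(i1.const_mul 2).add (i2.const_mul 2), ?_⟩
  refine (integral_add (i1.const_mul 2) (i2.const_mul 2)).trans ?_
  rw [integral_const_mul, integral_const_mul]
  simp only [Function.comp_apply] at e1 e2 ⊢
  rw [← e1, ← e2]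
  ring

/-- A covariance inequality of Efron–Stein type. -/
theorem norm_integral_mul_sub_le {f g : (ι → ℝ) → ℂ} (hf : Continuous f) (hg : Continuous g)
    {C Lf Lg : ℝ} (hfC : ∀ x, ‖f x‖ ≤ C) (hgC : ∀ x, ‖g x‖ ≤ C)
    (hfL : ∀ x i t, ‖f (Function.update x i t) - f x‖ ≤ Lf * |t - x i|)
    (hgL : ∀ x i t, ‖g (Function.update x i t) - g x‖ ≤ Lg * |t - x i|)
    (hLf : 0 ≤ Lf) (hLg : 0 ≤ Lg) :
    ‖∫ x, f x * g x ∂(Measure.pi fun _ : ι => gaussianReal 0 v) -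
      (∫ x, f x ∂(Measure.pi fun _ : ι => gaussianReal 0 v)) *
        ∫ x, g x ∂(Measure.pi fun _ : ι => gaussianReal 0 v)‖ ≤
      Fintype.card ι * (2 * Lf * Lg * v) := by
  set μ := Measure.pi fun _ : ι => gaussianReal 0 v with hμ
  have hC0 : 0 ≤ C := (norm_nonneg _).trans (hfC 0)
  have hZc : ∀ S : Finset ι, Continuous fun p : (ι → ℝ) × (ι → ℝ) => S.piecewise p.2 p.1 := by
    intro S
    refine continuous_pi fun j => ?_
    by_cases h : j ∈ S
    · simp only [Finset.piecewise, h, if_true]; fun_prop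
    · simp only [Finset.piecewise, h, if_false]; fun_prop
  have hint : ∀ (h : (ι → ℝ) × (ι → ℝ) → (ι → ℝ)) (_ : Continuous h) (S : Finset ι),
      Integrable (fun p : (ι → ℝ) × (ι → ℝ) => f (h p) * g (S.piecewise p.2 p.1)) (μ.prod μ) := by
    intro h hh S
    refine integrable_of_continuous_of_bounded (C := C * C)
      ((hf.comp hh).mul (hg.comp (hZc S))) fun p => ?_
    rw [norm_mul]
    exact mul_le_mul (hfC _) (hgC _) (norm_nonneg _) hC0
  -- Interpolation between `E[f g]` and `E[f] E[g]`: the arguments of `g` are replaced by those of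
  -- an independent copy, one coordinate at a time.
  have key : ∀ S : Finset ι, ‖∫ p, f p.1 * g (Finset.piecewise ∅ p.2 p.1) ∂(μ.prod μ) -
      ∫ p, f p.1 * g (S.piecewise p.2 p.1) ∂(μ.prod μ)‖ ≤ S.card * (2 * Lf * Lg * v) := by
    intro S
    induction S using Finset.induction_on with
    | empty => simp
    | insert i S hi ih =>
      rw [Finset.card_insert_of_notMem hi]
      have hsw := measurePreserving_swap_coord (γ := gaussianReal 0 v) i
      have hup : Continuous fun p : (ι → ℝ) × (ι → ℝ) => Function.update p.1 i (p.2 i) :=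
        continuous_fst.update i ((continuous_apply i).comp continuous_snd)
      have z1 : ∀ p : (ι → ℝ) × (ι → ℝ), S.piecewise (Function.update p.2 i (p.1 i))
          (Function.update p.1 i (p.2 i)) = (insert i S).piecewise p.2 p.1 := by
        intro p; ext j
        by_cases hj : j = i
        · subst hj; simp [Finset.piecewise, hi]
        · simp [Finset.piecewise, hj]
      have z2 : ∀ p : (ι → ℝ) × (ι → ℝ), (insert i S).piecewise (Function.update p.2 i (p.1 i))
          (Function.update p.1 i (p.2 i)) = S.piecewise p.2 p.1 := by
        intro p; ext j
        by_cases hj : j = i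
        · subst hj; simp [Finset.piecewise, hi]
        · simp [Finset.piecewise, hj]
      have z3 : ∀ p : (ι → ℝ) × (ι → ℝ), (insert i S).piecewise p.2 p.1 =
          Function.update (S.piecewise p.2 p.1) i (p.2 i) := by
        intro p; rw [Finset.piecewise_insert]
      have hd : ∀ (h : (ι → ℝ) × (ι → ℝ) → (ι → ℝ)) (_ : Continuous h),
          Integrable (fun p => f (h p) * (g (S.piecewise p.2 p.1) -
            g ((insert i S).piecewise p.2 p.1))) (μ.prod μ) := by
        intro h hh
        simp_rw [mul_sub]
        exact (hint h hh S).sub (hint h hh _)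
      set I := ∫ p, f p.1 * (g (S.piecewise p.2 p.1) - g ((insert i S).piecewise p.2 p.1))
        ∂(μ.prod μ) with hI
      have hI1 : I = (∫ p, f p.1 * g (S.piecewise p.2 p.1) ∂(μ.prod μ)) -
          ∫ p, f p.1 * g ((insert i S).piecewise p.2 p.1) ∂(μ.prod μ) := by
        rw [hI, ← integral_sub (hint _ continuous_fst S) (hint _ continuous_fst _)]
        simp_rw [mul_sub]
      -- Swapping coordinate `i` between the copies preserves the measure and changes the sign of
      -- the increment of `g`. Averaging the two expressions for `I` produces an increment of `f` as
      -- well, and so the product `Lf * Lg`.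
      have hI2 : I = -∫ p, f (Function.update p.1 i (p.2 i)) * (g (S.piecewise p.2 p.1) -
          g ((insert i S).piecewise p.2 p.1)) ∂(μ.prod μ) := by
        rw [hI, ← integral_neg]
        conv_lhs => rw [← hsw.map_eq]
        rw [integral_map hsw.measurable.aemeasurable
          (by rw [hsw.map_eq]; exact (hd _ continuous_fst).aestronglyMeasurable)]
        congr 1
        ext p
        simp only [z1, z2]
        ring
      have hI3 : 2 * I = ∫ p, (f p.1 - f (Function.update p.1 i (p.2 i))) *
          (g (S.piecewise p.2 p.1) - g ((insert i S).piecewise p.2 p.1)) ∂(μ.prod μ) := by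
        simp_rw [sub_mul]
        rw [integral_sub (hd _ continuous_fst) (hd _ hup), ← hI]
        linear_combination hI2
      have hb : ‖2 * I‖ ≤ Lf * Lg * (4 * v) := by
        obtain ⟨q1, q2⟩ := integral_sq_sub_le (v := v) i
        rw [hI3, ← q2, ← integral_const_mul]
        refine norm_integral_le_of_norm_le (q1.const_mul _) (.of_forall fun p => ?_)
        have b1 := hfL p.1 i (p.2 i)
        have b2 := hgL (S.piecewise p.2 p.1) i (p.2 i)
        rw [Finset.piecewise_eq_of_notMem _ _ _ hi] at b2
        rw [norm_mul, norm_sub_rev (f p.1), norm_sub_rev (g _), z3]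
        calc _ ≤ (Lf * |p.2 i - p.1 i|) * (Lg * |p.2 i - p.1 i|) :=
              mul_le_mul b1 b2 (norm_nonneg _) (by positivity)
          _ = Lf * Lg * (p.2 i - p.1 i) ^ 2 := by rw [← sq_abs]; ring
          _ ≤ _ := by
              gcongr
              nlinarith [sq_nonneg (p.2 i + p.1 i)]
      rw [norm_mul, Complex.norm_ofNat] at hb
      have : (∫ p, f p.1 * g (Finset.piecewise ∅ p.2 p.1) ∂(μ.prod μ)) -
          ∫ p, f p.1 * g ((insert i S).piecewise p.2 p.1) ∂(μ.prod μ) =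
          ((∫ p, f p.1 * g (Finset.piecewise ∅ p.2 p.1) ∂(μ.prod μ)) -
          ∫ p, f p.1 * g (S.piecewise p.2 p.1) ∂(μ.prod μ)) + I := by rw [hI1]; ring
      rw [this]
      push_cast
      refine (norm_add_le _ _).trans ?_
      linarith
  have h := key Finset.univ
  simp only [Finset.piecewise_empty, Finset.piecewise_univ, Finset.card_univ] at h
  rw [integral_prod_mul] at h
  have h0 : ∫ p : (ι → ℝ) × (ι → ℝ), f p.1 * g p.1 ∂(μ.prod μ) = ∫ x, f x * g x ∂μ := by
    have hm := measurePreserving_fst (μ := μ) (ν := μ)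
    conv_rhs => rw [← hm.map_eq]
    exact (integral_map (f := fun x => f x * g x) hm.measurable.aemeasurable
      (hf.mul hg).aestronglyMeasurable).symm
  rwa [h0] at h

end PiGaussian

/-! ### The Schwinger–Dyson equation for Gaussian pencils -/

namespace MatExp

variable {m : ℕ} {B : Type*} [CStarAlgebra B] (φ : MatExp m B) {ι : Type*} [Fintype ι]

/-- A linear pencil with real scalar variables. -/
noncomputable def realPencil (a₀ : Matrix (Fin m) (Fin m) ℂ) (D : ι → B) (x : ι → ℝ) : B :=
  φ.inc a₀ + ∑ i, x i • D i

/-- The resolvent of a linear pencil with real scalar variables. -/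
noncomputable def realResolvent (a₀ : Matrix (Fin m) (Fin m) ℂ) (D : ι → B)
    (l : Matrix (Fin m) (Fin m) ℂ) (x : ι → ℝ) : B :=
  Ring.inverse (φ.inc l - φ.realPencil a₀ D x)

variable {a₀ l : Matrix (Fin m) (Fin m) ℂ} {D : ι → B} {c : ℝ}

theorem isSelfAdjoint_realPencil (ha₀ : a₀.IsHermitian) (hD : ∀ i, IsSelfAdjoint (D i))
    (x : ι → ℝ) : IsSelfAdjoint (φ.realPencil a₀ D x) := by
  rw [IsSelfAdjoint, realPencil, star_add, star_sum, ← map_star,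
    show star a₀ = a₀ from ha₀]
  simp only [star_smul, (hD _).star_eq, star_trivial]

theorem continuous_realPencil : Continuous (φ.realPencil a₀ D) := by
  unfold realPencil
  exact continuous_const.add (continuous_finsetSum _ fun i _ =>
    (continuous_apply i).smul continuous_const)

section

variable (ha₀ : a₀.IsHermitian) (hD : ∀ i, IsSelfAdjoint (D i)) (hc : 0 < c) (hl : ImGe l c)
include ha₀ hD hc hl

theorem norm_realResolvent_le (x : ι → ℝ) : ‖φ.realResolvent a₀ D l x‖ ≤ c⁻¹ :=
  (φ.resolvent_bound hc hl (φ.isSelfAdjoint_realPencil ha₀ hD x)).2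

theorem isUnit_sub_realPencil (x : ι → ℝ) : IsUnit (φ.inc l - φ.realPencil a₀ D x) :=
  (φ.resolvent_bound hc hl (φ.isSelfAdjoint_realPencil ha₀ hD x)).1

theorem continuous_realResolvent : Continuous (φ.realResolvent a₀ D l) := by
  refine continuous_iff_continuousAt.2 fun x => ?_
  obtain ⟨u, hu⟩ := φ.isUnit_sub_realPencil ha₀ hD hc hl x
  have h := NormedRing.inverse_continuousAt u
  rw [hu] at h
  exact ContinuousAt.comp (f := fun x => φ.inc l - φ.realPencil a₀ D x) h
    (continuous_const.sub φ.continuous_realPencil).continuousAt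

variable [DecidableEq ι]

omit ha₀ hD hc hl in
theorem realPencil_update (x : ι → ℝ) (i : ι) (t : ℝ) :
    φ.realPencil a₀ D (Function.update x i t) = φ.realPencil a₀ D x + (t - x i) • D i := by
  have : ∀ j, Function.update x i t j • D j = x j • D j + if j = i then (t - x i) • D i else 0 := by
    intro j
    by_cases h : j = i
    · subst h; simp [sub_smul]
    · simp [h]
  rw [realPencil, realPencil, Finset.sum_congr rfl fun j _ => this j, Finset.sum_add_distrib,
    Finset.sum_ite_eq' Finset.univ i]
  simp [add_assoc]

/-- An exact increment by the resolvent identity, from which the coordinatewise Lipschitz bound is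
read off without differentiating. -/
theorem realResolvent_update_sub (x : ι → ℝ) (i : ι) (t : ℝ) :
    φ.realResolvent a₀ D l (Function.update x i t) - φ.realResolvent a₀ D l x = (t - x i) •
      (φ.realResolvent a₀ D l (Function.update x i t) * D i * φ.realResolvent a₀ D l x) := by
  have e1 := Ring.inverse_mul_cancel _
    (φ.isUnit_sub_realPencil ha₀ hD hc hl (Function.update x i t))
  have e2 := Ring.mul_inverse_cancel _ (φ.isUnit_sub_realPencil ha₀ hD hc hl x)
  have h : (t - x i) • D i = (φ.inc l - φ.realPencil a₀ D x) -
      (φ.inc l - φ.realPencil a₀ D (Function.update x i t)) := by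
    rw [φ.realPencil_update]; abel
  rw [← smul_mul_assoc, ← mul_smul_comm, h, realResolvent, realResolvent, mul_sub, sub_mul, e1,
    one_mul, mul_assoc, e2, mul_one]

theorem hasDerivAt_realResolvent (x : ι → ℝ) (i : ι) (t : ℝ) :
    HasDerivAt (fun t => φ.realResolvent a₀ D l (Function.update x i t))
      (φ.realResolvent a₀ D l (Function.update x i t) * D i *
        φ.realResolvent a₀ D l (Function.update x i t)) t := by
  obtain ⟨u, hu⟩ := φ.isUnit_sub_realPencil ha₀ hD hc hl (Function.update x i t)
  have h := hasFDerivAt_ringInverse (𝕜 := ℝ) u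
  rw [hu] at h
  have h1 : HasDerivAt (fun t => φ.inc l - φ.realPencil a₀ D (Function.update x i t)) (-D i) t := by
    simp_rw [φ.realPencil_update]
    have := (((hasDerivAt_id t).sub_const (x i)).smul_const (D i)).const_add
      (φ.realPencil a₀ D x)
    simpa using this.const_sub (φ.inc l)
  have h2 := h.comp_hasDerivAt t h1
  refine h2.congr_deriv ?_
  rw [realResolvent, ← hu, Ring.inverse_unit]
  simp

theorem integral_smul_realResolvent {v : ℝ≥0} (hv : v ≠ 0) (i : ι) :
    ∫ x, x i • φ.realResolvent a₀ D l x ∂(Measure.pi fun _ : ι => gaussianReal 0 v) =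
      (v : ℝ) • ∫ x, φ.realResolvent a₀ D l x * D i * φ.realResolvent a₀ D l x
        ∂(Measure.pi fun _ : ι => gaussianReal 0 v) := by
  have hR := φ.continuous_realResolvent ha₀ hD hc hl
  have hn := φ.norm_realResolvent_le ha₀ hD hc hl
  have hc' := inv_pos.2 hc
  refine integral_smul_pi_gaussianReal_eq hv i
    (φ.hasDerivAt_realResolvent ha₀ hD hc hl · i) hR ((hR.mul continuous_const).mul hR)
    (C := c⁻¹ + c⁻¹ * ‖D i‖ * c⁻¹) (fun x => (hn x).trans ?_) (fun x => ?_)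
  · exact le_add_of_nonneg_right (by positivity)
  · refine le_trans ?_ (le_add_of_nonneg_left hc'.le)
    calc _ ≤ ‖φ.realResolvent a₀ D l x‖ * ‖D i‖ * ‖φ.realResolvent a₀ D l x‖ :=
          (norm_mul_le _ _).trans (by gcongr; exact norm_mul_le _ _)
      _ ≤ _ := by gcongr <;> exact hn x

/-- The Schwinger–Dyson equation for a Gaussian pencil. -/
theorem schwinger_dyson_realResolvent {v : ℝ≥0} (hv : v ≠ 0) :
    (l - a₀) * ∫ x, φ.E (φ.realResolvent a₀ D l x) ∂(Measure.pi fun _ : ι => gaussianReal 0 v) - 1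
      = ∫ x, φ.E ((∑ i, (v : ℝ) • (D i * φ.realResolvent a₀ D l x * D i)) *
        φ.realResolvent a₀ D l x) ∂(Measure.pi fun _ : ι => gaussianReal 0 v) := by
  set μ := Measure.pi fun _ : ι => gaussianReal 0 v with hμ
  have hR := φ.continuous_realResolvent ha₀ hD hc hl
  have hn := φ.norm_realResolvent_le ha₀ hD hc hl
  have hc' := inv_pos.2 hc
  have iR : Integrable (φ.realResolvent a₀ D l) μ := integrable_of_continuous_of_bounded hR hn
  have iRD : ∀ i, Integrable
      (fun x => φ.realResolvent a₀ D l x * D i * φ.realResolvent a₀ D l x) μ := fun i =>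
    integrable_of_continuous_of_bounded ((hR.mul continuous_const).mul hR)
      (C := c⁻¹ * ‖D i‖ * c⁻¹) fun x =>
      (norm_mul_le _ _).trans (by
        gcongr
        · exact (norm_mul_le _ _).trans (by gcongr; exact hn x)
        · exact hn x)
  have ivRD : ∀ i, Integrable (fun x => (v : ℝ) •
      (φ.realResolvent a₀ D l x * D i * φ.realResolvent a₀ D l x)) μ := fun i => (iRD i).smul _
  have ixR : ∀ i, Integrable (fun x => x i • φ.realResolvent a₀ D l x) μ := fun i =>
    integrable_smul_pi_gaussianReal i hR hn
  -- The identity `(l - pencil) R = 1` with the Gaussian part moved to the right. Integration by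
  -- parts then replaces each `x i • R` by `v • R D i R`.
  have hpt : ∀ x, φ.inc (l - a₀) * φ.realResolvent a₀ D l x =
      1 + ∑ i, D i * (x i • φ.realResolvent a₀ D l x) := by
    intro x
    have e := Ring.mul_inverse_cancel _ (φ.isUnit_sub_realPencil ha₀ hD hc hl x)
    have e2 : φ.inc (l - a₀) = (φ.inc l - φ.realPencil a₀ D x) + ∑ i, x i • D i := by
      rw [realPencil, map_sub]; abel
    rw [e2, add_mul]
    refine congrArg₂ (· + ·) e ?_
    rw [Finset.sum_mul]
    exact Finset.sum_congr rfl fun i _ => by rw [mul_smul_comm, smul_mul_assoc]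
  have h1 : φ.inc (l - a₀) * ∫ x, φ.realResolvent a₀ D l x ∂μ =
      1 + ∑ i, D i * ((v : ℝ) • ∫ x, φ.realResolvent a₀ D l x * D i * φ.realResolvent a₀ D l x ∂μ)
      := by
    rw [← integral_const_mul_of_integrable iR]
    simp_rw [hpt]
    rw [integral_add (integrable_const _) (integrable_finsetSum _ fun i _ => (ixR i).const_mul _),
      integral_finsetSum _ fun i _ => (ixR i).const_mul _]
    simp only [integral_const, probReal_univ, one_smul]
    congr 1
    refine Finset.sum_congr rfl fun i _ => ?_
    rw [integral_const_mul_of_integrable (ixR i), ← φ.integral_smul_realResolvent ha₀ hD hc hl hv i]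
  have h2 : ∑ i, D i * ((v : ℝ) • ∫ x, φ.realResolvent a₀ D l x * D i * φ.realResolvent a₀ D l x ∂μ)
      = ∫ x, (∑ i, (v : ℝ) • (D i * φ.realResolvent a₀ D l x * D i)) *
        φ.realResolvent a₀ D l x ∂μ := by
    simp_rw [Finset.sum_mul, smul_mul_assoc]
    have : ∀ i x, (v : ℝ) • (D i * φ.realResolvent a₀ D l x * D i * φ.realResolvent a₀ D l x) =
        D i * ((v : ℝ) • (φ.realResolvent a₀ D l x * D i * φ.realResolvent a₀ D l x)) := by
      intro i x; rw [mul_smul_comm]; simp only [mul_assoc]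
    simp_rw [this]
    rw [integral_finsetSum _ fun i _ => (ivRD i).const_mul _]
    refine Finset.sum_congr rfl fun i _ => ?_
    rw [integral_const_mul_of_integrable (ivRD i), integral_smul]
  have iS : Integrable (fun x => (∑ i, (v : ℝ) • (D i * φ.realResolvent a₀ D l x * D i)) *
        φ.realResolvent a₀ D l x) μ := by
    have : ∀ i x, (v : ℝ) • (D i * φ.realResolvent a₀ D l x * D i) * φ.realResolvent a₀ D l x =
        D i * ((v : ℝ) • (φ.realResolvent a₀ D l x * D i * φ.realResolvent a₀ D l x)) := by
      intro i x; rw [mul_smul_comm, smul_mul_assoc]; simp only [mul_assoc]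
    simp_rw [Finset.sum_mul, this]
    exact integrable_finsetSum _ fun i _ => (ivRD i).const_mul _
  have h3 := φ.EL.integral_comp_comm iR
  have h4 := φ.EL.integral_comp_comm iS
  simp only [EL_apply] at h3 h4
  rw [h3, h4, ← φ.inc_mul, h1, h2, map_add, φ.E_one]
  abel

end

end MatExp

/-! ### Decoupling the quadratic term -/

section Covariance

variable {m r : ℕ} {ι : Type*} [Fintype ι] [DecidableEq ι] {v : ℝ≥0}

/-- Expanded in matrix units, `η(H) H` is bilinear in the entries of `H`, so the difference is a
combination of `m⁴` scalar covariances. -/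
theorem norm_integral_covMap_mul_sub_le (a : Fin r → Matrix (Fin m) (Fin m) ℂ)
    {H : (ι → ℝ) → Matrix (Fin m) (Fin m) ℂ} (hH : Continuous H) {C L : ℝ}
    (hHC : ∀ x, ‖H x‖ ≤ C) (hL : 0 ≤ L)
    (hHL : ∀ x i t p q, ‖H (Function.update x i t) p q - H x p q‖ ≤ L * |t - x i|) :
    ‖(∫ x, covMap a (H x) * H x ∂(Measure.pi fun _ : ι => gaussianReal 0 v)) -
      covMap a (∫ x, H x ∂(Measure.pi fun _ : ι => gaussianReal 0 v)) *
        ∫ x, H x ∂(Measure.pi fun _ : ι => gaussianReal 0 v)‖ ≤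
      m ^ 4 * (Fintype.card ι * (2 * L * L * v) * (2 * (∑ j, ‖a j‖) ^ 2)) := by
  set μ := Measure.pi fun _ : ι => gaussianReal 0 v with hμ
  let e : Fin m × Fin m → Matrix (Fin m) (Fin m) ℂ := fun s => Matrix.single s.1 s.2 1
  have hexp : ∀ z : Matrix (Fin m) (Fin m) ℂ, z = ∑ s : Fin m × Fin m, z s.1 s.2 • e s := by
    intro z
    conv_lhs => rw [Matrix.matrix_eq_sum_single z]
    rw [Fintype.sum_prod_type]
    simp [e, Matrix.smul_single]
  let covL : Matrix (Fin m) (Fin m) ℂ →ₗ[ℂ] Matrix (Fin m) (Fin m) ℂ :=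
    { toFun := covMap a
      map_add' := fun x y => by
        have := covMap_sub a (x + y) y
        rw [add_sub_cancel_right] at this
        rw [this]; abel
      map_smul' := fun z x => covMap_smul a z x }
  have hbil : ∀ z : Matrix (Fin m) (Fin m) ℂ, covMap a z * z =
      ∑ s : Fin m × Fin m, ∑ u : Fin m × Fin m,
        (z s.1 s.2 * z u.1 u.2) • (covMap a (e s) * e u) := by
    intro z
    have h1 : covMap a z = ∑ s : Fin m × Fin m, z s.1 s.2 • covMap a (e s) := by
      change covL z = ∑ s : Fin m × Fin m, z s.1 s.2 • covL (e s)
      conv_lhs => rw [hexp z]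
      rw [map_sum]
      simp only [map_smul]
    nth_rewrite 2 [hexp z]
    rw [h1, Finset.sum_mul_sum]
    refine Finset.sum_congr rfl fun s _ => Finset.sum_congr rfl fun u _ => ?_
    rw [smul_mul_smul_comm]
  let ent : ∀ _ : Fin m × Fin m, Matrix (Fin m) (Fin m) ℂ →L[ℂ] ℂ := fun s =>
    (Matrix.entryLinearMap ℂ ℂ s.1 s.2).toContinuousLinearMap
  have hent : ∀ s z, ent s z = z s.1 s.2 := fun s z => rfl
  have hf : ∀ s : Fin m × Fin m, Continuous fun x => H x s.1 s.2 := fun s =>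
    (ent s).continuous.comp hH
  have hfC : ∀ (s : Fin m × Fin m) x, ‖H x s.1 s.2‖ ≤ C := fun s x =>
    (norm_entry_le _ _ _).trans (hHC x)
  have hint : ∀ s : Fin m × Fin m, (∫ x, H x ∂μ) s.1 s.2 = ∫ x, H x s.1 s.2 ∂μ := fun s =>
    ((ent s).integral_comp_comm (integrable_of_continuous_of_bounded hH hHC)).symm
  have hff : ∀ s u : Fin m × Fin m, Integrable (fun x => H x s.1 s.2 * H x u.1 u.2) μ :=
    fun s u => integrable_of_continuous_of_bounded ((hf s).mul (hf u)) (C := C * C) fun x => by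
      rw [norm_mul]
      have := (norm_nonneg (H x)).trans (hHC x)
      gcongr <;> exact hfC _ _
  have h2 : ∫ x, covMap a (H x) * H x ∂μ = ∑ s : Fin m × Fin m, ∑ u : Fin m × Fin m,
      (∫ x, H x s.1 s.2 * H x u.1 u.2 ∂μ) • (covMap a (e s) * e u) := by
    simp_rw [hbil (H _)]
    rw [integral_finsetSum _ fun s _ => integrable_finsetSum _ fun u _ => (hff s u).smul_const _]
    refine Finset.sum_congr rfl fun s _ => ?_
    rw [integral_finsetSum _ fun u _ => (hff s u).smul_const _]
    exact Finset.sum_congr rfl fun u _ => integral_smul_const _ _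
  rw [h2, hbil (∫ x, H x ∂μ), ← Finset.sum_sub_distrib]
  simp_rw [← Finset.sum_sub_distrib, ← sub_smul, hint]
  refine (norm_sum_le_of_le _ fun s _ => norm_sum_le_of_le _ fun u _ => ?_).trans_eq
    (b := ∑ _s : Fin m × Fin m, ∑ _u : Fin m × Fin m,
      (Fintype.card ι * (2 * L * L * v) * (2 * (∑ j, ‖a j‖) ^ 2))) (by simp; ring)
  rw [norm_smul]
  gcongr
  · exact norm_integral_mul_sub_le (hf s) (hf u) (hfC s) (hfC u) (fun x i t => hHL x i t _ _)
      (fun x i t => hHL x i t _ _) hL hL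
  · calc _ ≤ 2 * (∑ j, ‖a j‖) ^ 2 * ‖e s‖ * ‖e u‖ :=
        (norm_mul_le _ _).trans (by gcongr; exact norm_covMap_le a _)
      _ ≤ 2 * (∑ j, ‖a j‖) ^ 2 * 1 * 1 := by gcongr <;> exact norm_single_one_le _ _
      _ = _ := by ring

end Covariance

open scoped MatrixOrder in
theorem isState_normTr {n : ℕ} (hn : 0 < n) : IsState (normTr n) where
  map_one := by
    have : (n : ℂ) ≠ 0 := by exact_mod_cast hn.ne'
    simp [normTr, this]
  nonneg x := by
    have h := (Matrix.posSemidef_conjTranspose_mul_self x).trace_nonneg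
    rw [normTr, LinearMap.smul_apply, smul_eq_mul]
    exact mul_nonneg (by simp) h

/-! ### Normalized trace, transposition and matrix units -/

section Transpose

variable {n : ℕ}

/-- Transposition is a star homomorphism into the opposite algebra, hence contractive. -/
theorem norm_transpose_le (x : Matrix (Fin n) (Fin n) ℂ) : ‖x.transpose‖ ≤ ‖x‖ := by
  let f : Matrix (Fin n) (Fin n) ℂ →⋆ₐ[ℂ] (Matrix (Fin n) (Fin n) ℂ)ᵐᵒᵖ :=
    { (Matrix.transposeAlgEquiv (Fin n) ℂ ℂ : _ →ₐ[ℂ] _) with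
      map_star' := fun x => by
        change MulOpposite.op (x.conjTranspose.transpose) = star (MulOpposite.op x.transpose)
        rw [← MulOpposite.op_star]
        rfl }
  exact NonUnitalStarAlgHom.norm_apply_le f x

theorem sum_single_mul_mul_single (x : Matrix (Fin n) (Fin n) ℂ) :
    ∑ k, ∑ l, Matrix.single k l (1 : ℂ) * x * Matrix.single k l 1 = x.transpose := by
  conv_rhs => rw [Matrix.matrix_eq_sum_single x.transpose]
  refine Finset.sum_congr rfl fun k _ => Finset.sum_congr rfl fun l _ => ?_
  rw [Matrix.single_mul_mul_single]
  simp

theorem sum_single_mul_mul_single_swap (hn : 0 < n) (x : Matrix (Fin n) (Fin n) ℂ) :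
    ∑ k, ∑ l, Matrix.single k l (1 : ℂ) * x * Matrix.single l k 1 =
      ((n : ℂ) * normTr n x) • (1 : Matrix (Fin n) (Fin n) ℂ) := by
  have : (n : ℂ) ≠ 0 := by exact_mod_cast hn.ne'
  have h : (n : ℂ) * normTr n x = ∑ l, x l l := by
    rw [normTr, LinearMap.smul_apply, smul_eq_mul, mul_inv_cancel_left₀ this]
    rfl
  rw [h, Matrix.smul_one_eq_diagonal, ← Matrix.sum_single_eq_diagonal]
  refine Finset.sum_congr rfl fun k _ => ?_
  simp_rw [Matrix.single_mul_mul_single]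
  ext p q
  simp [Matrix.sum_apply, Matrix.single_apply]

/-- The matrix unit has rank one, so the unnormalized trace is a single entry of `y * x` and the
whole factor `1/n` is gained. -/
theorem norm_normTr_mul_single_mul_le (x y : Matrix (Fin n) (Fin n) ℂ) (k l : Fin n) :
    ‖normTr n (x * Matrix.single k l 1 * y)‖ ≤ (n : ℝ)⁻¹ * (‖x‖ * ‖y‖) := by
  have h : Matrix.trace (x * Matrix.single k l 1 * y) = (y * x) l k := by
    rw [mul_assoc, Matrix.trace_mul_comm, mul_assoc, Matrix.trace_single_mul]
    simp
  rw [normTr, LinearMap.smul_apply, Matrix.traceLinearMap_apply, h, norm_smul, norm_inv,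
    Complex.norm_natCast]
  gcongr
  rw [mul_comm ‖x‖]
  exact (norm_entry_le _ _ _).trans (norm_mul_le _ _)

end Transpose

/-! ### The real Gaussian pencil in terms of matrix entries -/

section GaussianPencil

open scoped MatrixOrder

variable {m r n : ℕ}

theorem CStarMatrix.finset_sum_apply {A κ : Type*} [AddCommMonoid A] (s : Finset κ)
    (f : κ → CStarMatrix (Fin m) (Fin m) A) (p q : Fin m) :
    (∑ i ∈ s, f i) p q = ∑ i ∈ s, f i p q :=
  Matrix.sum_apply p q s f

/-- The entrywise transpose of a block matrix. -/
def blockTranspose (z : CStarMatrix (Fin m) (Fin m) (Matrix (Fin n) (Fin n) ℂ)) :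
    CStarMatrix (Fin m) (Fin m) (Matrix (Fin n) (Fin n) ℂ) :=
  CStarMatrix.ofMatrix fun p q => (z p q).transpose

/-- The coefficients of a linear pencil with respect to the entries of the real matrices. -/
noncomputable def entryCoeff (n : ℕ) (a : Fin r → Matrix (Fin m) (Fin m) ℂ)
    (i : Fin r × Fin n × Fin n) : CStarMatrix (Fin m) (Fin m) (Matrix (Fin n) (Fin n) ℂ) :=
  tensOne m _ (a i.1) * oneTens m _ (Matrix.single i.2.1 i.2.2 1) +
    tensOne m _ (star (a i.1)) * oneTens m _ (Matrix.single i.2.2 i.2.1 1)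

theorem oneTens_mul_mul_oneTens_apply (x y : Matrix (Fin n) (Fin n) ℂ)
    (z : CStarMatrix (Fin m) (Fin m) (Matrix (Fin n) (Fin n) ℂ)) (p q : Fin m) :
    (oneTens m _ x * z * oneTens m _ y) p q = x * z p q * y := by
  simp [CStarMatrix.mul_apply, oneTens_apply]

theorem star_oneTens (x : Matrix (Fin n) (Fin n) ℂ) :
    star (oneTens m _ x) = oneTens m _ (star x) := by
  ext1 p q
  rw [CStarMatrix.star_apply, oneTens_apply, oneTens_apply]
  split_ifs with h1 h2 h2
  · rfl
  · exact absurd h1.symm h2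
  · exact absurd h2.symm h1
  · exact star_zero _

theorem isSelfAdjoint_entryCoeff (a : Fin r → Matrix (Fin m) (Fin m) ℂ)
    (i : Fin r × Fin n × Fin n) : IsSelfAdjoint (entryCoeff n a i) := by
  rw [IsSelfAdjoint, entryCoeff, star_add, star_mul, star_mul, star_oneTens, star_oneTens,
    ← map_star, ← map_star, star_star, oneTens_mul_tensOne, oneTens_mul_tensOne, add_comm]
  simp [Matrix.star_eq_conjTranspose]

theorem ofMatrix_linPencil_eq_sum_entryCoeff (a₀ : Matrix (Fin m) (Fin m) ℂ)
    (a : Fin r → Matrix (Fin m) (Fin m) ℂ) (Y : Fin r → Matrix (Fin n) (Fin n) ℝ) :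
    CStarMatrix.ofMatrix (linPencil a₀ a fun j => (Y j).map ((↑) : ℝ → ℂ)) =
      tensOne m _ a₀ + ∑ i : Fin r × Fin n × Fin n,
        ((Y i.1 i.2.1 i.2.2 : ℝ) : ℂ) • entryCoeff n a i := by
  have key : ∀ j, ∑ k, ∑ l, ((Y j k l : ℝ) : ℂ) • entryCoeff n a (j, k, l) =
      CStarMatrix.ofMatrix (tens (a j) ((Y j).map ((↑) : ℝ → ℂ)) +
        tens (a j).conjTranspose (star ((Y j).map ((↑) : ℝ → ℂ)))) := by
    intro j
    have h1 : ∀ (b : Matrix (Fin m) (Fin m) ℂ) (x : Fin n → Fin n → Matrix (Fin n) (Fin n) ℂ),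
        ∑ k, ∑ l, ((Y j k l : ℝ) : ℂ) • (tensOne m _ b * oneTens m _ (x k l)) =
          CStarMatrix.ofMatrix (tens b (∑ k, ∑ l, ((Y j k l : ℝ) : ℂ) • x k l)) := by
      intro b x
      ext1 p q
      simp_rw [← ofMatrix_tens, CStarMatrix.finset_sum_apply]
      change ∑ k, ∑ l, ((Y j k l : ℝ) : ℂ) • (b p q • x k l) =
        b p q • ∑ k, ∑ l, ((Y j k l : ℝ) : ℂ) • x k l
      simp_rw [Finset.smul_sum, smul_comm (b p q)]
    simp_rw [entryCoeff, smul_add, Finset.sum_add_distrib, h1]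
    have h2 : ∑ k, ∑ l, ((Y j k l : ℝ) : ℂ) • Matrix.single k l (1 : ℂ) =
        (Y j).map ((↑) : ℝ → ℂ) := by
      conv_rhs => rw [Matrix.matrix_eq_sum_single ((Y j).map _)]
      simp [Matrix.smul_single]
    have h3 : ∑ k, ∑ l, ((Y j k l : ℝ) : ℂ) • Matrix.single l k (1 : ℂ) =
        star ((Y j).map ((↑) : ℝ → ℂ)) := by
      conv_rhs => rw [Matrix.matrix_eq_sum_single (star _), Finset.sum_comm]
      simp [Matrix.smul_single, Matrix.star_apply]
    rw [h2, h3]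
    rfl
  simp_rw [Fintype.sum_prod_type, key]
  rw [linPencil]
  ext1 p q
  rw [CStarMatrix.add_apply, CStarMatrix.finset_sum_apply]
  rw [CStarMatrix.ofMatrix_apply, Matrix.add_apply, Matrix.sum_apply]
  rfl

theorem sum_oneTens_mul_mul_oneTens (z : CStarMatrix (Fin m) (Fin m) (Matrix (Fin n) (Fin n) ℂ)) :
    ∑ k, ∑ l, oneTens m _ (Matrix.single k l 1) * z * oneTens m _ (Matrix.single k l 1) =
      blockTranspose z := by
  ext1 p q
  change _ = (z p q).transpose
  rw [← sum_single_mul_mul_single]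
  simp_rw [← oneTens_mul_mul_oneTens_apply, CStarMatrix.finset_sum_apply]

theorem sum_oneTens_mul_mul_oneTens_swap (hn : 0 < n)
    (z : CStarMatrix (Fin m) (Fin m) (Matrix (Fin n) (Fin n) ℂ)) :
    ∑ k, ∑ l, oneTens m _ (Matrix.single k l 1) * z * oneTens m _ (Matrix.single l k 1) =
      (n : ℂ) • tensOne m _ ((sliceExp m (isState_normTr hn)).E z) := by
  ext1 p q
  change _ = (n : ℂ) • (normTr n (z p q) • (1 : Matrix (Fin n) (Fin n) ℂ))
  rw [smul_smul, ← sum_single_mul_mul_single_swap hn]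
  simp_rw [← oneTens_mul_mul_oneTens_apply, CStarMatrix.finset_sum_apply]

/-- Transposing the inner blocks alone need not be contractive. Estimating block by block costs
powers of `m` only, so the bound is uniform in `n`. -/
theorem norm_E_blockTranspose_mul_le (hn : 0 < n)
    (z w : CStarMatrix (Fin m) (Fin m) (Matrix (Fin n) (Fin n) ℂ)) :
    ‖(sliceExp m (isState_normTr hn)).E (blockTranspose z * w)‖ ≤ 2 * m ^ 3 * (‖z‖ * ‖w‖) := by
  refine (norm_le_of_entries_le (c := m * (2 * (‖z‖ * ‖w‖))) _ fun p q => ?_).trans_eq (by ring)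
  change ‖normTr n ((blockTranspose z * w) p q)‖ ≤ _
  rw [CStarMatrix.mul_apply, map_sum]
  refine (norm_sum_le_of_le _ fun s _ => ?_).trans_eq
    (b := ∑ _s : Fin m, 2 * (‖z‖ * ‖w‖)) (by simp)
  refine ((isState_normTr hn).norm_apply_le _).trans ?_
  gcongr
  refine (norm_mul_le _ _).trans ?_
  gcongr
  · exact (norm_transpose_le (z p s)).trans CStarMatrix.norm_entry_le_norm
  · exact CStarMatrix.norm_entry_le_norm

/-- The factor `1/n` drives the covariance estimate: `r n²` coordinates of variance `1/n`, with
Lipschitz constants of order `1/n`, contribute `O(1/n)` in total. -/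
theorem norm_E_mul_entryCoeff_mul_apply_le (hn : 0 < n) (a : Fin r → Matrix (Fin m) (Fin m) ℂ)
    (i : Fin r × Fin n × Fin n)
    (z w : CStarMatrix (Fin m) (Fin m) (Matrix (Fin n) (Fin n) ℂ)) (p q : Fin m) :
    ‖(sliceExp m (isState_normTr hn)).E (z * entryCoeff n a i * w) p q‖ ≤
      2 * m * ‖a i.1‖ * (n : ℝ)⁻¹ * (‖z‖ * ‖w‖) := by
  have key : ∀ (b : Matrix (Fin m) (Fin m) ℂ) (k l : Fin n),
      ‖(sliceExp m (isState_normTr hn)).E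
        (z * (tensOne m _ b * oneTens m _ (Matrix.single k l 1)) * w) p q‖ ≤
      m * ‖b‖ * (n : ℝ)⁻¹ * (‖z‖ * ‖w‖) := by
    intro b k l
    rw [← mul_assoc z]
    set x := z * tensOne m _ b with hx
    have hxn : ‖x‖ ≤ ‖z‖ * ‖b‖ := (norm_mul_le _ _).trans (by
      gcongr; exact (sliceExp m (isState_normTr hn)).norm_inc_le b)
    change ‖normTr n ((x * oneTens m _ (Matrix.single k l (1 : ℂ)) * w) p q)‖ ≤ _
    have : (x * oneTens m _ (Matrix.single k l (1 : ℂ)) * w) p q =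
        ∑ s, x p s * Matrix.single k l 1 * w s q := by
      simp [CStarMatrix.mul_apply, oneTens_apply]
    rw [this, map_sum]
    refine (norm_sum_le_of_le _ fun s _ =>
      (norm_normTr_mul_single_mul_le (x p s) (w s q) k l).trans ?_).trans_eq
      (b := ∑ _s : Fin m, (n : ℝ)⁻¹ * (‖z‖ * ‖b‖ * ‖w‖)) (by simp; ring)
    gcongr
    · exact CStarMatrix.norm_entry_le_norm.trans hxn
    · exact CStarMatrix.norm_entry_le_norm
  rw [entryCoeff, mul_add, add_mul, map_add, Matrix.add_apply]
  refine (norm_add_le _ _).trans ?_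
  have h1 := key (a i.1) i.2.1 i.2.2
  have h2 := key (star (a i.1)) i.2.2 i.2.1
  rw [norm_star] at h2
  linarith

/-- Products of `e_kl` with `e_lk` sum to `n` times a slice and yield the covariance map; products
of `e_kl` with itself yield a transpose without the factor `n`, and become the `1/n` error after
normalization. -/
theorem sum_entryCoeff_mul_mul (hn : 0 < n) (a : Fin r → Matrix (Fin m) (Fin m) ℂ)
    (z : CStarMatrix (Fin m) (Fin m) (Matrix (Fin n) (Fin n) ℂ)) (j : Fin r) :
    ∑ k, ∑ l, entryCoeff n a (j, k, l) * z * entryCoeff n a (j, k, l) =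
      tensOne m _ (a j) * blockTranspose z * tensOne m _ (a j) +
      tensOne m _ (star (a j)) * blockTranspose z * tensOne m _ (star (a j)) +
      (n : ℂ) • tensOne m _ (a j * (sliceExp m (isState_normTr hn)).E z * star (a j) +
        star (a j) * (sliceExp m (isState_normTr hn)).E z * a j) := by
  have key : ∀ (b d : Matrix (Fin m) (Fin m) ℂ) (x y : Matrix (Fin n) (Fin n) ℂ),
      tensOne m _ b * oneTens m _ x * z * (tensOne m _ d * oneTens m _ y) =
      tensOne m _ b * (oneTens m _ x * z * oneTens m _ y) * tensOne m _ d := by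
    intro b d x y
    rw [← oneTens_mul_tensOne d]
    simp only [mul_assoc]
  simp_rw [entryCoeff, add_mul, mul_add, key, Finset.sum_add_distrib, ← Finset.sum_mul,
    ← Finset.mul_sum]
  rw [sum_oneTens_mul_mul_oneTens, sum_oneTens_mul_mul_oneTens_swap hn, Finset.sum_comm,
    sum_oneTens_mul_mul_oneTens_swap hn]
  have h : ∑ k, ∑ l, oneTens m _ (Matrix.single l k 1) * z * oneTens m _ (Matrix.single l k 1) =
      blockTranspose z := by
    rw [Finset.sum_comm, sum_oneTens_mul_mul_oneTens]
  rw [h, map_add, map_mul, map_mul, map_mul, map_mul, smul_add, mul_smul_comm, smul_mul_assoc,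
    mul_smul_comm, smul_mul_assoc]
  abel

theorem norm_E_sum_entryCoeff_mul_sub_le (hn : 0 < n) (a : Fin r → Matrix (Fin m) (Fin m) ℂ)
    (z : CStarMatrix (Fin m) (Fin m) (Matrix (Fin n) (Fin n) ℂ)) :
    ‖(sliceExp m (isState_normTr hn)).E
        ((∑ i, (n : ℂ)⁻¹ • (entryCoeff n a i * z * entryCoeff n a i)) * z) -
      covMap a ((sliceExp m (isState_normTr hn)).E z) * (sliceExp m (isState_normTr hn)).E z‖ ≤
      4 * m ^ 3 * (∑ j, ‖a j‖) ^ 2 * (n : ℝ)⁻¹ * ‖z‖ ^ 2 := by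
  set φ := sliceExp m (isState_normTr hn) with hφ
  have hn0 : (n : ℂ) ≠ 0 := by exact_mod_cast hn.ne'
  have h1 : ∑ i, (n : ℂ)⁻¹ • (entryCoeff n a i * z * entryCoeff n a i) =
      (n : ℂ)⁻¹ • ∑ j, (tensOne m _ (a j) * blockTranspose z * tensOne m _ (a j) +
        tensOne m _ (star (a j)) * blockTranspose z * tensOne m _ (star (a j))) +
      φ.inc (covMap a (φ.E z)) := by
    rw [← Finset.smul_sum, Fintype.sum_prod_type]
    simp_rw [Fintype.sum_prod_type, sum_entryCoeff_mul_mul hn a z]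
    rw [Finset.sum_add_distrib, ← Finset.smul_sum, ← map_sum, smul_add, inv_smul_smul₀ hn0]
    rfl
  have h2 : ∀ b, ‖φ.E (tensOne m _ b * blockTranspose z * tensOne m _ b * z)‖ ≤
      2 * m ^ 3 * ‖z‖ ^ 2 * ‖b‖ ^ 2 := by
    intro b
    have hb : ‖tensOne m (Matrix (Fin n) (Fin n) ℂ) b‖ ≤ ‖b‖ := φ.norm_inc_le b
    change ‖φ.E (φ.inc b * _ * _ * _)‖ ≤ _
    rw [mul_assoc, mul_assoc, φ.inc_mul]
    calc _ ≤ ‖b‖ * (2 * m ^ 3 * (‖z‖ * (‖b‖ * ‖z‖))) := by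
          refine (norm_mul_le _ _).trans ?_
          gcongr
          refine (norm_E_blockTranspose_mul_le hn _ _).trans ?_
          gcongr
          exact (norm_mul_le _ _).trans (by gcongr)
      _ = _ := by ring
  rw [h1, add_mul, map_add, φ.inc_mul, add_sub_cancel_right, smul_mul_assoc, map_smul, norm_smul,
    norm_inv, Complex.norm_natCast, Finset.sum_mul, map_sum]
  calc _ ≤ (n : ℝ)⁻¹ * ∑ j, 4 * m ^ 3 * ‖z‖ ^ 2 * ‖a j‖ ^ 2 := by
        gcongr
        refine norm_sum_le_of_le _ fun j _ => ?_
        rw [add_mul, map_add]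
        refine (norm_add_le _ _).trans ?_
        have e1 := h2 (a j)
        have e2 := h2 (star (a j))
        rw [norm_star] at e2
        linarith
    _ ≤ (n : ℝ)⁻¹ * (4 * m ^ 3 * ‖z‖ ^ 2 * (∑ j, ‖a j‖) ^ 2) := by
        rw [← Finset.mul_sum]
        gcongr
        exact Finset.sum_sq_le_sq_sum_of_nonneg fun _ _ => norm_nonneg _
    _ = _ := by ring

end GaussianPencil

theorem posDef_neg_matIm_integral {α : Type*} [MeasurableSpace α] {μ : Measure α} [NeZero μ]
    {m : ℕ} {H : α → Matrix (Fin m) (Fin m) ℂ} (hi : Integrable H μ)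
    (hH : ∀ x, (-matIm (H x)).PosDef) : (-matIm (∫ x, H x ∂μ)).PosDef := by
  rw [Matrix.posDef_iff_dotProduct_mulVec]
  have hsa : (-matIm (∫ x, H x ∂μ)).IsHermitian := (isSelfAdjoint_matIm _).neg
  refine ⟨hsa, fun v hv => ?_⟩
  let q : Matrix (Fin m) (Fin m) ℂ →ₗ[ℝ] ℝ :=
    { toFun := fun z => reForm (-matIm z) v v
      map_add' := fun x y => by rw [matIm_add, neg_add, reForm_add]
      map_smul' := fun t x => by
        have h : matIm (t • x) = t • matIm x := by
          rw [matIm, matIm, Matrix.conjTranspose_smul, star_trivial, ← smul_sub, smul_comm]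
        rw [h, ← smul_neg, reForm, Matrix.smul_mulVec, dotProduct_smul, Complex.smul_re]
        rfl }
  have hpos : ∀ z : Matrix (Fin m) (Fin m) ℂ, z.PosDef → 0 < reForm z v v := fun z hz =>
    (Complex.pos_iff.1 (hz.dotProduct_mulVec_pos hv)).1
  have h := (LinearMap.toContinuousLinearMap q).integral_comp_comm hi
  have h2 : 0 < ∫ x, q (H x) ∂μ := by
    refine (integral_pos_iff_support_of_nonneg (f := fun x => q (H x))
      (fun x => (hpos _ (hH x)).le)
      ((LinearMap.toContinuousLinearMap q).integrable_comp hi)).2 ?_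
    -- The integrand is positive everywhere and the measure is nonzero, so strict positivity
    -- survives integration.
    have : (Function.support fun x => q (H x)) = Set.univ :=
      Set.eq_univ_of_forall fun x => (hpos _ (hH x)).ne'
    rw [this]
    exact NeZero.pos _
  rw [Complex.pos_iff]
  refine ⟨lt_of_lt_of_eq h2 h, ?_⟩
  have h3 := hsa.im_star_dotProduct_mulVec_self v
  exact h3.symm

/-! ### The approximate Dyson equation -/

namespace MatExp

variable {m r : ℕ} {B : Type*} [CStarAlgebra B] (φ : MatExp m B) {ι : Type*} [Fintype ι]
  {a₀ l : Matrix (Fin m) (Fin m) ℂ} {D : ι → B} {c : ℝ}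

theorem continuous_E_realResolvent (ha₀ : a₀.IsHermitian) (hD : ∀ i, IsSelfAdjoint (D i))
    (hc : 0 < c) (hl : ImGe l c) : Continuous fun x => φ.E (φ.realResolvent a₀ D l x) :=
  φ.EL.continuous.comp (φ.continuous_realResolvent ha₀ hD hc hl)

theorem norm_E_realResolvent_le (ha₀ : a₀.IsHermitian) (hD : ∀ i, IsSelfAdjoint (D i))
    (hc : 0 < c) (hl : ImGe l c) (x : ι → ℝ) :
    ‖φ.E (φ.realResolvent a₀ D l x)‖ ≤ 2 * m ^ 2 * c⁻¹ :=
  φ.norm_E_resolvent_le hc hl (φ.isSelfAdjoint_realPencil ha₀ hD x)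

/-- An approximate Dyson equation for the expected resolvent of a Gaussian pencil. -/
theorem norm_integral_realResolvent_dyson_le [DecidableEq ι] (ha₀ : a₀.IsHermitian)
    (hD : ∀ i, IsSelfAdjoint (D i)) (hc : 0 < c) (hl : ImGe l c) {v : ℝ≥0} (hv : v ≠ 0)
    (a : Fin r → Matrix (Fin m) (Fin m) ℂ) {K₁ K₂ : ℝ} (hK₁ : 0 ≤ K₁) (hK₂ : 0 ≤ K₂)
    (h₁ : ∀ z, ‖φ.E ((∑ i, (v : ℂ) • (D i * z * D i)) * z) - covMap a (φ.E z) * φ.E z‖ ≤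
      K₁ * ‖z‖ ^ 2)
    (h₂ : ∀ i z w p q, ‖φ.E (z * D i * w) p q‖ ≤ K₂ * (‖z‖ * ‖w‖)) :
    ‖(l - a₀ - covMap a (∫ x, φ.E (φ.realResolvent a₀ D l x)
        ∂(Measure.pi fun _ : ι => gaussianReal 0 v))) *
      (∫ x, φ.E (φ.realResolvent a₀ D l x) ∂(Measure.pi fun _ : ι => gaussianReal 0 v)) - 1‖ ≤
      K₁ * c⁻¹ ^ 2 + m ^ 4 * (Fintype.card ι * (2 * (K₂ * c⁻¹ ^ 2) * (K₂ * c⁻¹ ^ 2) * v) *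
        (2 * (∑ j, ‖a j‖) ^ 2)) := by
  set μ := Measure.pi fun _ : ι => gaussianReal 0 v with hμ
  have hR := φ.continuous_realResolvent ha₀ hD hc hl
  have hn := φ.norm_realResolvent_le ha₀ hD hc hl
  have hE := φ.continuous_E_realResolvent ha₀ hD hc hl
  have hEn := φ.norm_E_realResolvent_le ha₀ hD hc hl
  have hc' := inv_pos.2 hc
  obtain ⟨F, hF⟩ : ∃ F : (ι → ℝ) → Matrix (Fin m) (Fin m) ℂ, F = fun x =>
    φ.E ((∑ i, (v : ℂ) • (D i * φ.realResolvent a₀ D l x * D i)) * φ.realResolvent a₀ D l x) -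
      covMap a (φ.E (φ.realResolvent a₀ D l x)) * φ.E (φ.realResolvent a₀ D l x) := ⟨_, rfl⟩
  have hFc : Continuous F := by
    rw [hF]
    refine Continuous.sub (φ.EL.continuous.comp (Continuous.mul (continuous_finsetSum _ fun i _ =>
      ((continuous_const.mul hR).mul continuous_const).const_smul _) hR)) ?_
    exact ((continuous_covMap a).comp hE).mul hE
  have hFn : ∀ x, ‖F x‖ ≤ K₁ * c⁻¹ ^ 2 := fun x => by
    rw [hF]
    refine (h₁ _).trans ?_
    gcongr
    exact hn x
  have hcov : Continuous fun x =>
      covMap a (φ.E (φ.realResolvent a₀ D l x)) * φ.E (φ.realResolvent a₀ D l x) :=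
    ((continuous_covMap a).comp hE).mul hE
  have icov : Integrable (fun x =>
      covMap a (φ.E (φ.realResolvent a₀ D l x)) * φ.E (φ.realResolvent a₀ D l x)) μ :=
    integrable_of_continuous_of_bounded hcov
      (C := 2 * (∑ j, ‖a j‖) ^ 2 * (2 * m ^ 2 * c⁻¹) * (2 * m ^ 2 * c⁻¹)) fun x => by
      refine (norm_mul_le _ _).trans ?_
      gcongr
      · refine (norm_covMap_le a _).trans ?_
        gcongr
        exact hEn x
      · exact hEn x
  have iF : Integrable F μ := integrable_of_continuous_of_bounded hFc hFn
  have hsd := φ.schwinger_dyson_realResolvent ha₀ hD hc hl hv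
  have hsum : ∀ x, φ.E ((∑ i, (v : ℝ) • (D i * φ.realResolvent a₀ D l x * D i)) *
      φ.realResolvent a₀ D l x) = F x +
        covMap a (φ.E (φ.realResolvent a₀ D l x)) * φ.E (φ.realResolvent a₀ D l x) := by
    intro x
    rw [hF]
    simp only [sub_add_cancel, ← Complex.coe_smul]
  simp_rw [hsum] at hsd
  rw [integral_add iF icov] at hsd
  -- The Lipschitz constant combines `h₂` with the two resolvents in `realResolvent_update_sub`,
  -- each of norm at most `c⁻¹`.
  have hL := norm_integral_covMap_mul_sub_le (v := v) a hE (L := K₂ * c⁻¹ ^ 2) hEn (by positivity)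
    (fun x i t p q => by
      rw [← Matrix.sub_apply, ← map_sub, φ.realResolvent_update_sub ha₀ hD hc hl,
        ← Complex.coe_smul, map_smul, Matrix.smul_apply, norm_smul, Complex.norm_real,
        Real.norm_eq_abs, mul_comm]
      gcongr
      refine (h₂ _ _ _ _ _).trans ?_
      rw [pow_two]
      gcongr <;> exact hn _)
  rw [← hμ] at hL
  have heq : ∀ g : Matrix (Fin m) (Fin m) ℂ, (l - a₀ - covMap a g) * g - 1 =
      ((l - a₀) * g - 1) - covMap a g * g := fun g => by rw [sub_mul _ (covMap a g)]; abel
  rw [heq, hsd, add_sub_assoc]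
  refine (norm_add_le _ _).trans (add_le_add ?_ hL)
  refine (norm_integral_le_of_norm_le_const (Filter.Eventually.of_forall hFn)).trans_eq ?_
  simp

end MatExp

/-! ### The expected resolvent of the random matrices -/

section GaussianMean

open scoped MatrixOrder

variable {m r n : ℕ} {a₀ l : Matrix (Fin m) (Fin m) ℂ} {c : ℝ}

/-- The expected sliced resolvent of the Gaussian pencil, as an integral over the entries. -/
noncomputable def gaussianMean (hn : 0 < n) (a₀ : Matrix (Fin m) (Fin m) ℂ)
    (a : Fin r → Matrix (Fin m) (Fin m) ℂ) (l : Matrix (Fin m) (Fin m) ℂ) :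
    Matrix (Fin m) (Fin m) ℂ :=
  ∫ x, (sliceExp m (isState_normTr hn)).E
    ((sliceExp m (isState_normTr hn)).realResolvent a₀ (entryCoeff n a) l x)
    ∂(Measure.pi fun _ : Fin r × Fin n × Fin n => gaussianReal 0 (1 / (n : ℝ≥0)))

theorem norm_gaussianMean_le (hn : 0 < n) (ha₀ : a₀.IsHermitian)
    (a : Fin r → Matrix (Fin m) (Fin m) ℂ) (hc : 0 < c) (hl : ImGe l c) :
    ‖gaussianMean hn a₀ a l‖ ≤ 2 * m ^ 2 * c⁻¹ := by
  refine (norm_integral_le_of_norm_le_const (Filter.Eventually.of_forall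
    ((sliceExp m (isState_normTr hn)).norm_E_realResolvent_le ha₀
      (isSelfAdjoint_entryCoeff a) hc hl))).trans_eq ?_
  simp

theorem posDef_neg_matIm_gaussianMean (hn : 0 < n) (ha₀ : a₀.IsHermitian)
    (a : Fin r → Matrix (Fin m) (Fin m) ℂ) (hc : 0 < c) (hl : ImGe l c) :
    (-matIm (gaussianMean hn a₀ a l)).PosDef := by
  set φ := sliceExp m (isState_normTr hn) with hφ
  exact posDef_neg_matIm_integral
    (integrable_of_continuous_of_bounded
      (φ.continuous_E_realResolvent ha₀ (isSelfAdjoint_entryCoeff a) hc hl)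
      (φ.norm_E_realResolvent_le ha₀ (isSelfAdjoint_entryCoeff a) hc hl))
    fun x => φ.posDef_neg_matIm_E_resolvent hc hl
      (φ.isSelfAdjoint_realPencil ha₀ (isSelfAdjoint_entryCoeff a) x)

/-- The expected sliced resolvent solves the matrix Dyson equation up to an error of order
`1 / n`. -/
theorem norm_gaussianMean_dyson_le (hn : 0 < n) (ha₀ : a₀.IsHermitian)
    (a : Fin r → Matrix (Fin m) (Fin m) ℂ) (hc : 0 < c) (hl : ImGe l c) :
    ‖(l - a₀ - covMap a (gaussianMean hn a₀ a l)) * gaussianMean hn a₀ a l - 1‖ ≤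
      (16 * r * m ^ 6 * (∑ j, ‖a j‖) ^ 4 + 4 * m ^ 3 * (∑ j, ‖a j‖) ^ 2) / n *
        (c⁻¹ ^ 4 + c⁻¹ ^ 2) := by
  have hn0 : (n : ℝ) ≠ 0 := by exact_mod_cast hn.ne'
  have hv : (1 / (n : ℝ≥0)) ≠ 0 := by
    have : (n : ℝ≥0) ≠ 0 := by exact_mod_cast hn.ne'
    positivity
  have hvc : (((1 / (n : ℝ≥0) : ℝ≥0) : ℝ) : ℂ) = (n : ℂ)⁻¹ := by simp
  obtain ⟨σ, hσ⟩ : ∃ σ, σ = ∑ j, ‖a j‖ := ⟨_, rfl⟩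
  have hσ0 : 0 ≤ σ := hσ ▸ Finset.sum_nonneg fun _ _ => norm_nonneg _
  have hc' := inv_pos.2 hc
  refine ((sliceExp m (isState_normTr hn)).norm_integral_realResolvent_dyson_le ha₀
    (isSelfAdjoint_entryCoeff a) hc hl hv a (K₁ := 4 * m ^ 3 * (∑ j, ‖a j‖) ^ 2 * (n : ℝ)⁻¹)
    (K₂ := 2 * m * σ * (n : ℝ)⁻¹) (by positivity) (by positivity)
    (fun z => ?_) (fun i z w p q => ?_)).trans ?_
  · rw [hvc]
    exact norm_E_sum_entryCoeff_mul_sub_le hn a z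
  · refine (norm_E_mul_entryCoeff_mul_apply_le hn a i z w p q).trans ?_
    gcongr
    rw [hσ]
    exact Finset.single_le_sum (f := fun j => ‖a j‖) (fun _ _ => norm_nonneg _)
      (Finset.mem_univ _)
  · rw [← hσ]
    have e : ((1 / (n : ℝ≥0) : ℝ≥0) : ℝ) = (n : ℝ)⁻¹ := by simp
    rw [e]
    simp only [Fintype.card_prod, Fintype.card_fin, Nat.cast_mul]
    -- The coordinate count `r n²` meets three factors `1/n`, two from Lipschitz constants and one
    -- from the variance, which leaves `1/n`.
    have e2 : 4 * (m : ℝ) ^ 3 * σ ^ 2 * (n : ℝ)⁻¹ * c⁻¹ ^ 2 + m ^ 4 *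
        (r * (n * n) * (2 * (2 * m * σ * (n : ℝ)⁻¹ * c⁻¹ ^ 2) *
          (2 * m * σ * (n : ℝ)⁻¹ * c⁻¹ ^ 2) * (n : ℝ)⁻¹) * (2 * σ ^ 2)) =
        4 * m ^ 3 * σ ^ 2 / n * c⁻¹ ^ 2 + 16 * r * m ^ 6 * σ ^ 4 / n * c⁻¹ ^ 4 := by
      field_simp
      ring
    rw [e2, add_div]
    have p1 : 0 ≤ 4 * (m : ℝ) ^ 3 * σ ^ 2 / n * c⁻¹ ^ 4 := by positivity
    have p2 : 0 ≤ 16 * r * (m : ℝ) ^ 6 * σ ^ 4 / n * c⁻¹ ^ 2 := by positivity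
    linarith

/-- The matrix Dyson equation is solvable. -/
theorem exists_isDysonSol (ha₀ : a₀.IsHermitian) (a : Fin r → Matrix (Fin m) (Fin m) ℂ)
    (hc : 0 < c) (hl : ImGe l c) : ∃ g, IsDysonSol a₀ a l g ∧ ‖g‖ ≤ 2 * m ^ 2 * c⁻¹ := by
  -- The means stay in a compact ball of matrices and their Dyson errors tend to zero, so any limit
  -- point is an exact solution obeying the same norm bound.
  obtain ⟨g, hg, k, hk, hlim⟩ := tendsto_subseq_of_bounded
    (Metric.isBounded_closedBall (x := (0 : Matrix (Fin m) (Fin m) ℂ)) (r := 2 * m ^ 2 * c⁻¹))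
    (x := fun n : ℕ => gaussianMean n.succ_pos a₀ a l)
    fun n => mem_closedBall_zero_iff.2 (norm_gaussianMean_le n.succ_pos ha₀ a hc hl)
  rw [Metric.isClosed_closedBall.closure_eq, mem_closedBall_zero_iff] at hg
  refine ⟨g, ?_, hg⟩
  have h1 : Filter.Tendsto (fun n => (l - a₀ - covMap a (gaussianMean (k n).succ_pos a₀ a l)) *
      gaussianMean (k n).succ_pos a₀ a l - 1) Filter.atTop
      (nhds ((l - a₀ - covMap a g) * g - 1)) :=
    (((continuous_const.sub (continuous_covMap a)).mul continuous_id).sub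
      continuous_const).continuousAt.tendsto.comp hlim
  have h2 : Filter.Tendsto (fun n => (l - a₀ - covMap a (gaussianMean (k n).succ_pos a₀ a l)) *
      gaussianMean (k n).succ_pos a₀ a l - 1) Filter.atTop (nhds 0) := by
    refine squeeze_zero_norm (fun n => norm_gaussianMean_dyson_le (k n).succ_pos ha₀ a hc hl) ?_
    rw [← zero_mul (c⁻¹ ^ 4 + c⁻¹ ^ 2)]
    refine Filter.Tendsto.mul_const _ ?_
    exact ((tendsto_const_div_atTop_nhds_zero_nat _).comp (Filter.tendsto_add_atTop_nat 1)).comp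
      hk.tendsto_atTop
  exact sub_eq_zero.1 (tendsto_nhds_unique h1 h2)

variable {Ω : Type*} [MeasurableSpace Ω] {P : Measure Ω} [IsProbabilityMeasure P]

/-- Independence between the matrices and within each one combine into joint independence of all `r
n²` entries, so expectations depend only on the product Gaussian law. -/
theorem map_entries_eq_pi {v : ℝ≥0} {Y : Fin r → Ω → Matrix (Fin n) (Fin n) ℝ}
    (hY : ∀ j, IsGRMReal P v (Y j))
    (hind : iIndepFun (fun (j : Fin r) ω (p : Fin n × Fin n) => Y j ω p.1 p.2) P) :
    P.map (fun ω (i : Fin r × Fin n × Fin n) => Y i.1 ω i.2.1 i.2.2) =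
      Measure.pi fun _ : Fin r × Fin n × Fin n => gaussianReal 0 v := by
  have h := iIndepFun_uncurry' (X := fun (j : Fin r) (p : Fin n × Fin n) ω => Y j ω p.1 p.2)
    (fun j p => (hY j).measurable _ _) hind fun j => (hY j).indep
  refine ((iIndepFun_iff_map_fun_eq_pi_map (f := fun (i : Fin r × Fin n × Fin n) ω =>
    Y i.1 ω i.2.1 i.2.2) fun i => ((hY i.1).measurable i.2.1 i.2.2).aemeasurable).1 h).trans ?_
  congr 1
  funext i
  exact (hY i.1).law _ _

theorem Gn_eq_gaussianMean (hn : 0 < n) (ha₀ : a₀.IsHermitian)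
    (a : Fin r → Matrix (Fin m) (Fin m) ℂ) {Y : Fin r → Ω → Matrix (Fin n) (Fin n) ℝ}
    (hY : ∀ j, IsGRMReal P (1 / (n : ℝ≥0)) (Y j))
    (hind : iIndepFun (fun (j : Fin r) ω (p : Fin n × Fin n) => Y j ω p.1 p.2) P)
    (hc : 0 < c) (hl : ImGe l c) : Gn P a₀ a Y l = gaussianMean hn a₀ a l := by
  set φ := sliceExp m (isState_normTr hn) with hφ
  have hH : ∀ ω, Hn a₀ a Y l ω =
      φ.E (φ.realResolvent a₀ (entryCoeff n a) l fun i => Y i.1 ω i.2.1 i.2.2) := by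
    intro ω
    rw [Hn, slicedResolvent_eq (isState_normTr hn), ofMatrix_linPencil_eq_sum_entryCoeff,
      MatExp.realResolvent, MatExp.realPencil]
    simp only [← Complex.coe_smul]
    rfl
  have hEc := φ.continuous_E_realResolvent (D := entryCoeff n a) ha₀
    (isSelfAdjoint_entryCoeff a) hc hl
  ext p q
  let ent : Matrix (Fin m) (Fin m) ℂ →L[ℂ] ℂ :=
    (Matrix.entryLinearMap ℂ ℂ p q).toContinuousLinearMap
  have h1 : gaussianMean hn a₀ a l p q = ∫ x, ent (φ.E (φ.realResolvent a₀ (entryCoeff n a) l x))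
      ∂(Measure.pi fun _ : Fin r × Fin n × Fin n => gaussianReal 0 (1 / (n : ℝ≥0))) :=
    (ent.integral_comp_comm (integrable_of_continuous_of_bounded hEc
      (φ.norm_E_realResolvent_le ha₀ (isSelfAdjoint_entryCoeff a) hc hl))).symm
  rw [h1, ← map_entries_eq_pi hY hind]
  refine Eq.trans ?_ (integral_map
    (measurable_pi_lambda _ fun i => (hY i.1).measurable _ _).aemeasurable
    (f := fun x => ent (φ.E (φ.realResolvent a₀ (entryCoeff n a) l x)))
    (ent.continuous.comp hEc).aestronglyMeasurable).symm
  change ∫ ω, Hn a₀ a Y l ω p q ∂P = _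
  simp_rw [hH]
  rfl

end GaussianMean

/-! ### Assembly of the estimate -/

theorem mainTheorem11 {m r : ℕ} (hm : 0 < m) (hr : 0 < r)
    (a₀ : Matrix (Fin m) (Fin m) ℂ) (ha₀ : a₀.IsHermitian)
    (a : Fin r → Matrix (Fin m) (Fin m) ℂ) :
    ∃ C₂ : ℝ,
      ∀ (Ω : Type*) [MeasurableSpace Ω] (P : Measure Ω) [IsProbabilityMeasure P]
        (Y : (n : ℕ) → Fin r → Ω → Matrix (Fin n) (Fin n) ℝ)
        (_ : ∀ n : ℕ, 0 < n → ∀ j, IsGRMReal P (1 / (n : ℝ≥0)) (Y n j))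
        (_ : ∀ n : ℕ, 0 < n →
          iIndepFun (fun (j : Fin r) ω (p : Fin n × Fin n) => Y n j ω p.1 p.2) P)
        (A : Type*) [CStarAlgebra A] (τ : A →ₗ[ℂ] ℂ) (_ : IsState τ)
        (y : Fin r → A) (_ : IsCircularSystem τ y)
        (l : Matrix (Fin m) (Fin m) ℂ) (_ : (matIm l).PosDef) (n : ℕ) (_ : 0 < n),
        ‖Gn P a₀ a (Y n) l - Glim τ a₀ a y l‖ ≤
          C₂ / n * (‖l‖ + (‖a₀‖ + 16 * ∑ j, ‖a j‖)) ^ 2 *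
            (‖(matIm l)⁻¹‖ ^ 7 + ‖(matIm l)⁻¹‖ ^ 5) := by
  -- The stability constant `8C(1 + 2C)` with `C = 2m²`, times the constant of
  -- `norm_gaussianMean_dyson_le`.
  refine ⟨8 * (2 * m ^ 2) * (1 + 2 * (2 * m ^ 2)) *
    (16 * r * m ^ 6 * (∑ j, ‖a j‖) ^ 4 + 4 * m ^ 3 * (∑ j, ‖a j‖) ^ 2), ?_⟩
  intro Ω _ P _ Y hY hind A _ τ hτ y hy l hl n hn
  let _ := CStarAlgebra.spectralOrder A
  have _ := CStarAlgebra.spectralOrderedRing A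
  obtain ⟨hκ, hge⟩ := imGe_inv_norm hl hm
  have hκ' := inv_pos.2 hκ
  have hsa : IsSelfAdjoint (CStarMatrix.ofMatrix (linPencil a₀ a y)) :=
    isSelfAdjoint_linPencil ha₀ a y
  have hσ0 : 0 ≤ ∑ j, ‖a j‖ := Finset.sum_nonneg fun _ _ => norm_nonneg _
  have hcl : ‖(matIm l)⁻¹‖⁻¹ ≤ ‖l‖ := by
    rw [inv_le_iff_one_le_mul₀ hκ]
    exact one_le_norm_mul_norm_inv_matIm hl hm
  rw [Gn_eq_gaussianMean hn ha₀ a (hY n hn) (hind n hn) hκ' hge]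
  refine (norm_sub_le_of_approx_dyson hm ha₀ (G := Glim τ a₀ a y) (C := 2 * m ^ 2)
    (K := ‖a₀‖ + 16 * ∑ j, ‖a j‖) (by positivity)
    (fun l' c hc hl' => ⟨isDysonSol_Glim hτ hy ha₀
      (fun _ _ hc hl => exists_isDysonSol ha₀ a hc hl) hc hl', ?_, ?_⟩)
    (fun l₁ c₁ l₂ c₂ hc₁ hl₁ hc₂ hl₂ => ?_) hκ' hge hcl
    (posDef_neg_matIm_gaussianMean hn ha₀ a hκ' hge) (norm_gaussianMean_le hn ha₀ a hκ' hge)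
    (norm_gaussianMean_dyson_le hn ha₀ a hκ' hge) (by linarith)
    (by linarith [norm_nonneg a₀])).trans_eq ?_
  · rw [Glim, slicedResolvent_eq hτ]
    exact (sliceExp m hτ).posDef_neg_matIm_E_resolvent hc hl' hsa
  · rw [Glim, slicedResolvent_eq hτ]
    exact (sliceExp m hτ).norm_E_resolvent_le hc hl' hsa
  · rw [Glim, Glim, slicedResolvent_eq hτ, slicedResolvent_eq hτ]
    exact (sliceExp m hτ).norm_E_resolvent_sub_le hc₁ hl₁ hc₂ hl₂ hsa
  -- The factor `k³` from stability multiplies `k⁴ + k²` to `k⁷ + k⁵`.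
  · rw [inv_inv]
    ring
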